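/- Let $M\ge n\ge 2$ and $N\ge 1$ be integers. For $0<\delta<\frac1{M-1}$ put $$\mu_n(\delta)=\sum_{k=n-1}^{M-1}\binom{M-1}{k}(-1)^k\Big[\sum_{i=0}^{n-1}\binom{n-1}{i}(-1)^i i^k\Big]\delta^k$$ and $$F_{\delta}(x)=\begin{cases}0,& x\le 1-(n-1)\delta,\\[2pt] 1-\dfrac{\Gamma(M)}{\Gamma(M-n+1)\,\mu_n(\delta)}\displaystyle\int_{R_x}\Big(1-\sum_{i=1}^{n-1}t_i\Big)^{M-n}dt_1\cdots dt_{n-1},& 1-(n-1)\delta<x\le 1,\\[2pt] 1,& x>1,\end{cases}$$ where $R_x$ is the set of $t\in\mathbb R^{n-1}$ with $0\le t_i\le\min\{\delta,\,1-x-\sum_{j=i+1}^{n-1}t_j\}$ for all $i$. Then $\mu_n(\delta)>0$. Let $F_{\bar\beta}$ and $F_{\tilde\beta}$ be the functions that equal $0$ for $x\le 1-(n-1)\delta$, equal $1$ for $x>1$, and for $1-(n-1)\delta<x\le1$ are given by $$F_{\bar\beta}(x)=1-\frac{I_{1-x}(n-1,M-n+1)}{\mu_n(\delta)},\qquad F_{\tilde\beta}(x)=1-\frac{\mu_n\big(\frac{1-x}{n-1}\big)}{\mu_n(\delta)},$$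 where $I_x(a,b)$ is the regularized incomplete beta function. Then the following hold. (a) Let $v$ be a random vector that is isotropically distributed on the unit sphere of $\mathbb C^M$ and independent of the random orthonormal vectors $q_1,\dots,q_{n-1}\in\mathbb C^M$. Then $\Pr(|v^Hq_i|^2<\delta,\ i<n)=\mu_n(\delta)$. The c.d.f. $F_{\beta(n)}(x)=\Pr\big(\|v-\sum_{i<n}(q_i^Hv)q_i\|^2\le x\,\big|\,|v^Hq_i|^2<\delta,\ i<n\big)$ equals $F_\delta(x)$ for all real $x$, and $F_{\bar\beta}(x)\le F_{\beta(n)}(x)\le F_{\tilde\beta}(x)$. In particular $F_{\bar\beta}\le F_\delta\le F_{\tilde\beta}$. (b) If $n=2$, then $F_{\bar\beta}=F_{\beta(2)}=F_{\tilde\beta}$, and $F_{\beta(2)}(x)$ is $0$ for $x\le1-\delta$, $\dfrac{x^{M-1}-(1-\delta)^{M-1}}{1-(1-\delta)^{M-1}}$ for $1-\delta<x\le1$, and $1$ for $x>1$. The same holds with $F_\delta$ in place of $F_{\beta(2)}$. (c) Let $H_1,H_2,\dots$ be independent $N\times M$ random matrices with i.i.d. $\mathcal{CN}(0,1)$ entries,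 $\lambda_k$ the largest eigenvalue of $H_k^HH_k$, and $v_k$ a (measurable) unit eigenvector for it. Given $K$ and $\delta$, run semi-orthogonal user selection. Start from $U_1=\{1,\dots,K\}$. At iteration $m$ put $\xi_k=v_k-\sum_{i<m}(q_i^Hv_k)q_i$ and $\beta_k(m)=\|\xi_k\|^2$ for $k\in U_m$, and select $\pi(m)\in\arg\max_{k\in U_m}\lambda_k\beta_k(m)$. Then put $q_m=\xi_{\pi(m)}/\|\xi_{\pi(m)}\|$ and $U_{m+1}=\{k\in U_m: k\ne\pi(m),\ |v_k^Hq_m|^2<\delta\}$. Stop when there are no candidates left. Let $\delta=\delta_K\in(0,\frac1{M-1})$ with $K\delta_K^{M-1}\to\infty$ as $K\to\infty$ (for example, $\delta$ constant). Then, for all sufficiently large $K$, $\Pr(k\in U_n)>0$ for all $k\le K$, and $$\sup_{k\le K}\ \sup_{x\in\mathbb R}\ \Big|\Pr\big(\beta_k(n)\le x\,\big|\,k\in U_n\big)-F_{\delta_K}(x)\Big|\longrightarrow 0\qquad(K\to\infty).$$ -/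

import Mathlib

open MeasureTheory ProbabilityTheory Filter Matrix
open scoped NNReal

noncomputable section

/-- Column vectors of length `M`, with the Hermitian norm. -/
abbrev CVec (M : ℕ) : Type := EuclideanSpace ℂ (Fin M)

/-- The standard circularly symmetric complex Gaussian law `CN(0,1)`: independent real and imaginary
parts, each `N(0,1/2)`. -/
def stdComplexGaussian : Measure ℂ :=
  ((gaussianReal 0 (1 / 2)).prod (gaussianReal 0 (1 / 2))).map Complex.measurableEquivRealProd.symm

/-- The largest eigenvalue of `Aᴴ A`, i.e. the square of the largest singular value of `A`. -/
def maxGramEigenvalue {N M : ℕ} (A : Matrix (Fin N) (Fin M) ℂ) : ℝ :=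
  ⨆ i : Fin M, (isHermitian_conjTranspose_mul_self A).eigenvalues i

/-- `v` is a principal right singular vector of `A`: a unit eigenvector of `Aᴴ A` for its largest
eigenvalue. -/
def IsPrincipalVector {N M : ℕ} (A : Matrix (Fin N) (Fin M) ℂ) (v : CVec M) : Prop :=
  ‖v‖ = 1 ∧ (Aᴴ * A) *ᵥ (⇑v) = (maxGramEigenvalue A : ℂ) • (⇑v)

/-- The Gram-Schmidt residual `v - ∑ (uᴴ v) u`, summed over the vectors `u` in the list `q`. -/
def gsResidual {M : ℕ} (q : List (CVec M)) (v : CVec M) : CVec M :=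
  v - (q.map fun u => inner ℂ u v • u).sum

/-- What the semi-orthogonal user selection (SUS) holds at the start of an iteration: the candidate
set and the orthonormal vectors generated so far, oldest first. -/
structure SUSState (M K : ℕ) where
  cand : Finset (Fin K)
  basis : List (CVec M)

/-- A candidate `k` that maximizes `γ k` (the least index, in case of a tie); `none` if and only if
there are no candidates. -/
def susSelect {K : ℕ} (S : Finset (Fin K)) (γ : Fin K → ℝ) : Option (Fin K) :=
  ((List.finRange K).filter fun k => k ∈ S).argmax γ

open Classical in
/-- One iteration: select the candidate `p` maximizing `lam k * ‖ξ_k‖ ^ 2`, where `ξ_k` is the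
residual of `v k`; add `q = ξ_p / ‖ξ_p‖` to the basis; remove `p` and all users that violate the
semi-orthogonality criterion `|(v k)ᴴ q|² < δ`. The procedure stands still when there are no
candidates left. -/
def susStep {M K : ℕ} (lam : Fin K → ℝ) (v : Fin K → CVec M) (δ : ℝ) (s : SUSState M K) :
    SUSState M K :=
  match susSelect s.cand (fun k => lam k * ‖gsResidual s.basis (v k)‖ ^ 2) with
  | none => s
  | some p =>
    let q : CVec M := ((‖gsResidual s.basis (v p)‖⁻¹ : ℝ) : ℂ) • gsResidual s.basis (v p)
    { cand := s.cand.filter fun k => k ≠ p ∧ ‖(inner ℂ (v k) q : ℂ)‖ ^ 2 < δ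
      basis := s.basis ++ [q] }

/-- The state `(U_n, (q_1, …, q_{n-1}))` of the SUS procedure at iteration `n ≥ 1`. It starts from
the set `U_1` of all users and from no vectors. -/
def susState {M K : ℕ} (lam : Fin K → ℝ) (v : Fin K → CVec M) (δ : ℝ) (n : ℕ) : SUSState M K :=
  (susStep lam v δ)^[n - 1] { cand := Finset.univ, basis := [] }

section Downlink

variable {Ω : Type*} {N M : ℕ}

/-- The channel matrix `H_k` of user `k`, from its entries. -/
def channel (h : ℕ → Fin N → Fin M → Ω → ℂ) (k : ℕ) (ω : Ω) : Matrix (Fin N) (Fin M) ℂ :=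
  Matrix.of fun i j => h k i j ω

/-- The SUS state at iteration `n`, when it is run with the first `K` users. -/
def downlinkState (h : ℕ → Fin N → Fin M → Ω → ℂ) (v : ℕ → Ω → CVec M) (K : ℕ) (δ : ℝ) (n : ℕ)
    (ω : Ω) : SUSState M K :=
  susState (fun k : Fin K => maxGramEigenvalue (channel h k ω)) (fun k : Fin K => v k ω) δ n

/-- The event `k ∈ U_n`. -/
def candEvent (h : ℕ → Fin N → Fin M → Ω → ℂ) (v : ℕ → Ω → CVec M) {K : ℕ} (δ : ℝ) (n : ℕ)
    (k : Fin K) : Set Ω :=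
  {ω | k ∈ (downlinkState h v K δ n ω).cand}

/-- The projection variable `β_k(n) = ‖ξ_k‖²` of user `k` at iteration `n`. -/
def projVar (h : ℕ → Fin N → Fin M → Ω → ℂ) (v : ℕ → Ω → CVec M) {K : ℕ} (δ : ℝ) (n : ℕ)
    (k : Fin K) (ω : Ω) : ℝ :=
  ‖gsResidual (downlinkState h v K δ n ω).basis (v k ω)‖ ^ 2

/-- `P(β_k(n) ≤ x | k ∈ U_n)` for the SUS procedure with `K` users. -/
def susCDF [MeasurableSpace Ω] (P : Measure Ω) (h : ℕ → Fin N → Fin M → Ω → ℂ)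
    (v : ℕ → Ω → CVec M) {K : ℕ} (δ : ℝ) (n : ℕ) (k : Fin K) (x : ℝ) : ℝ :=
  (ProbabilityTheory.cond P (candEvent h v δ n k)).real {ω | projVar h v δ n k ω ≤ x}

/-- The random vector `v` is isotropically distributed on the complex unit sphere. -/
structure IsIsotropicUnit [MeasurableSpace Ω] (P : Measure Ω) (v : Ω → CVec M) : Prop where
  measurable : Measurable v
  norm_eq_one : ∀ᵐ ω ∂P, ‖v ω‖ = 1
  map_eq : ∀ U : CVec M ≃ₗᵢ[ℂ] CVec M, P.map (fun ω => U (v ω)) = P.map v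

/-- The event `|vᴴ q_i|² < δ` for all `i`. -/
def semiOrthEvent {m : ℕ} (v : Ω → CVec M) (q : Fin m → Ω → CVec M) (δ : ℝ) : Set Ω :=
  {ω | ∀ i, ‖(inner ℂ (v ω) (q i ω) : ℂ)‖ ^ 2 < δ}

/-- `P(‖v - ∑ (q_iᴴ v) q_i‖² ≤ x | |vᴴ q_i|² < δ for all i)`. -/
def betaCDF [MeasurableSpace Ω] {m : ℕ} (P : Measure Ω) (v : Ω → CVec M) (q : Fin m → Ω → CVec M)
    (δ x : ℝ) : ℝ :=
  (ProbabilityTheory.cond P (semiOrthEvent v q δ)).real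
    {ω | ‖v ω - ∑ i, inner ℂ (q i ω) (v ω) • q i ω‖ ^ 2 ≤ x}

end Downlink

/-- The polynomial `μ_n(δ)`. -/
def muPoly (M n : ℕ) (δ : ℝ) : ℝ :=
  ∑ k ∈ Finset.Icc (n - 1) (M - 1), ((M - 1).choose k : ℝ) * (-1) ^ k *
    (∑ i ∈ Finset.range n, ((n - 1).choose i : ℝ) * (-1) ^ i * (i : ℝ) ^ k) * δ ^ k

/-- The region `t_i ∈ [0, min (δ, 1 - x - ∑_{j > i} t_j)]`. -/
def betaRegion (m : ℕ) (δ x : ℝ) : Set (Fin m → ℝ) :=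
  {t | ∀ i, t i ∈ Set.Icc 0 (min δ (1 - x - ∑ j ∈ Finset.Ioi i, t j))}

/-- The c.d.f. of the projection variable as a multiple integral. -/
def betaFormula (M n : ℕ) (δ x : ℝ) : ℝ :=
  if x ≤ 1 - ((n : ℝ) - 1) * δ then 0
  else if x ≤ 1 then
    1 - Real.Gamma M / (Real.Gamma ((M : ℝ) - n + 1) * muPoly M n δ) *
      ∫ t in betaRegion (n - 1) δ x, (1 - ∑ i, t i) ^ (M - n)
  else 1

/-- The closed form for `n = 2`. -/
def betaFormulaTwo (M : ℕ) (δ x : ℝ) : ℝ :=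
  if x ≤ 1 - δ then 0
  else if x ≤ 1 then (x ^ (M - 1) - (1 - δ) ^ (M - 1)) / (1 - (1 - δ) ^ (M - 1))
  else 1

/-- The regularized incomplete beta function `I_x(a, b)`. -/
def regIncBeta (x a b : ℝ) : ℝ :=
  (∫ t in (0 : ℝ)..x, t ^ (a - 1) * (1 - t) ^ (b - 1)) / ProbabilityTheory.beta a b

/-- The upper bound for the c.d.f. -/
def betaUpper (M n : ℕ) (δ x : ℝ) : ℝ :=
  if x ≤ 1 - ((n : ℝ) - 1) * δ then 0
  else if x ≤ 1 then 1 - muPoly M n ((1 - x) / ((n : ℝ) - 1)) / muPoly M n δ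
  else 1

/-- The lower bound for the c.d.f. -/
def betaLower (M n : ℕ) (δ x : ℝ) : ℝ :=
  if x ≤ 1 - ((n : ℝ) - 1) * δ then 0
  else if x ≤ 1 then 1 - regIncBeta (1 - x) ((n : ℝ) - 1) ((M : ℝ) - n + 1) / muPoly M n δ
  else 1

end

open scoped ENNReal

noncomputable section

/-! There is only one isotropic law on the unit sphere of `ℂ^M`, that of a normalized Gaussian
vector. The squared moduli of its coordinates are independent exponential variables divided by their
sum. Hence the numbers `t_i = |vᴴ q_i|²`, for `n - 1` orthonormal vectors, have the Dirichlet law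
with density proportional to `(1 - ∑ t_i)^(M-n)` on the solid simplex (`IsotropicLaw.map_sq_inner`).
Random `q_i` that are independent of `v` are handled by Fubini (`measure_sq_inner_mem`).

By Pythagoras the squared residual is `1 - ∑ t_i`, so (a) and (b) only concern the Dirichlet law.
Its survival function is `(1 - ∑ a_i)^(M-1)` (`dirichlet_survival`). Inclusion-exclusion gives the
probability of the box `[0, δ)^(n-1)`, and expanding the powers gives `μ_n(δ)`, because alternating
binomial sums kill all powers below `n - 1`. The c.d.f. is `1 - D(R_x) / μ_n(δ)`. Replacing `R_x` by
the larger set `∑ t_i ≤ 1 - x` gives the lower bound; replacing it by the smaller cube of side `(1 -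
x)/(n - 1)` gives the upper one. For `n = 2` the three regions agree up to null sets.

For (c), compare with the selection run without user `k`. If `k` is not selected, both runs coincide
(`susHist_erase_eq`), and the vectors of the run without `k` are independent of `v_k`. So, when that
run does not get stuck, passing its tests and the residual follow the Dirichlet law exactly
(`UserLaw.measure_passEvent_inter`). Two things can disturb this. First, `k` itself is selected: by
exchangeability this has probability at most `(n - 1)/K`, negligible against `μ_n(δ) ≥ c δ^(M-1)`
since `K δ^(M-1) → ∞`. Second, the run without `k` gets stuck: a union bound over the selected users
gives at most `∑ K^i (1 - c δ^(M-2))^(K-1-i) → 0`. The probability of not being stuck multiplies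
numerator and denominator alike, so a lower bound of `1/2` suffices.

It remains to put the channel in this form. Almost surely the principal eigenvector is unique up to
phase, and the selection ignores phases (`susHist_phase`). So `v_k` may be replaced by a canonical
eigenvector obtained by power iteration. It is a measurable function of `H_k`, commutes with unitary
maps (hence is isotropic) and ignores scaling. The selection metric is therefore homogeneous of
degree two in the channel, and so has no atoms and no ties (`userLaw_userMeasure`). -/

/-! ### Beta integrals and the coordinate sum on the orthant. -/

lemma integral_sub_pow_mul_pow (k m : ℕ) (r : ℝ) :
    ∫ s in (0 : ℝ)..r, (r - s) ^ k * s ^ m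
      = (k.factorial * m.factorial / (k + m + 1).factorial : ℝ) * r ^ (k + m + 1) := by
  induction k generalizing m with
  | zero =>
    simp only [pow_zero, one_mul, integral_pow, Nat.factorial_zero, zero_add, Nat.factorial_succ]
    have := Nat.factorial_ne_zero m
    push_cast
    field_simp
    simp
  | succ k ih =>
    -- Integration by parts moves one power from `r - s` to `s`, with vanishing boundary terms; this
    -- is why `m` stays general in the induction on `k`.
    have hparts := intervalIntegral.integral_mul_deriv_eq_deriv_mul (a := (0 : ℝ)) (b := r)
      (u := fun s => (r - s) ^ (k + 1)) (u' := fun s => -((k + 1 : ℕ) * (r - s) ^ k))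
      (v := fun s => s ^ (m + 1) / (m + 1 : ℝ)) (v' := fun s => s ^ m)
      (fun s _ => by
        have h := ((hasDerivAt_id' s).const_sub r).fun_pow (k + 1)
        simpa using h)
      (fun s _ => by
        have h := (hasDerivAt_pow (m + 1) s).div_const (m + 1 : ℝ)
        have hm : (m + 1 : ℝ) ≠ 0 := by positivity
        convert h using 1
        push_cast
        field_simp)
      (Continuous.intervalIntegrable (by fun_prop) _ _)
      (Continuous.intervalIntegrable (by fun_prop) _ _)
    rw [hparts]
    have h2 : (fun s : ℝ => -((k + 1 : ℕ) * (r - s) ^ k) * (s ^ (m + 1) / (m + 1 : ℝ)))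
        = fun s => (-(k + 1 : ℝ) / (m + 1)) * ((r - s) ^ k * s ^ (m + 1)) := by
      ext s; push_cast; ring
    rw [h2, intervalIntegral.integral_const_mul, ih (m + 1)]
    have e : k + (m + 1) + 1 = k + 1 + m + 1 := by ring
    rw [e, Nat.factorial_succ m, Nat.factorial_succ k]
    have := Nat.factorial_ne_zero (k + 1 + m + 1)
    push_cast
    field_simp
    simp

lemma setLIntegral_Icc_pow (m : ℕ) {u : ℝ} (hu : 0 ≤ u) :
    ∫⁻ s in Set.Icc 0 u, ENNReal.ofReal (s ^ m / m.factorial)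
      = ENNReal.ofReal (u ^ (m + 1) / (m + 1).factorial) := by
  rw [← ofReal_integral_eq_lintegral_ofReal, integral_Icc_eq_integral_Ioc,
    ← intervalIntegral.integral_of_le hu, intervalIntegral.integral_div, integral_pow,
    Nat.factorial_succ]
  · have := Nat.factorial_ne_zero m
    congr 1
    push_cast
    field_simp
    simp
  · exact Continuous.integrableOn_Icc (by fun_prop)
  · filter_upwards [ae_restrict_mem measurableSet_Icc] with s hs
    have := hs.1
    simp only [Pi.zero_apply]
    positivity

/-- The sum of the coordinates maps Lebesgue measure on the orthant to `s ^ m / m! ds`. -/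
lemma lintegral_orthant_sum (m : ℕ) {g : ℝ → ℝ≥0∞} (hg : Measurable g) :
    ∫⁻ t in {t : Fin (m + 1) → ℝ | ∀ i, 0 ≤ t i}, g (∑ i, t i)
      = ∫⁻ s in Set.Ici 0, g s * ENNReal.ofReal (s ^ m / m.factorial) := by
  have hmeas : ∀ m : ℕ, MeasurableSet {t : Fin (m + 1) → ℝ | ∀ i, 0 ≤ t i} := fun m => by
    measurability
  induction m generalizing g with
  | zero =>
    rw [← lintegral_indicator (hmeas 0), ← lintegral_indicator measurableSet_Ici,
      ← (volume_preserving_funUnique (Fin 1) ℝ).lintegral_comp (by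
        apply Measurable.indicator (by fun_prop) measurableSet_Ici)]
    congr 1
    ext t
    simp [Set.indicator_apply]
  | succ m ih =>
    have hgf : Measurable fun p : ℝ × (Fin (m + 1) → ℝ) =>
        (Set.Ici (0 : ℝ)).indicator (fun _ =>
          {t : Fin (m + 1) → ℝ | ∀ i, 0 ≤ t i}.indicator (fun t => g (p.1 + ∑ i, t i)) p.2) p.1 := by
      have h1 : MeasurableSet {p : ℝ × (Fin (m + 1) → ℝ) | 0 ≤ p.1 ∧ ∀ i, 0 ≤ p.2 i} := by
        measurability
      have h2 : Measurable fun p : ℝ × (Fin (m + 1) → ℝ) => g (p.1 + ∑ i, p.2 i) := by fun_prop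
      convert h2.indicator h1 using 1
      ext p
      by_cases h3 : 0 ≤ p.1 <;> by_cases h4 : ∀ i, 0 ≤ p.2 i <;> simp [h3, h4]
    have h1 := (volume_preserving_piFinSuccAbove (fun _ : Fin (m + 2) => ℝ) 0).lintegral_comp hgf
    rw [← lintegral_indicator (hmeas (m + 1))]
    have h2 : ∀ t : Fin (m + 2) → ℝ,
        {t : Fin (m + 2) → ℝ | ∀ i, 0 ≤ t i}.indicator (fun t => g (∑ i, t i)) t
        = (Set.Ici (0 : ℝ)).indicator (fun _ =>
          {t : Fin (m + 1) → ℝ | ∀ i, 0 ≤ t i}.indicator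
            (fun s => g (t 0 + ∑ i, s i)) (fun i => t i.succ)) (t 0) := by
      intro t
      have hall : (∀ i, 0 ≤ t i) ↔ 0 ≤ t 0 ∧ ∀ i : Fin (m + 1), 0 ≤ t i.succ :=
        Fin.forall_fin_succ
      simp only [Set.indicator_apply, Set.mem_ofPred_eq, hall, Fin.sum_univ_succ (n := m + 1),
        Set.mem_Ici]
      by_cases h3 : 0 ≤ t 0 <;> by_cases h4 : ∀ i : Fin (m + 1), 0 ≤ t i.succ <;> simp only [h3, h4,
        and_self, and_false, if_true, if_false, implies_true, and_true]
    simp_rw [h2]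
    refine Eq.trans h1 ?_
    rw [Measure.volume_eq_prod, lintegral_prod _ hgf.aemeasurable]
    have h3 : ∀ x : ℝ, ∫⁻ y : Fin (m + 1) → ℝ, (Set.Ici (0 : ℝ)).indicator (fun _ =>
          {t : Fin (m + 1) → ℝ | ∀ i, 0 ≤ t i}.indicator (fun t => g (x + ∑ i, t i)) y) x
        = ∫⁻ s, (Set.Ici (0 : ℝ)).indicator (fun s => (Set.Ici s).indicator
            (fun u => g u * ENNReal.ofReal (s ^ m / m.factorial)) (x + s)) s := by
      intro x
      by_cases hx : 0 ≤ x
      · simp only [Set.indicator_of_mem (show x ∈ Set.Ici 0 from hx)]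
        rw [lintegral_indicator (hmeas m), ih (g := fun s => g (x + s)) (by fun_prop),
          ← lintegral_indicator measurableSet_Ici]
        simp [Set.indicator_apply, hx]
      · simp [Set.indicator_apply, hx]
    simp_rw [h3]
    have hm2 : Measurable fun p : ℝ × ℝ => (Set.Ici (0 : ℝ)).indicator (fun s =>
        (Set.Ici s).indicator (fun u => g u * ENNReal.ofReal (s ^ m / m.factorial)) p.1) p.2 := by
      have e1 : MeasurableSet {p : ℝ × ℝ | 0 ≤ p.2 ∧ p.2 ≤ p.1} := by measurability
      have e2 : Measurable fun p : ℝ × ℝ => g p.1 * ENNReal.ofReal (p.2 ^ m / m.factorial) := by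
        fun_prop
      convert e2.indicator e1 using 1
      ext p
      by_cases h3 : 0 ≤ p.2 <;> by_cases h4 : p.2 ≤ p.1 <;> simp [h3, h4]
    have hm3 : Measurable fun p : ℝ × ℝ => (Set.Ici (0 : ℝ)).indicator (fun s =>
        (Set.Ici s).indicator (fun u => g u * ENNReal.ofReal (s ^ m / m.factorial)) (p.1 + s)) p.2 :=
      hm2.comp (show Measurable fun p : ℝ × ℝ => (p.1 + p.2, p.2) by fun_prop)
    rw [lintegral_lintegral_swap hm3.aemeasurable]
    -- The total `u = x + s` becomes the outer variable and `0 ≤ x` becomes `s ≤ u`, so that what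
    -- remains is the integral of `s ^ m / m!` over `[0, u]`.
    have h5 : ∀ s : ℝ, ∫⁻ x, (Set.Ici (0 : ℝ)).indicator (fun s =>
        (Set.Ici s).indicator (fun u => g u * ENNReal.ofReal (s ^ m / m.factorial)) (x + s)) s
        = ∫⁻ x, (Set.Ici (0 : ℝ)).indicator (fun s =>
        (Set.Ici s).indicator (fun u => g u * ENNReal.ofReal (s ^ m / m.factorial)) x) s := fun s =>
      lintegral_add_right_eq_self (μ := volume) (fun x => (Set.Ici (0 : ℝ)).indicator (fun s =>
        (Set.Ici s).indicator (fun u => g u * ENNReal.ofReal (s ^ m / m.factorial)) x) s) s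
    simp_rw [h5]
    rw [← lintegral_lintegral_swap hm2.aemeasurable, ← lintegral_indicator measurableSet_Ici]
    congr 1
    ext u
    have h6 : ∀ s : ℝ, (Set.Ici (0 : ℝ)).indicator (fun s =>
        (Set.Ici s).indicator (fun u => g u * ENNReal.ofReal (s ^ m / m.factorial)) u) s
        = g u * (Set.Icc 0 u).indicator (fun s => ENNReal.ofReal (s ^ m / m.factorial)) s := by
      intro s
      by_cases h3 : 0 ≤ s <;> by_cases h4 : s ≤ u <;> simp [h3, h4]
    simp_rw [h6]
    rw [lintegral_const_mul _ (Measurable.indicator (by fun_prop) measurableSet_Icc),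
      lintegral_indicator measurableSet_Icc]
    by_cases hu : 0 ≤ u
    · rw [setLIntegral_Icc_pow m hu, Set.indicator_of_mem (show u ∈ Set.Ici 0 from hu)]
    · rw [Set.indicator_of_notMem (show u ∉ Set.Ici 0 from hu), Set.Icc_eq_empty hu]
      simp

/-! ### The Dirichlet law and its survival function. -/

/-- The solid standard simplex. -/
def solidSimplex (m : ℕ) : Set (Fin m → ℝ) := {t | (∀ i, 0 ≤ t i) ∧ ∑ i, t i ≤ 1}

lemma measurableSet_solidSimplex (m : ℕ) : MeasurableSet (solidSimplex m) := by
  unfold solidSimplex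
  measurability

/-- The density of the first `m` squared moduli of the coordinates of an isotropic unit vector in
dimension `m + k + 1`, on the solid simplex. -/
def dirichletDensity (m k : ℕ) (t : Fin m → ℝ) : ℝ :=
  (m + k).factorial / k.factorial * (1 - ∑ i, t i) ^ k

lemma continuous_dirichletDensity (m k : ℕ) : Continuous (dirichletDensity m k) := by
  unfold dirichletDensity
  fun_prop

/-- The Dirichlet law with density proportional to `(1 - ∑ t_i) ^ k` on the solid simplex. -/
def dirichlet (m k : ℕ) : Measure (Fin m → ℝ) :=
  (volume.restrict (solidSimplex m)).withDensity fun t => ENNReal.ofReal (dirichletDensity m k t)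

lemma dirichlet_apply (m k : ℕ) {A : Set (Fin m → ℝ)} (hA : MeasurableSet A) :
    dirichlet m k A
      = ∫⁻ t in A ∩ solidSimplex m, ENNReal.ofReal (dirichletDensity m k t) := by
  rw [dirichlet, withDensity_apply _ hA, Measure.restrict_restrict hA]

lemma dirichlet_absolutelyContinuous (m k : ℕ) : dirichlet m k ≪ volume :=
  (withDensity_absolutelyContinuous _ _).trans Measure.restrict_le_self.absolutelyContinuous

lemma ae_mem_solidSimplex (m k : ℕ) : ∀ᵐ t ∂dirichlet m k, t ∈ solidSimplex m :=
  (withDensity_absolutelyContinuous _ _) (ae_restrict_mem (measurableSet_solidSimplex m))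

/-- The density depends on the sum only, so `lintegral_orthant_sum` reduces everything to one
dimension; the sum has the Beta law with parameters `m + 1` and `k + 1`. -/
lemma lintegral_dirichlet_sum (m k : ℕ) {g : ℝ → ℝ≥0∞} (hg : Measurable g) :
    ∫⁻ t, g (∑ i, t i) ∂dirichlet (m + 1) k
      = ∫⁻ s in Set.Icc 0 1, g s * ENNReal.ofReal
        ((m + 1 + k).factorial / (k.factorial * m.factorial) * ((1 - s) ^ k * s ^ m)) := by
  have hset : solidSimplex (m + 1) = {t : Fin (m + 1) → ℝ | ∑ i, t i ≤ 1} ∩ {t | ∀ i, 0 ≤ t i} := by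
    ext t; simp [solidSimplex, and_comm]
  have hm1 : MeasurableSet {t : Fin (m + 1) → ℝ | ∑ i, t i ≤ 1} := by measurability
  rw [dirichlet, lintegral_withDensity_eq_lintegral_mul _
    (continuous_dirichletDensity _ _).measurable.ennreal_ofReal (by fun_prop), hset,
    ← Measure.restrict_restrict hm1, ← lintegral_indicator hm1]
  have h1 := lintegral_orthant_sum m (g := (Set.Iic (1 : ℝ)).indicator fun s =>
    ENNReal.ofReal ((m + 1 + k).factorial / k.factorial * (1 - s) ^ k) * g s)
    (Measurable.indicator (by fun_prop) measurableSet_Iic)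
  have h2 : Set.Icc (0 : ℝ) 1 = Set.Iic 1 ∩ Set.Ici 0 := by
    ext x; simp [and_comm]
  rw [h2, ← Measure.restrict_restrict measurableSet_Iic, ← lintegral_indicator measurableSet_Iic]
  refine Eq.trans ?_ (h1.trans ?_)
  · congr 1
  · refine setLIntegral_congr_fun measurableSet_Ici fun s hs => ?_
    simp only [Set.indicator_apply, Set.mem_Iic]
    split_ifs with h
    · have h3 : (0 : ℝ) ≤ 1 - s := by linarith
      have h4 : (0 : ℝ) ≤ s := hs
      rw [mul_comm _ (g s), mul_assoc, ← ENNReal.ofReal_mul (by positivity)]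
      congr 2
      have := Nat.factorial_ne_zero m
      have := Nat.factorial_ne_zero k
      field_simp
    · simp

/-- The joint survival function of the Dirichlet law. -/
lemma dirichlet_survival (m k : ℕ) {a : Fin (m + 1) → ℝ} (ha : ∀ i, 0 ≤ a i)
    (hsum : ∑ i, a i ≤ 1) :
    dirichlet (m + 1) k {t | ∀ i, a i ≤ t i}
      = ENNReal.ofReal ((1 - ∑ i, a i) ^ (m + 1 + k)) := by
  have hA : MeasurableSet {t : Fin (m + 1) → ℝ | ∀ i, a i ≤ t i} := by measurability
  -- Translation by `a` turns the set into the simplex of side `1 - b` at the origin, where the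
  -- integrand is again a function of the sum.
  rw [dirichlet_apply _ _ hA, ← lintegral_indicator (hA.inter (measurableSet_solidSimplex _)),
    ← lintegral_add_right_eq_self _ a]
  set b := ∑ i, a i with hb
  have h0 : MeasurableSet {t : Fin (m + 1) → ℝ | ∀ i, 0 ≤ t i} := by measurability
  have hpt : ∀ t : Fin (m + 1) → ℝ,
      ({t : Fin (m + 1) → ℝ | ∀ i, a i ≤ t i} ∩ solidSimplex (m + 1)).indicator
        (fun t => ENNReal.ofReal (dirichletDensity (m + 1) k t)) (t + a)
      = {t : Fin (m + 1) → ℝ | ∀ i, 0 ≤ t i}.indicator (fun t =>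
        (Set.Iic (1 - b)).indicator (fun s => ENNReal.ofReal
          ((m + 1 + k).factorial / k.factorial * (1 - b - s) ^ k)) (∑ i, t i)) t := by
    intro t
    have e1 : ∑ i, (t i + a i) = ∑ i, t i + b := by rw [Finset.sum_add_distrib]
    by_cases h1 : ∀ i, 0 ≤ t i
    · have h3 : ∀ i, 0 ≤ t i + a i := fun i => add_nonneg (h1 i) (ha i)
      by_cases h2 : ∑ i, t i ≤ 1 - b
      · have h4 : ∑ i, (t i + a i) ≤ 1 := by rw [e1]; linarith
        have : t + a ∈ {t : Fin (m + 1) → ℝ | ∀ i, a i ≤ t i} ∩ solidSimplex (m + 1) :=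
          ⟨fun i => by simpa using h1 i, h3, h4⟩
        rw [Set.indicator_of_mem this, Set.indicator_of_mem (show t ∈ {t | ∀ i, 0 ≤ t i} from h1),
          Set.indicator_of_mem (show _ ∈ Set.Iic (1 - b) from h2), dirichletDensity]
        congr 3
        simp only [Pi.add_apply, e1]
        ring
      · have : t + a ∉ {t : Fin (m + 1) → ℝ | ∀ i, a i ≤ t i} ∩ solidSimplex (m + 1) := by
          rintro ⟨-, -, h4⟩
          simp only [Pi.add_apply, e1] at h4
          exact h2 (by linarith)
        rw [Set.indicator_of_notMem this, Set.indicator_of_mem (show t ∈ {t | ∀ i, 0 ≤ t i} from h1),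
          Set.indicator_of_notMem (show _ ∉ Set.Iic (1 - b) from h2)]
    · have : t + a ∉ {t : Fin (m + 1) → ℝ | ∀ i, a i ≤ t i} ∩ solidSimplex (m + 1) := by
        rintro ⟨h4, -⟩
        exact h1 fun i => by simpa using h4 i
      rw [Set.indicator_of_notMem this,
        Set.indicator_of_notMem (show t ∉ {t | ∀ i, 0 ≤ t i} from h1)]
  simp_rw [hpt]
  rw [lintegral_indicator h0, lintegral_orthant_sum m
    (Measurable.indicator (by fun_prop) measurableSet_Iic)]
  have hcomb : ∀ s ∈ Set.Ici (0 : ℝ), (Set.Iic (1 - b)).indicator (fun s => ENNReal.ofReal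
          ((m + 1 + k).factorial / k.factorial * (1 - b - s) ^ k)) s
          * ENNReal.ofReal (s ^ m / m.factorial)
        = (Set.Iic (1 - b)).indicator (fun s => ENNReal.ofReal
          ((m + 1 + k).factorial / (k.factorial * m.factorial) * ((1 - b - s) ^ k * s ^ m))) s := by
    intro s hs
    simp only [Set.indicator_apply, Set.mem_Iic]
    split_ifs with h
    · have h3 : (0 : ℝ) ≤ 1 - b - s := by linarith
      rw [← ENNReal.ofReal_mul (by positivity)]
      congr 1
      have := Nat.factorial_ne_zero m
      have := Nat.factorial_ne_zero k
      field_simp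
    · simp
  rw [setLIntegral_congr_fun measurableSet_Ici hcomb, lintegral_indicator measurableSet_Iic,
    Measure.restrict_restrict measurableSet_Iic]
  have h2 : Set.Iic (1 - b) ∩ Set.Ici (0 : ℝ) = Set.Icc 0 (1 - b) := by
    ext x; simp [and_comm]
  have hb1 : (0 : ℝ) ≤ 1 - b := by linarith
  rw [h2, ← ofReal_integral_eq_lintegral_ofReal]
  · congr 1
    rw [integral_Icc_eq_integral_Ioc, ← intervalIntegral.integral_of_le hb1,
      intervalIntegral.integral_const_mul, integral_sub_pow_mul_pow]
    have := Nat.factorial_ne_zero m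
    have := Nat.factorial_ne_zero k
    have e : k + m + 1 = m + 1 + k := by ring
    have := Nat.factorial_ne_zero (m + 1 + k)
    rw [e]
    field_simp
  · exact Continuous.integrableOn_Icc (by fun_prop)
  · filter_upwards [ae_restrict_mem measurableSet_Icc] with s hs
    have := hs.1
    have h3 : (0 : ℝ) ≤ 1 - b - s := by linarith [hs.2]
    simp only [Pi.zero_apply]
    positivity

instance isProbabilityMeasure_dirichlet (m k : ℕ) : IsProbabilityMeasure (dirichlet (m + 1) k) := by
  have h := dirichlet_survival m k (a := fun _ => 0) (fun _ => le_rfl) (by simp)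
  constructor
  rw [← measure_congr (μ := dirichlet (m + 1) k) (s := {t | ∀ i, 0 ≤ t i}), h]
  · simp
  · filter_upwards [ae_mem_solidSimplex (m + 1) k] with t ht
    exact propext ⟨fun _ => trivial, fun _ => ht.1⟩

/-- The sum has a density. This makes strict and weak inequalities interchangeable, and for `r = 1`
it excludes vanishing residuals. -/
lemma dirichlet_sum_eq (m k : ℕ) (r : ℝ) : dirichlet (m + 1) k {t | ∑ i, t i = r} = 0 := by
  have hm1 : MeasurableSet {t : Fin (m + 1) → ℝ | ∑ i, t i = r} := by measurability
  have h := lintegral_dirichlet_sum m k (g := Set.indicator {r} 1)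
    (measurable_one.indicator (measurableSet_singleton r))
  rw [← lintegral_indicator_one hm1]
  refine Eq.trans ?_ (h.trans ?_)
  · rfl
  · refine lintegral_eq_zero_of_ae_eq_zero ?_
    refine ae_restrict_of_ae ?_
    filter_upwards [Measure.ae_ne volume r] with s hs
    simp [hs]

lemma dirichlet_coord_eq (m k : ℕ) (i : Fin m) (r : ℝ) : dirichlet m k {t | t i = r} = 0 :=
  dirichlet_absolutelyContinuous m k (Measure.pi_hyperplane (fun _ : Fin m => (volume : Measure ℝ)) i r)

/-! ### Box probabilities and the polynomial `μ_n`. -/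

/-- Inclusion-exclusion for the box `[0, δ)^m`. -/
lemma dirichlet_box (m k : ℕ) {δ : ℝ} (hδ : 0 ≤ δ) (hδ1 : (m + 1 : ℝ) * δ ≤ 1) :
    (dirichlet (m + 1) k).real {t | ∀ i, t i < δ}
      = ∑ i ∈ Finset.range (m + 2), ((m + 1).choose i : ℝ) * (-1) ^ i
        * (1 - i * δ) ^ (m + 1 + k) := by
  classical
  set D := dirichlet (m + 1) k
  have hS : ∀ S : Finset (Fin (m + 1)), MeasurableSet {t : Fin (m + 1) → ℝ | ∀ i ∈ S, δ ≤ t i} := by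
    intro S
    have : {t : Fin (m + 1) → ℝ | ∀ i ∈ S, δ ≤ t i} = ⋂ i ∈ S, {t | δ ≤ t i} := by ext; simp
    rw [this]
    exact Finset.measurableSet_biInter _ fun i _ => measurableSet_le measurable_const (by fun_prop)
  have hbox : MeasurableSet {t : Fin (m + 1) → ℝ | ∀ i, t i < δ} := by measurability
  have hSval : ∀ S : Finset (Fin (m + 1)), D.real {t | ∀ i ∈ S, δ ≤ t i}
      = (1 - S.card * δ) ^ (m + 1 + k) := by
    intro S
    have hsum : ∑ i, (if i ∈ S then δ else 0) = S.card * δ := by simp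
    have hcard : (S.card : ℝ) ≤ m + 1 := by
      have := Finset.card_le_univ S
      rw [Fintype.card_fin] at this
      exact_mod_cast this
    -- The survival formula is used for every `S`, including the full set; this is where `(m + 1) *
    -- δ ≤ 1` enters.
    have hle : S.card * δ ≤ 1 := le_trans (by gcongr) hδ1
    have h := dirichlet_survival m k (a := fun i => if i ∈ S then δ else 0)
      (fun i => by split_ifs <;> simp [hδ]) (by rw [hsum]; exact hle)
    rw [hsum] at h
    rw [measureReal_def, ← measure_congr (s := {t | ∀ i, (if i ∈ S then δ else 0) ≤ t i}), h,
      ENNReal.toReal_ofReal]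
    · have : 0 ≤ 1 - S.card * δ := by linarith
      positivity
    · filter_upwards [ae_mem_solidSimplex (m + 1) k] with t ht
      refine propext ⟨fun h i hi => by simpa [hi] using h i, fun h i => ?_⟩
      by_cases hi : i ∈ S
      · simpa [hi] using h i hi
      · simpa [hi] using ht.1 i
  -- The indicator of the box is the product of the factors `1 - 1_{δ ≤ t i}`, expanded over
  -- subsets.
  have hind : ∀ t : Fin (m + 1) → ℝ, Set.indicator {t : Fin (m + 1) → ℝ | ∀ i, t i < δ} (1 : (Fin (m + 1) → ℝ) → ℝ) t
      = ∑ S ∈ (Finset.univ : Finset (Fin (m + 1))).powerset,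
        (-1) ^ S.card * Set.indicator {t : Fin (m + 1) → ℝ | ∀ i ∈ S, δ ≤ t i} (1 : (Fin (m + 1) → ℝ) → ℝ) t := by
    intro t
    have h1 : Set.indicator {t : Fin (m + 1) → ℝ | ∀ i, t i < δ} (1 : (Fin (m + 1) → ℝ) → ℝ) t
        = ∏ i, (-(if δ ≤ t i then (1 : ℝ) else 0) + 1) := by
      by_cases h : ∀ i, t i < δ
      · rw [Set.indicator_of_mem (show t ∈ {t | ∀ i, t i < δ} from h)]
        symm
        exact Finset.prod_eq_one fun i _ => by simp [h i]
      · rw [Set.indicator_of_notMem (show t ∉ {t | ∀ i, t i < δ} from h)]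
        push Not at h
        obtain ⟨i, hi⟩ := h
        symm
        exact Finset.prod_eq_zero (Finset.mem_univ i) (by simp [hi])
    rw [h1, Finset.prod_add]
    refine Finset.sum_congr rfl fun S _ => ?_
    rw [Finset.prod_neg, Finset.prod_const_one, mul_one]
    congr 1
    by_cases h : ∀ i ∈ S, δ ≤ t i
    · rw [Set.indicator_of_mem (show t ∈ {t | ∀ i ∈ S, δ ≤ t i} from h)]
      exact Finset.prod_eq_one fun i hi => by simp [h i hi]
    · rw [Set.indicator_of_notMem (show t ∉ {t | ∀ i ∈ S, δ ≤ t i} from h)]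
      push Not at h
      obtain ⟨i, hi, hi2⟩ := h
      exact Finset.prod_eq_zero hi (by simp [hi2])
  rw [← integral_indicator_one hbox]
  simp_rw [hind]
  rw [integral_finsetSum]
  · simp_rw [integral_const_mul, integral_indicator_one (hS _), hSval]
    rw [Finset.sum_powerset_apply_card (fun j => (-1 : ℝ) ^ j * (1 - j * δ) ^ (m + 1 + k)),
      Finset.card_univ, Fintype.card_fin]
    refine Finset.sum_congr rfl fun i _ => ?_
    rw [nsmul_eq_mul, mul_assoc]
  · intro S _
    exact ((integrable_const (1 : ℝ)).indicator (hS S)).const_mul _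

/-- Up to the sign `(-1) ^ m` this is the `m`-th forward difference of `x ^ j` at `0`, and the
degree `j` is less than `m`. -/
lemma alternating_sum_choose_mul_pow {j m : ℕ} (h : j < m) :
    ∑ i ∈ Finset.range (m + 1), (m.choose i : ℝ) * (-1) ^ i * (i : ℝ) ^ j = 0 := by
  have h1 := congrFun (fwdDiff_iter_pow_eq_zero_of_lt (R := ℝ) h) 0
  rw [fwdDiff_iter_eq_sum_shift] at h1
  simp only [Pi.zero_apply] at h1
  have h2 : ∑ i ∈ Finset.range (m + 1), (m.choose i : ℝ) * (-1) ^ i * (i : ℝ) ^ j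
      = (-1) ^ m * ∑ i ∈ Finset.range (m + 1),
        ((-1 : ℤ) ^ (m - i) * (m.choose i : ℤ)) • ((0 : ℝ) + i • 1) ^ j := by
    rw [Finset.mul_sum]
    refine Finset.sum_congr rfl fun i hi => ?_
    have hi' : i ≤ m := by simpa [Nat.lt_succ_iff] using hi
    obtain ⟨d, rfl⟩ := Nat.exists_eq_add_of_le hi'
    have : ((-1 : ℝ) ^ d) * (-1) ^ d = 1 := by rw [← mul_pow]; simp
    simp only [zsmul_eq_mul, nsmul_eq_mul, Nat.add_sub_cancel_left]
    push_cast
    rw [pow_add]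
    linear_combination (-((i + d).choose i : ℝ) * (-1) ^ i * i ^ j) * this
  rw [h2, h1, mul_zero]

/-- Expand `(1 - i * δ) ^ (m + 1 + k)` and exchange the sums: the powers of `δ` below `m + 1`
cancel, and the remaining range is that of `muPoly`. From here on `n = m + 2` and `M = m + 1 + k +
1`, so `k = M - n`. -/
lemma dirichlet_box_eq_muPoly (m k : ℕ) {δ : ℝ} (hδ : 0 ≤ δ) (hδ1 : (m + 1 : ℝ) * δ ≤ 1) :
    (dirichlet (m + 1) k).real {t | ∀ i, t i < δ} = muPoly (m + 1 + k + 1) (m + 2) δ := by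
  rw [dirichlet_box m k hδ hδ1, muPoly]
  have h1 : ∀ i : ℕ, (1 - i * δ) ^ (m + 1 + k) = ∑ j ∈ Finset.range (m + 1 + k + 1),
      ((m + 1 + k).choose j : ℝ) * (-1) ^ j * (i : ℝ) ^ j * δ ^ j := by
    intro i
    rw [sub_eq_add_neg, add_comm, add_pow]
    refine Finset.sum_congr rfl fun j _ => ?_
    rw [neg_pow, mul_pow]
    ring
  simp_rw [h1, Finset.mul_sum]
  rw [Finset.sum_comm]
  simp only [Nat.add_sub_cancel, show m + 2 - 1 = m + 1 from rfl]
  have hsub : Finset.Icc (m + 1) (m + 1 + k) ⊆ Finset.range (m + 1 + k + 1) := by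
    intro x hx
    simp only [Finset.mem_Icc, Finset.mem_range] at *
    omega
  rw [← Finset.sum_subset hsub]
  · refine Finset.sum_congr rfl fun j _ => ?_
    rw [Finset.sum_mul]
    refine Finset.sum_congr rfl fun i _ => ?_
    ring
  · intro j hj hj2
    have hj3 : j < m + 1 := by
      simp only [Finset.mem_Icc, Finset.mem_range] at *
      omega
    have h3 := alternating_sum_choose_mul_pow hj3
    calc _ = ((m + 1 + k).choose j : ℝ) * (-1) ^ j * δ ^ j
          * ∑ i ∈ Finset.range (m + 1 + 1), ((m + 1).choose i : ℝ) * (-1) ^ i * (i : ℝ) ^ j := by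
          rw [Finset.mul_sum]
          exact Finset.sum_congr rfl fun i _ => by ring
      _ = 0 := by rw [h3, mul_zero]

/-- Since `M - 1 = m + 1 + k ≥ n - 1`, the box `[0, δ)^(n-1)` lies in the solid simplex. -/
lemma succ_mul_le_one {m k : ℕ} {δ : ℝ} (hδ1 : δ < 1 / (m + 1 + k : ℝ)) :
    (m + 1 : ℝ) * δ < 1 := by
  have h : (0 : ℝ) < m + 1 + k := by positivity
  rw [lt_div_iff₀ h] at hδ1
  rcases le_or_gt δ 0 with h0 | h0
  · nlinarith
  · nlinarith [mul_nonneg h0.le (Nat.cast_nonneg (α := ℝ) k)]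

/-- The probability of the box `[0, δ)^m` is at least of order `δ ^ m`. -/
lemma le_dirichlet_box (m k : ℕ) {δ : ℝ} (hδ : 0 < δ) (hδ1 : δ < 1 / (m + 1 + k : ℝ)) :
    (1 / (m + 1 + k : ℝ)) ^ k * δ ^ (m + 1)
      ≤ (dirichlet (m + 1) k).real {t | ∀ i, t i < δ} := by
  have hlt := succ_mul_le_one hδ1
  have hbox : MeasurableSet {t : Fin (m + 1) → ℝ | ∀ i, t i < δ} := by measurability
  have hpi : MeasurableSet (Set.univ.pi fun _ : Fin (m + 1) => Set.Ico 0 δ) :=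
    MeasurableSet.univ_pi fun _ => measurableSet_Ico
  have hsub : (Set.univ.pi fun _ : Fin (m + 1) => Set.Ico 0 δ)
      ⊆ {t : Fin (m + 1) → ℝ | ∀ i, t i < δ} ∩ solidSimplex (m + 1) := by
    intro t ht
    simp only [Set.mem_pi, Set.mem_univ, true_implies, Set.mem_Ico] at ht
    refine ⟨fun i => (ht i).2, fun i => (ht i).1, ?_⟩
    calc ∑ i, t i ≤ ∑ _i : Fin (m + 1), δ := Finset.sum_le_sum fun i _ => (ht i).2.le
      _ = (m + 1) * δ := by simp
      _ ≤ 1 := hlt.le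
  have hdens : ∀ t ∈ (Set.univ.pi fun _ : Fin (m + 1) => Set.Ico 0 δ),
      (1 / (m + 1 + k : ℝ)) ^ k ≤ dirichletDensity (m + 1) k t := by
    intro t ht
    simp only [Set.mem_pi, Set.mem_univ, true_implies, Set.mem_Ico] at ht
    have hsum : ∑ i, t i ≤ (m + 1) * δ := by
      calc ∑ i, t i ≤ ∑ _i : Fin (m + 1), δ := Finset.sum_le_sum fun i _ => (ht i).2.le
        _ = (m + 1) * δ := by simp
    have hfac : (1 : ℝ) ≤ (m + 1 + k).factorial / k.factorial := by
      rw [one_le_div (by positivity)]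
      exact_mod_cast Nat.factorial_le (by omega)
    have hpow : (1 / (m + 1 + k : ℝ)) ^ k ≤ (1 - ∑ i, t i) ^ k := by
      -- On the box `1 - ∑ t i ≥ k / (m + 1 + k)`. For `k ≥ 1` this is at least `1 / (m + 1 + k)`;
      -- for `k = 0` the bound may be `0`, but then the exponent vanishes.
      rcases Nat.eq_zero_or_pos k with rfl | hk
      · simp
      · have hk1 : (1 : ℝ) ≤ k := by exact_mod_cast hk
        have hpos : (0 : ℝ) < m + 1 + k := by positivity
        apply pow_le_pow_left₀ (by positivity)
        have h1 : (m + 1 : ℝ) * δ ≤ (m + 1) * (1 / (m + 1 + k)) := by gcongr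
        have h2 : (m + 1 : ℝ) * (1 / (m + 1 + k)) = 1 - k * (1 / (m + 1 + k)) := by
          field_simp
          ring
        have h3 : (1 : ℝ) / (m + 1 + k) ≤ k * (1 / (m + 1 + k)) :=
          le_mul_of_one_le_left (by positivity) hk1
        linarith
    have h0 : (0 : ℝ) ≤ (1 - ∑ i, t i) ^ k := le_trans (by positivity) hpow
    exact hpow.trans (le_mul_of_one_le_left h0 hfac)
  have hkey : ENNReal.ofReal ((1 / (m + 1 + k : ℝ)) ^ k * δ ^ (m + 1))
      ≤ dirichlet (m + 1) k {t | ∀ i, t i < δ} := by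
    rw [dirichlet_apply _ _ hbox]
    calc ENNReal.ofReal ((1 / (m + 1 + k : ℝ)) ^ k * δ ^ (m + 1))
        = ∫⁻ _t in (Set.univ.pi fun _ : Fin (m + 1) => Set.Ico 0 δ),
            ENNReal.ofReal ((1 / (m + 1 + k : ℝ)) ^ k) := by
          rw [setLIntegral_const, Real.volume_pi_Ico, ENNReal.ofReal_mul (by positivity)]
          simp [ENNReal.ofReal_pow hδ.le]
      _ ≤ ∫⁻ t in (Set.univ.pi fun _ : Fin (m + 1) => Set.Ico 0 δ),
            ENNReal.ofReal (dirichletDensity (m + 1) k t) :=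
          setLIntegral_mono' hpi fun t ht => ENNReal.ofReal_le_ofReal (hdens t ht)
      _ ≤ _ := lintegral_mono_set hsub
  rw [measureReal_def]
  exact (ENNReal.ofReal_le_iff_le_toReal (measure_ne_top _ _)).1 hkey

/-! ### The integration region and the explicit c.d.f. with its bounds. -/

/-- The nested bound at `i = 0` is the bound on the whole sum. It implies the others, since partial
sums of nonnegative coordinates are no larger. -/
lemma mem_betaRegion_iff {m : ℕ} {δ x : ℝ} {t : Fin (m + 1) → ℝ} :
    t ∈ betaRegion (m + 1) δ x ↔ (∀ i, 0 ≤ t i) ∧ (∀ i, t i ≤ δ) ∧ ∑ i, t i ≤ 1 - x := by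
  have hsplit : ∀ i, t i + ∑ j ∈ Finset.Ioi i, t j = ∑ j ∈ Finset.Ici i, t j := by
    intro i
    rw [← Finset.Ioi_insert i, Finset.sum_insert (by simp)]
  constructor
  · intro h
    refine ⟨fun i => (h i).1, fun i => (le_min_iff.1 (h i).2).1, ?_⟩
    have h0 := (le_min_iff.1 (h 0).2).2
    have h1 : Finset.Ici (0 : Fin (m + 1)) = Finset.univ := by ext; simp
    have h2 := hsplit 0
    rw [h1] at h2
    linarith
  · rintro ⟨h0, h1, h2⟩ i
    refine ⟨h0 i, le_min (h1 i) ?_⟩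
    have h3 : ∑ j ∈ Finset.Ici i, t j ≤ ∑ j, t j :=
      Finset.sum_le_sum_of_subset_of_nonneg (Finset.subset_univ _) fun j _ _ => h0 j
    linarith [hsplit i]

lemma measurableSet_betaRegion (m : ℕ) (δ x : ℝ) : MeasurableSet (betaRegion (m + 1) δ x) := by
  have : betaRegion (m + 1) δ x
      = {t | (∀ i, 0 ≤ t i) ∧ (∀ i, t i ≤ δ) ∧ ∑ i, t i ≤ 1 - x} := by
    ext t; exact mem_betaRegion_iff
  rw [this]
  measurability

/-- For `0 ≤ x` the region lies in the simplex, so only the normalizing constant, `Γ(M) / Γ(M - n +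
1)` in the notation of the formula, separates the integral from a probability. -/
lemma dirichlet_betaRegion (m k : ℕ) {δ x : ℝ} (hx : 0 ≤ x) :
    (dirichlet (m + 1) k).real (betaRegion (m + 1) δ x)
      = (m + 1 + k).factorial / k.factorial
        * ∫ t in betaRegion (m + 1) δ x, (1 - ∑ i, t i) ^ k := by
  have hR := measurableSet_betaRegion m δ x
  have hsub : betaRegion (m + 1) δ x ∩ solidSimplex (m + 1) = betaRegion (m + 1) δ x := by
    refine Set.inter_eq_left.2 fun t ht => ?_
    obtain ⟨h0, -, h2⟩ := mem_betaRegion_iff.1 ht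
    exact ⟨h0, by linarith⟩
  rw [measureReal_def, dirichlet_apply _ _ hR, hsub, ← integral_const_mul,
    integral_eq_lintegral_of_nonneg_ae]
  · rfl
  · filter_upwards [ae_restrict_mem hR] with t ht
    obtain ⟨h0, -, h2⟩ := mem_betaRegion_iff.1 ht
    have : 0 ≤ 1 - ∑ i, t i := by linarith
    simp only [Pi.zero_apply]
    positivity
  · exact Continuous.aestronglyMeasurable (by fun_prop)

lemma dirichlet_box_inter_lt (m k : ℕ) {δ x : ℝ} :
    (dirichlet (m + 1) k).real {t | (∀ i, t i < δ) ∧ ∑ i, t i < 1 - x}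
      = (dirichlet (m + 1) k).real (betaRegion (m + 1) δ x) := by
  refine measureReal_congr ?_
  have h1 : ∀ᵐ t ∂dirichlet (m + 1) k, ∀ i, t i ≠ δ :=
    ae_all_iff.2 fun i => by
      rw [ae_iff]; simpa using dirichlet_coord_eq (m + 1) k i δ
  have h2 : ∀ᵐ t ∂dirichlet (m + 1) k, ∑ i, t i ≠ 1 - x := by
    rw [ae_iff]; simpa using dirichlet_sum_eq m k (1 - x)
  filter_upwards [ae_mem_solidSimplex (m + 1) k, h1, h2] with t ht h1 h2
  refine propext ⟨fun h => mem_betaRegion_iff.2 ⟨ht.1, fun i => (h.1 i).le, h.2.le⟩, fun h => ?_⟩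
  obtain ⟨-, h3, h4⟩ := mem_betaRegion_iff.1 h
  exact ⟨fun i => lt_of_le_of_ne (h3 i) (h1 i), lt_of_le_of_ne h4 h2⟩

section Formula

variable (m k : ℕ) {δ : ℝ}

lemma muPoly_pos (hδ : 0 < δ) (hδ1 : δ < 1 / (m + 1 + k : ℝ)) :
    0 < muPoly (m + 1 + k + 1) (m + 2) δ := by
  rw [← dirichlet_box_eq_muPoly m k hδ.le (succ_mul_le_one hδ1).le]
  exact lt_of_lt_of_le (by positivity) (le_dirichlet_box m k hδ hδ1)

lemma betaFormula_of_mem (hδ1 : δ < 1 / (m + 1 + k : ℝ)) {x : ℝ}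
    (hx : 1 - (m + 1 : ℝ) * δ < x) (hx1 : x ≤ 1) :
    betaFormula (m + 1 + k + 1) (m + 2) δ x
      = 1 - (dirichlet (m + 1) k).real (betaRegion (m + 1) δ x)
        / muPoly (m + 1 + k + 1) (m + 2) δ := by
  have hlt := succ_mul_le_one hδ1
  have e1 : ((m + 2 : ℕ) : ℝ) - 1 = m + 1 := by push_cast; ring
  have e2 : ((m + 1 + k + 1 : ℕ) : ℝ) - ((m + 2 : ℕ) : ℝ) + 1 = (k : ℝ) + 1 := by push_cast; ring
  have e3 : ((m + 1 + k + 1 : ℕ) : ℝ) = ((m + 1 + k : ℕ) : ℝ) + 1 := by push_cast; ring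
  rw [betaFormula, if_neg (by rw [e1]; linarith), if_pos hx1, e2, e3, Real.Gamma_nat_eq_factorial,
    Real.Gamma_nat_eq_factorial, dirichlet_betaRegion m k (by linarith),
    show m + 1 + k + 1 - (m + 2) = k by omega, show m + 2 - 1 = m + 1 from rfl]
  ring

/-- The multiple-integral formula as a conditional probability. -/
lemma betaFormula_eq (hδ : 0 < δ) (hδ1 : δ < 1 / (m + 1 + k : ℝ)) (x : ℝ) :
    betaFormula (m + 1 + k + 1) (m + 2) δ x
      = (dirichlet (m + 1) k).real {t | (∀ i, t i < δ) ∧ 1 - ∑ i, t i ≤ x}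
        / muPoly (m + 1 + k + 1) (m + 2) δ := by
  have hlt := succ_mul_le_one hδ1
  have hmu := muPoly_pos m k hδ hδ1
  have hbox := dirichlet_box_eq_muPoly m k hδ.le hlt.le
  have e1 : ((m + 2 : ℕ) : ℝ) - 1 = m + 1 := by push_cast; ring
  rcases le_or_gt x (1 - (m + 1 : ℝ) * δ) with hx | hx
  · have hempty : {t : Fin (m + 1) → ℝ | (∀ i, t i < δ) ∧ 1 - ∑ i, t i ≤ x} = ∅ := by
      ext t
      simp only [Set.mem_ofPred_eq, Set.mem_empty_iff_false, iff_false, not_and, not_le]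
      intro ht
      have : ∑ i, t i < ∑ _i : Fin (m + 1), δ :=
        Finset.sum_lt_sum_of_nonempty Finset.univ_nonempty fun i _ => ht i
      simp only [Finset.sum_const, Finset.card_univ, Fintype.card_fin, nsmul_eq_mul] at this
      push_cast at this
      linarith
    rw [hempty, betaFormula, if_pos (by rw [e1]; exact hx)]
    simp
  · rcases le_or_gt x 1 with hx1 | hx1
    · rw [betaFormula_of_mem m k hδ1 hx hx1, ← dirichlet_box_inter_lt, eq_div_iff hmu.ne',
        sub_mul, one_mul, div_mul_cancel₀ _ hmu.ne', ← hbox, sub_eq_iff_eq_add, ← measureReal_union]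
      · congr 1
        ext t
        simp only [Set.mem_ofPred_eq, Set.mem_union, ← and_or_left]
        refine ⟨fun h => ⟨h, ?_⟩, fun h => h.1⟩
        rcases le_or_gt (1 - ∑ i, t i) x with h1 | h1
        · exact Or.inl h1
        · exact Or.inr (by linarith)
      · refine Set.disjoint_left.2 fun t h1 h2 => ?_
        have := h1.2
        have := h2.2
        linarith
      · measurability
    · rw [betaFormula, if_neg (by rw [e1]; nlinarith), if_neg (by linarith), eq_comm,
        div_eq_one_iff_eq hmu.ne', ← hbox]
      refine measureReal_congr ?_
      filter_upwards [ae_mem_solidSimplex (m + 1) k] with t ht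
      refine propext ⟨fun h => h.1, fun h => ⟨h, ?_⟩⟩
      have : 0 ≤ ∑ i, t i := Finset.sum_nonneg fun i _ => ht.1 i
      linarith

lemma dirichlet_sum_le (r : ℝ) (hr : 0 ≤ r) (hr1 : r ≤ 1) :
    (dirichlet (m + 1) k).real {t | ∑ i, t i ≤ r}
      = regIncBeta r (((m + 2 : ℕ) : ℝ) - 1)
        (((m + 1 + k + 1 : ℕ) : ℝ) - ((m + 2 : ℕ) : ℝ) + 1) := by
  have e1 : ((m + 2 : ℕ) : ℝ) - 1 = m + 1 := by push_cast; ring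
  have e2 : ((m + 1 + k + 1 : ℕ) : ℝ) - ((m + 2 : ℕ) : ℝ) + 1 = (k : ℝ) + 1 := by push_cast; ring
  have hmeas : MeasurableSet {t : Fin (m + 1) → ℝ | ∑ i, t i ≤ r} := by measurability
  have h := lintegral_dirichlet_sum m k (g := (Set.Iic r).indicator 1)
    (measurable_one.indicator measurableSet_Iic)
  have h1 : dirichlet (m + 1) k {t | ∑ i, t i ≤ r}
      = ∫⁻ s in Set.Icc 0 r, ENNReal.ofReal
        ((m + 1 + k).factorial / (k.factorial * m.factorial) * ((1 - s) ^ k * s ^ m)) := by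
    rw [← lintegral_indicator_one hmeas]
    refine Eq.trans (by rfl) (h.trans ?_)
    have h2 : Set.Icc 0 r = Set.Iic r ∩ Set.Icc 0 1 := by
      ext s
      simp only [Set.mem_Icc, Set.mem_inter_iff, Set.mem_Iic]
      constructor
      · rintro ⟨h1, h2⟩; exact ⟨h2, h1, h2.trans hr1⟩
      · rintro ⟨h1, h2, -⟩; exact ⟨h2, h1⟩
    rw [h2, ← Measure.restrict_restrict measurableSet_Iic, ← lintegral_indicator measurableSet_Iic]
    congr 1
    ext s
    by_cases hs : s ≤ r <;> simp [hs]
  rw [measureReal_def, h1, ← integral_eq_lintegral_of_nonneg_ae, regIncBeta, e1, e2,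
    integral_Icc_eq_integral_Ioc, ← intervalIntegral.integral_of_le hr,
    intervalIntegral.integral_const_mul, ProbabilityTheory.beta, Real.Gamma_nat_eq_factorial,
    Real.Gamma_nat_eq_factorial,
    show (m : ℝ) + 1 + (k + 1) = ((m + 1 + k : ℕ) : ℝ) + 1 by push_cast; ring,
    Real.Gamma_nat_eq_factorial]
  · simp only [add_sub_cancel_right, Real.rpow_natCast]
    simp_rw [mul_comm ((1 - _ : ℝ) ^ k)]
    field_simp
  · filter_upwards [ae_restrict_mem measurableSet_Icc] with s hs
    have h2 : 0 ≤ s := hs.1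
    have h3 : 0 ≤ 1 - s := by linarith [hs.2]
    simp only [Pi.zero_apply]
    positivity
  · exact Continuous.aestronglyMeasurable (by fun_prop)

/-- Dropping the constraints `t i ≤ δ` enlarges the region, and the sum alone has a Beta law. -/
lemma betaLower_le (hδ : 0 < δ) (hδ1 : δ < 1 / (m + 1 + k : ℝ)) (x : ℝ) :
    betaLower (m + 1 + k + 1) (m + 2) δ x ≤ betaFormula (m + 1 + k + 1) (m + 2) δ x := by
  have hlt := succ_mul_le_one hδ1
  have hmu := muPoly_pos m k hδ hδ1
  have e1 : ((m + 2 : ℕ) : ℝ) - 1 = m + 1 := by push_cast; ring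
  rcases le_or_gt x (1 - (m + 1 : ℝ) * δ) with hx | hx
  · rw [betaLower, betaFormula, if_pos (by rw [e1]; exact hx), if_pos (by rw [e1]; exact hx)]
  · rcases le_or_gt x 1 with hx1 | hx1
    · rw [betaFormula_of_mem m k hδ1 hx hx1, betaLower, if_neg (by rw [e1]; linarith),
        if_pos hx1, ← dirichlet_sum_le m k _ (by linarith) (by linarith)]
      gcongr
      · exact measure_ne_top _ _
      · exact fun t ht => (mem_betaRegion_iff.1 ht).2.2
    · rw [betaLower, betaFormula, if_neg (by rw [e1]; nlinarith), if_neg (by linarith),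
        if_neg (by rw [e1]; nlinarith), if_neg (by linarith)]

/-- The cube of side `(1 - x) / (m + 1)` fits into the region: this side is at most `δ`, and `m + 1`
coordinates below it have sum at most `1 - x`. Its probability is `muPoly` at the side length. -/
lemma le_betaUpper (hδ : 0 < δ) (hδ1 : δ < 1 / (m + 1 + k : ℝ)) (x : ℝ) :
    betaFormula (m + 1 + k + 1) (m + 2) δ x ≤ betaUpper (m + 1 + k + 1) (m + 2) δ x := by
  have hlt := succ_mul_le_one hδ1
  have hmu := muPoly_pos m k hδ hδ1
  have e1 : ((m + 2 : ℕ) : ℝ) - 1 = m + 1 := by push_cast; ring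
  have hm : (0 : ℝ) < m + 1 := by positivity
  rcases le_or_gt x (1 - (m + 1 : ℝ) * δ) with hx | hx
  · rw [betaUpper, betaFormula, if_pos (by rw [e1]; exact hx), if_pos (by rw [e1]; exact hx)]
  · rcases le_or_gt x 1 with hx1 | hx1
    · have hr : (m + 1 : ℝ) * ((1 - x) / (m + 1)) = 1 - x := by field_simp
      have hr0 : 0 ≤ (1 - x) / (m + 1 : ℝ) := div_nonneg (by linarith) hm.le
      have hrδ : (1 - x) / (m + 1 : ℝ) ≤ δ := by
        rw [div_le_iff₀ hm]; linarith
      rw [betaFormula_of_mem m k hδ1 hx hx1, betaUpper, if_neg (by rw [e1]; linarith),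
        if_pos hx1, e1, ← dirichlet_box_eq_muPoly m k hr0 (by rw [hr]; linarith)]
      gcongr 1 - ?_ / _
      refine ENNReal.toReal_mono (measure_ne_top _ _) (measure_mono_ae ?_)
      filter_upwards [ae_mem_solidSimplex (m + 1) k] with t ht h
      refine mem_betaRegion_iff.2 ⟨ht.1, fun i => (h i).le.trans hrδ, ?_⟩
      calc ∑ i, t i ≤ ∑ _i : Fin (m + 1), (1 - x) / (m + 1 : ℝ) :=
            Finset.sum_le_sum fun i _ => (h i).le
        _ = 1 - x := by
            rw [Finset.sum_const, Finset.card_univ, Fintype.card_fin, nsmul_eq_mul]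
            push_cast
            exact hr
    · rw [betaUpper, betaFormula, if_neg (by rw [e1]; nlinarith), if_neg (by linarith),
        if_neg (by rw [e1]; nlinarith), if_neg (by linarith)]

end Formula

/-! ### The case `n = 2`. -/

section Two

variable (k : ℕ) {δ : ℝ}

lemma muPoly_two (hδ : 0 ≤ δ) (hδ1 : δ ≤ 1) :
    muPoly (0 + 1 + k + 1) (0 + 2) δ = 1 - (1 - δ) ^ (1 + k) := by
  rw [← dirichlet_box_eq_muPoly 0 k hδ (by simpa using hδ1),
    dirichlet_box 0 k hδ (by simpa using hδ1)]
  simp [Finset.sum_range_succ]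
  ring

lemma dirichlet_one_le (k : ℕ) {r : ℝ} (hr : 0 ≤ r) (hr1 : r ≤ 1) :
    (dirichlet (0 + 1) k).real {t | ∑ i, t i ≤ r} = 1 - (1 - r) ^ (1 + k) := by
  have h := dirichlet_box_eq_muPoly 0 k hr (by simpa using hr1)
  rw [muPoly_two k hr hr1] at h
  rw [← h]
  refine measureReal_congr ?_
  have h1 : ∀ᵐ t ∂dirichlet (0 + 1) k, t 0 ≠ r := by
    rw [ae_iff]; simpa using dirichlet_coord_eq (0 + 1) k 0 r
  filter_upwards [h1] with t ht
  simp only [eq_iff_iff]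
  constructor
  · intro h i
    have h' : ∑ i : Fin 1, t i ≤ r := h
    rw [Fin.sum_univ_one] at h'
    rw [Subsingleton.elim (α := Fin 1) i 0]
    exact lt_of_le_of_ne h' ht
  · intro h
    change ∑ i : Fin 1, t i ≤ r
    rw [Fin.sum_univ_one]
    exact (h 0).le

/-- With a single coordinate, `t 0 ≤ 1 - x < δ` makes the box constraint redundant, so the regions
behind the c.d.f. and both bounds coincide up to null sets. -/
lemma betaFormula_two (hδ : 0 < δ) (hδ1 : δ < 1 / (0 + 1 + k : ℝ)) (x : ℝ) :
    betaFormula (0 + 1 + k + 1) (0 + 2) δ x = betaFormulaTwo (0 + 1 + k + 1) δ x ∧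
    betaLower (0 + 1 + k + 1) (0 + 2) δ x = betaFormula (0 + 1 + k + 1) (0 + 2) δ x ∧
    betaFormula (0 + 1 + k + 1) (0 + 2) δ x = betaUpper (0 + 1 + k + 1) (0 + 2) δ x := by
  have hlt : δ < 1 := by simpa using succ_mul_le_one (m := 0) (k := k) (by simpa using hδ1)
  have hmu := muPoly_pos 0 k hδ (by simpa using hδ1)
  rcases le_or_gt x (1 - δ) with hx | hx
  · have h1 : x ≤ 1 - (((0 + 2 : ℕ) : ℝ) - 1) * δ := by norm_num; linarith
    simp only [betaFormula, betaFormulaTwo, betaLower, betaUpper, if_pos h1, if_pos hx, and_self]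
  · have h1 : ¬ x ≤ 1 - (((0 + 2 : ℕ) : ℝ) - 1) * δ := by norm_num; linarith
    rcases le_or_gt x 1 with hx1 | hx1
    · have hS : (dirichlet (0 + 1) k).real (betaRegion (0 + 1) δ x)
          = (dirichlet (0 + 1) k).real {t | ∑ i, t i ≤ 1 - x} := by
        refine measureReal_congr ?_
        filter_upwards [ae_mem_solidSimplex (0 + 1) k] with t ht
        refine propext ⟨fun h => (mem_betaRegion_iff.1 h).2.2,
          fun h => mem_betaRegion_iff.2 ⟨ht.1, fun i => ?_, h⟩⟩
        have h' : ∑ i : Fin 1, t i ≤ 1 - x := h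
        rw [Fin.sum_univ_one] at h'
        rw [Subsingleton.elim (α := Fin 1) i 0]
        linarith
      have hF := betaFormula_of_mem 0 k (by simpa using hδ1) (x := x) (by simpa using hx) hx1
      rw [hS] at hF
      have hD := dirichlet_one_le k (r := 1 - x) (by linarith) (by linarith)
      have hB := dirichlet_sum_le 0 k (1 - x) (by linarith) (by linarith)
      refine ⟨?_, ?_, ?_⟩
      · rw [hF, betaFormulaTwo, if_neg (by linarith), if_pos hx1, hD, muPoly_two k hδ.le hlt.le]
        rw [muPoly_two k hδ.le hlt.le] at hmu
        rw [show 0 + 1 + k + 1 - 1 = 1 + k by omega, eq_div_iff hmu.ne', sub_mul,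
          div_mul_cancel₀ _ hmu.ne']
        ring
      · rw [hF, betaLower, if_neg h1, if_pos hx1, hB]
      · rw [hF, betaUpper, if_neg h1, if_pos hx1, hD,
          show (1 - x) / (((0 + 2 : ℕ) : ℝ) - 1) = 1 - x by norm_num,
          muPoly_two k (by linarith : 0 ≤ 1 - x) (by linarith)]
    · have h2 : ¬ x ≤ 1 := by linarith
      simp only [betaFormula, betaFormulaTwo, betaLower, betaUpper, if_neg h1, if_neg h2,
        if_neg (show ¬ x ≤ 1 - δ by linarith), and_self]

end Two

/-! ### Product densities, the complex Gaussian law and exponential variables. -/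

section Product

variable {X : Type*} [MeasurableSpace X]

lemma lintegral_pi_fin_prod {n : ℕ} (μ : Fin n → Measure X) [∀ i, SigmaFinite (μ i)]
    {f : Fin n → X → ℝ≥0∞} (hf : ∀ i, Measurable (f i)) :
    ∫⁻ x, ∏ i, f i (x i) ∂Measure.pi μ = ∏ i, ∫⁻ y, f i y ∂μ i := by
  induction n with
  | zero => simp
  | succ n ih =>
    have hg1 : Measurable fun y : Fin n → X => ∏ i : Fin n, f i.succ (y i) :=
      Finset.measurable_prod _ fun i _ => (hf i.succ).comp (measurable_pi_apply i)
    have hg : Measurable fun p : X × (Fin n → X) => f 0 p.1 * ∏ i : Fin n, f i.succ (p.2 i) :=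
      ((hf 0).comp measurable_fst).mul (hg1.comp measurable_snd)
    have h1 := (measurePreserving_piFinSuccAbove μ 0).lintegral_comp hg
    have h2 : ∀ x : Fin (n + 1) → X, ∏ i, f i (x i) = f 0 (x 0) * ∏ i : Fin n, f i.succ (x i.succ) :=
      fun x => Fin.prod_univ_succ _
    have h3 := lintegral_prod_mul (μ := μ 0) (ν := Measure.pi fun j : Fin n => μ j.succ)
      (hf 0).aemeasurable hg1.aemeasurable
    simp_rw [h2]
    refine Eq.trans h1 (h3.trans ?_)
    rw [Fin.prod_univ_succ, ih (fun j => μ j.succ) fun i => hf i.succ]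

lemma pi_withDensity_fin {n : ℕ} (μ : Measure X) [SigmaFinite μ] {f : X → ℝ≥0∞}
    (hf : Measurable f) [SigmaFinite (μ.withDensity f)] :
    Measure.pi (fun _ : Fin n => μ.withDensity f)
      = (Measure.pi fun _ => μ).withDensity fun x => ∏ i, f (x i) := by
  refine Measure.pi_eq fun s hs => ?_
  rw [withDensity_apply _ (MeasurableSet.univ_pi hs), Measure.restrict_pi_pi,
    lintegral_pi_fin_prod _ fun _ => hf]
  exact Finset.prod_congr rfl fun i _ => (withDensity_apply _ (hs i)).symm

end Product

lemma stdComplexGaussian_eq_withDensity :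
    stdComplexGaussian
      = volume.withDensity fun z : ℂ => ENNReal.ofReal (Real.pi⁻¹ * Real.exp (-‖z‖ ^ 2)) := by
  have h12 : (1 / 2 : ℝ≥0) ≠ 0 := by norm_num
  have hG : gaussianReal 0 (1 / 2) = volume.withDensity (gaussianPDF 0 (1 / 2)) :=
    gaussianReal_of_var_ne_zero _ h12
  have h1 : (gaussianReal 0 (1 / 2)).prod (gaussianReal 0 (1 / 2))
      = (volume : Measure (ℝ × ℝ)).withDensity
        fun p => gaussianPDF 0 (1 / 2) p.1 * gaussianPDF 0 (1 / 2) p.2 := by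
    rw [hG, prod_withDensity (measurable_gaussianPDF _ _) (measurable_gaussianPDF _ _)]
    rfl
  rw [stdComplexGaussian, h1]
  have hvp := Complex.volume_preserving_equiv_real_prod.symm
  classical
  refine Measure.ext fun s hs => ?_
  rw [Measure.map_apply (MeasurableEquiv.measurable _) hs, withDensity_apply _ hs,
    withDensity_apply _ ((MeasurableEquiv.measurable _) hs),
    ← hvp.setLIntegral_comp_preimage hs (by fun_prop)]
  refine lintegral_congr fun p => ?_
  rw [gaussianPDF, gaussianPDF, ← ENNReal.ofReal_mul (gaussianPDFReal_nonneg _ _ _),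
    gaussianPDFReal, gaussianPDFReal]
  congr 1
  have h2 : ‖Complex.measurableEquivRealProd.symm p‖ ^ 2 = p.1 ^ 2 + p.2 ^ 2 := by
    rw [Complex.sq_norm, Complex.normSq_apply]
    simp [Complex.measurableEquivRealProd_symm_apply, sq]
  rw [h2]
  have h3 : (Real.sqrt (2 * Real.pi * ((1 / 2 : ℝ≥0) : ℝ)))⁻¹
      * (Real.sqrt (2 * Real.pi * ((1 / 2 : ℝ≥0) : ℝ)))⁻¹ = Real.pi⁻¹ := by
    rw [← mul_inv, Real.mul_self_sqrt (by positivity)]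
    push_cast
    congr 1
    ring
  calc _ = ((Real.sqrt (2 * Real.pi * ((1 / 2 : ℝ≥0) : ℝ)))⁻¹
      * (Real.sqrt (2 * Real.pi * ((1 / 2 : ℝ≥0) : ℝ)))⁻¹)
      * (Real.exp (-(p.1 - 0) ^ 2 / (2 * ((1 / 2 : ℝ≥0) : ℝ)))
      * Real.exp (-(p.2 - 0) ^ 2 / (2 * ((1 / 2 : ℝ≥0) : ℝ)))) := by ring
    _ = _ := by
      rw [h3, ← Real.exp_add]
      push_cast
      congr 2
      ring

instance isProbabilityMeasure_stdComplexGaussian : IsProbabilityMeasure stdComplexGaussian := by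
  unfold stdComplexGaussian
  exact Measure.isProbabilityMeasure_map (MeasurableEquiv.measurable _).aemeasurable

/-- The density of the standard exponential law. -/
def expDensity (x : ℝ) : ℝ≥0∞ := (Set.Ici 0).indicator (fun x => ENNReal.ofReal (Real.exp (-x))) x

lemma measurable_expDensity : Measurable expDensity :=
  Measurable.indicator (by fun_prop) measurableSet_Ici

/-- The squared modulus of a standard complex Gaussian variable is exponentially distributed. -/
lemma stdComplexGaussian_map_sq :
    stdComplexGaussian.map (fun z => ‖z‖ ^ 2) = volume.withDensity expDensity := by
  classical
  refine Measure.ext fun s hs => ?_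
  have hmeas : Measurable fun z : ℂ => ‖z‖ ^ 2 := by fun_prop
  have hpre : MeasurableSet ((fun z : ℂ => ‖z‖ ^ 2) ⁻¹' s) := hmeas hs
  rw [Measure.map_apply hmeas hs, stdComplexGaussian_eq_withDensity, withDensity_apply _ hpre,
    withDensity_apply _ hs, ← lintegral_indicator hpre, ← Complex.lintegral_comp_polarCoord_symm]
  have htarget : polarCoord.target = Set.Ioi (0 : ℝ) ×ˢ Set.Ioo (-Real.pi) Real.pi := rfl
  -- In polar coordinates the law is `2 r exp(-r²) dr` times the uniform law of the angle; the
  -- substitution `u = r²` then leaves the exponential density.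
  have hpt : ∀ p ∈ Set.Ioi (0 : ℝ) ×ˢ Set.Ioo (-Real.pi) Real.pi,
      ENNReal.ofReal p.1 • ((fun z : ℂ => ‖z‖ ^ 2) ⁻¹' s).indicator (fun z : ℂ =>
        ENNReal.ofReal (Real.pi⁻¹ * Real.exp (-‖z‖ ^ 2))) (Complex.polarCoord.symm p)
      = ENNReal.ofReal (2 * Real.pi)⁻¹ * (ENNReal.ofReal |2 * p.1|
        * s.indicator (fun u => ENNReal.ofReal (Real.exp (-u))) (p.1 ^ 2)) := by
    rintro ⟨r, θ⟩ ⟨hr, -⟩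
    have hr : 0 < r := hr
    have hn : ‖Complex.polarCoord.symm (r, θ)‖ = r := by
      rw [Complex.norm_polarCoord_symm, abs_of_pos hr]
    simp only [Set.indicator_apply, Set.mem_preimage, hn, smul_eq_mul]
    split_ifs
    · rw [← ENNReal.ofReal_mul hr.le, ← ENNReal.ofReal_mul (by positivity),
        ← ENNReal.ofReal_mul (by positivity), abs_of_pos (by positivity)]
      congr 1
      field_simp
    · simp
  have hg : Measurable fun r : ℝ => ENNReal.ofReal |2 * r|
        * s.indicator (fun u => ENNReal.ofReal (Real.exp (-u))) (r ^ 2) := by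
    have : Measurable fun r : ℝ => s.indicator (fun u => ENNReal.ofReal (Real.exp (-u))) (r ^ 2) :=
      (Measurable.indicator (by fun_prop) hs).comp (show Measurable fun r : ℝ => r ^ 2 by fun_prop)
    fun_prop
  rw [htarget, setLIntegral_congr_fun (measurableSet_Ioi.prod measurableSet_Ioo) hpt,
    lintegral_const_mul _ (by fun_prop), Measure.volume_eq_prod, ← Measure.prod_restrict]
  have h1 : ∫⁻ p : ℝ × ℝ, ENNReal.ofReal |2 * p.1|
        * s.indicator (fun u => ENNReal.ofReal (Real.exp (-u))) (p.1 ^ 2)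
        ∂(volume.restrict (Set.Ioi 0)).prod (volume.restrict (Set.Ioo (-Real.pi) Real.pi))
      = (∫⁻ r in Set.Ioi (0 : ℝ), ENNReal.ofReal |2 * r|
        * s.indicator (fun u => ENNReal.ofReal (Real.exp (-u))) (r ^ 2))
        * ENNReal.ofReal (2 * Real.pi) := by
    have := lintegral_prod_mul (μ := volume.restrict (Set.Ioi (0 : ℝ)))
      (ν := volume.restrict (Set.Ioo (-Real.pi) Real.pi)) hg.aemeasurable
      (g := fun _ => 1) aemeasurable_const
    simp only [mul_one, lintegral_const, Measure.restrict_apply MeasurableSet.univ, one_mul,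
      Set.univ_inter, Real.volume_Ioo] at this
    rw [this]
    congr 2
    ring
  have himg : (fun r : ℝ => r ^ 2) '' Set.Ioi 0 = Set.Ioi 0 := by
    ext u
    simp only [Set.mem_image, Set.mem_Ioi]
    exact ⟨fun ⟨r, hr, h⟩ => h ▸ by positivity,
      fun hu => ⟨Real.sqrt u, Real.sqrt_pos.2 hu, Real.sq_sqrt hu.le⟩⟩
  have h2 := lintegral_image_eq_lintegral_abs_deriv_mul (s := Set.Ioi (0 : ℝ))
    (f := fun r => r ^ 2) (f' := fun r => 2 * r) measurableSet_Ioi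
    (fun x _ => by simpa using (hasDerivAt_pow 2 x).hasDerivWithinAt)
    (fun x hx y hy h => by
      have hx' : (0 : ℝ) < x := hx
      have hy' : (0 : ℝ) < y := hy
      exact (pow_left_inj₀ hx'.le hy'.le two_ne_zero).1 h)
    (s.indicator (fun u => ENNReal.ofReal (Real.exp (-u))))
  rw [himg] at h2
  rw [h1, ← h2, mul_comm, mul_assoc, ← ENNReal.ofReal_mul (by positivity),
    mul_inv_cancel₀ (by positivity), ENNReal.ofReal_one, mul_one, setLIntegral_congr Ioi_ae_eq_Ici,
    ← lintegral_indicator measurableSet_Ici, ← lintegral_indicator hs]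
  refine lintegral_congr fun u => ?_
  simp only [expDensity, Set.indicator_apply]
  split_ifs <;> simp_all

instance isProbabilityMeasure_withDensity_expDensity :
    IsProbabilityMeasure ((volume : Measure ℝ).withDensity expDensity) := by
  rw [← stdComplexGaussian_map_sq]
  exact Measure.isProbabilityMeasure_map (by fun_prop)

lemma lintegral_exp_neg_div {c : ℝ} (hc : 0 < c) :
    ∫⁻ x in Set.Ici (0 : ℝ), ENNReal.ofReal (Real.exp (-(x / c))) = ENNReal.ofReal c := by
  have h := lintegral_exponentialPDF_eq_one (r := c⁻¹) (by positivity)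
  have h1 : ∀ x, exponentialPDF c⁻¹ x = (Set.Ici (0 : ℝ)).indicator
      (fun x => ENNReal.ofReal c⁻¹ * ENNReal.ofReal (Real.exp (-(x / c)))) x := by
    intro x
    by_cases hx : 0 ≤ x
    · rw [exponentialPDF_of_nonneg hx, Set.indicator_of_mem (show x ∈ Set.Ici 0 from hx),
        ENNReal.ofReal_mul (by positivity), div_eq_inv_mul]
    · rw [exponentialPDF_of_neg (not_le.1 hx), Set.indicator_of_notMem (show x ∉ Set.Ici 0 from hx)]
  simp_rw [h1] at h
  rw [lintegral_indicator measurableSet_Ici, lintegral_const_mul _ (by fun_prop)] at h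
  rw [ENNReal.ofReal_inv_of_pos hc] at h
  rw [← ENNReal.mul_right_inj (a := (ENNReal.ofReal c)⁻¹) (by simp) (by simpa using hc), h]
  rw [ENNReal.inv_mul_cancel (by simpa using hc) (by simp)]

/-- For independent standard exponential variables `E_i` with sum `S`,
`P(E_i ≥ a_i S for all i) = (1 - ∑ a_i) ^ (M - 1)`. -/
lemma exponential_survival (M : ℕ) {a : Fin (M + 1) → ℝ} (ha : ∀ i, 0 ≤ a i)
    (hsum : ∑ i, a i < 1) :
    Measure.pi (fun _ : Fin (M + 1) => (volume : Measure ℝ).withDensity expDensity)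
      {x | ∀ i, a i * ∑ j, x j ≤ x i} = ENNReal.ofReal ((1 - ∑ i, a i) ^ M) := by
  set b := ∑ i, a i with hb
  have hb1 : 0 < 1 - b := by linarith
  have hA : MeasurableSet {x : Fin (M + 1) → ℝ | ∀ i, a i * ∑ j, x j ≤ x i} := by
    have : {x : Fin (M + 1) → ℝ | ∀ i, a i * ∑ j, x j ≤ x i}
        = ⋂ i, {x | a i * ∑ j, x j ≤ x i} := by ext; simp
    rw [this]
    exact MeasurableSet.iInter fun i => measurableSet_le (by fun_prop) (by fun_prop)
  rw [pi_withDensity_fin _ measurable_expDensity, withDensity_apply _ hA,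
    ← lintegral_indicator hA, ← volume_pi]
  set f : (Fin (M + 1) → ℝ) → ℝ≥0∞ := fun y => ∏ i, (Set.Ici (0 : ℝ)).indicator
    (fun x => ENNReal.ofReal (Real.exp (-(x / (1 - b))))) (y i) with hf
  have hfm : Measurable f := Finset.measurable_prod _ fun i _ =>
    (Measurable.indicator (by fun_prop) measurableSet_Ici).comp (measurable_pi_apply i)
  -- The map `x ↦ x - (∑ x) a` carries the event to the nonnegative orthant. It multiplies the
  -- coordinate sum by `1 - b`, which is also its determinant by the rank-one determinant formula.
  -- The integral is thus `(1 - b)^(M+1) / (1 - b)`.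
  set L := Matrix.toLin' (1 + replicateCol Unit (-a) * replicateRow Unit (1 : Fin (M + 1) → ℝ))
    with hL
  have hLapp : ∀ x i, L x i = x i - a i * ∑ j, x j := by
    intro x i
    simp [hL, -Matrix.mulVec_mulVec, Matrix.mulVec, dotProduct,
      sub_eq_add_neg, Finset.mul_sum]
  have hdet : LinearMap.det L = 1 - b := by
    rw [hL, LinearMap.det_toLin', det_one_add_replicateCol_mul_replicateRow, dotProduct]
    simp [hb, sub_eq_add_neg]
  have hsumL : ∀ x, ∑ i, L x i = (1 - b) * ∑ j, x j := by
    intro x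
    simp_rw [hLapp, Finset.sum_sub_distrib, ← Finset.sum_mul]
    ring
  have hpt : ∀ x, {x : Fin (M + 1) → ℝ | ∀ i, a i * ∑ j, x j ≤ x i}.indicator
      (fun x => ∏ i, expDensity (x i)) x = f (L x) := by
    intro x
    by_cases hx : ∀ i, a i * ∑ j, x j ≤ x i
    · have h0 : ∀ i, 0 ≤ L x i := fun i => by rw [hLapp]; linarith [hx i]
      have hS : 0 ≤ ∑ j, x j := by
        have := Finset.sum_nonneg fun i (_ : i ∈ Finset.univ) => h0 i
        rw [hsumL] at this
        exact nonneg_of_mul_nonneg_right this hb1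
      have hx0 : ∀ i, 0 ≤ x i := fun i => le_trans (mul_nonneg (ha i) hS) (hx i)
      rw [Set.indicator_of_mem (show x ∈ {x | ∀ i, a i * ∑ j, x j ≤ x i} from hx)]
      simp only [hf, expDensity]
      rw [Finset.prod_congr rfl fun i _ =>
        Set.indicator_of_mem (show x i ∈ Set.Ici 0 from hx0 i) _, Finset.prod_congr rfl fun i _ =>
        Set.indicator_of_mem (show L x i ∈ Set.Ici 0 from h0 i) _,
        ← ENNReal.ofReal_prod_of_nonneg fun i _ => (Real.exp_pos _).le,
        ← ENNReal.ofReal_prod_of_nonneg fun i _ => (Real.exp_pos _).le, ← Real.exp_sum,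
        ← Real.exp_sum, Finset.sum_neg_distrib, Finset.sum_neg_distrib, ← Finset.sum_div, hsumL,
        mul_div_cancel_left₀ _ hb1.ne']
    · rw [Set.indicator_of_notMem (show x ∉ {x | ∀ i, a i * ∑ j, x j ≤ x i} from hx)]
      push Not at hx
      obtain ⟨i, hi⟩ := hx
      symm
      refine Finset.prod_eq_zero (Finset.mem_univ i) (Set.indicator_of_notMem ?_ _)
      rw [hLapp, Set.mem_Ici, not_le]
      linarith
  simp_rw [hpt]
  have hLm : Measurable L := (LinearMap.continuous_of_finiteDimensional L).measurable
  rw [← lintegral_map hfm hLm,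
    Measure.map_linearMap_addHaar_eq_smul_addHaar _ (by rw [hdet]; exact hb1.ne'), hdet,
    lintegral_smul_measure, volume_pi, hf, lintegral_pi_fin_prod _ fun _ =>
      Measurable.indicator (by fun_prop) measurableSet_Ici]
  simp_rw [lintegral_indicator measurableSet_Ici, lintegral_exp_neg_div hb1]
  rw [Finset.prod_const, Finset.card_univ, Fintype.card_fin, abs_of_pos (by positivity),
    ← ENNReal.ofReal_pow hb1.le, smul_eq_mul, ← ENNReal.ofReal_mul (by positivity)]
  congr 1
  field_simp
  ring

/-! ### Gaussian vectors and the uniqueness of the isotropic law. -/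

/-- The law of a vector of independent standard complex Gaussian variables. -/
def gaussianVec (M : ℕ) : Measure (CVec M) :=
  (Measure.pi fun _ => stdComplexGaussian).map (WithLp.toLp 2)

instance isProbabilityMeasure_gaussianVec (M : ℕ) : IsProbabilityMeasure (gaussianVec M) :=
  Measure.isProbabilityMeasure_map (by fun_prop)

lemma stdComplexGaussian_singleton (z : ℂ) : stdComplexGaussian {z} = 0 := by
  rw [stdComplexGaussian_eq_withDensity]
  exact withDensity_absolutelyContinuous _ _ (measure_singleton z)

lemma charFun_stdComplexGaussian (w : ℂ) :
    charFun stdComplexGaussian w = Complex.exp (-‖w‖ ^ 2 / 4) := by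
  have h1 : ∀ p : ℝ × ℝ, Complex.exp
      ((inner ℝ (Complex.measurableEquivRealProd.symm p) w : ℝ) * Complex.I)
      = Complex.exp ((inner ℝ p.1 w.re : ℝ) * Complex.I)
        * Complex.exp ((inner ℝ p.2 w.im : ℝ) * Complex.I) := by
    intro p
    rw [← Complex.exp_add, ← add_mul]
    congr 2
    simp [Complex.inner, Complex.measurableEquivRealProd_symm_apply]
  rw [charFun_apply, stdComplexGaussian, integral_map_equiv]
  simp_rw [h1]
  rw [integral_prod_mul (fun x : ℝ => Complex.exp ((inner ℝ x w.re : ℝ) * Complex.I))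
    (fun x : ℝ => Complex.exp ((inner ℝ x w.im : ℝ) * Complex.I)), ← charFun_apply, ← charFun_apply,
    charFun_gaussianReal, charFun_gaussianReal, ← Complex.exp_add,
    show (‖w‖ : ℂ) ^ 2 = ((‖w‖ ^ 2 : ℝ) : ℂ) by push_cast; rfl, Complex.sq_norm, Complex.normSq_apply]
  congr 1
  push_cast
  ring

lemma charFun_gaussianVec {M : ℕ} (t : CVec M) :
    charFun (gaussianVec M) t = Complex.exp (-‖t‖ ^ 2 / 4) := by
  rw [gaussianVec, charFun_pi]
  simp_rw [charFun_stdComplexGaussian]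
  rw [← Complex.exp_sum, ← Complex.ofReal_pow, EuclideanSpace.norm_sq_eq]
  congr 1
  push_cast
  rw [← Finset.sum_div, Finset.sum_neg_distrib]

lemma CVec.real_inner_eq {M : ℕ} (x y : CVec M) : (inner ℝ x y : ℝ) = (inner ℂ x y : ℂ).re := by
  rw [PiLp.inner_apply, PiLp.inner_apply, Complex.re_sum]
  exact Finset.sum_congr rfl fun i _ => by simp [Complex.inner]

lemma charFun_map_isometry {M : ℕ} (τ : Measure (CVec M)) (U : CVec M ≃ₗᵢ[ℂ] CVec M) (t : CVec M) :
    charFun (τ.map U) t = charFun τ (U.symm t) := by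
  rw [charFun_apply, charFun_apply, integral_map (by fun_prop) (by fun_prop)]
  refine integral_congr_ae (ae_of_all _ fun x => ?_)
  have : (inner ℝ (U x) t : ℝ) = inner ℝ x (U.symm t) := by
    rw [CVec.real_inner_eq, CVec.real_inner_eq, ← U.inner_map_map x (U.symm t),
      U.apply_symm_apply]
  simp only [this]

/-- The characteristic function depends on the norm only. -/
lemma gaussianVec_map_isometry {M : ℕ} (U : CVec M ≃ₗᵢ[ℂ] CVec M) :
    (gaussianVec M).map U = gaussianVec M := by
  have : IsProbabilityMeasure ((gaussianVec M).map U) :=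
    Measure.isProbabilityMeasure_map (by fun_prop)
  refine Measure.ext_of_charFun (funext fun t => ?_)
  rw [charFun_map_isometry, charFun_gaussianVec, charFun_gaussianVec, U.symm.norm_map]

/-- A probability law on the unit sphere that is invariant under all unitary maps. -/
structure IsotropicLaw {M : ℕ} (τ : Measure (CVec M)) : Prop where
  isProbabilityMeasure : IsProbabilityMeasure τ
  norm_eq_one : ∀ᵐ v ∂τ, ‖v‖ = 1
  map_eq : ∀ U : CVec M ≃ₗᵢ[ℂ] CVec M, τ.map U = τ

/-- An orthonormal family of at most `M` vectors can be moved to coordinate vectors. -/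
lemma exists_isometry_inner_eq_coord {m l : ℕ} {q : Fin m → CVec (m + l)} (hq : Orthonormal ℂ q) :
    ∃ U : CVec (m + l) ≃ₗᵢ[ℂ] CVec (m + l),
      ∀ v i, (inner ℂ (q i) v : ℂ) = U v (Fin.castAdd l i) := by
  -- The zero vectors only pad the family to the full index type; orthonormality is needed on the
  -- range of `Fin.castAdd l` alone.
  have horth : Orthonormal ℂ ((Set.range (Fin.castAdd l)).domRestrict
      (Fin.append q (fun _ : Fin l => (0 : CVec (m + l))))) := by
    rw [orthonormal_iff_ite] at hq ⊢
    rintro ⟨-, i, rfl⟩ ⟨-, j, rfl⟩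
    simp [Set.domRestrict_apply, hq i j, Subtype.ext_iff]
  obtain ⟨b, hb⟩ := horth.exists_orthonormalBasis_extension_of_card_eq (by simp)
  refine ⟨b.repr, fun v i => ?_⟩
  rw [b.repr_apply_apply, hb _ ⟨i, rfl⟩, Fin.append_left]

/-- A unitary map moves `x` to the first coordinate vector, so the right-hand side does not involve
the direction `x`. -/
lemma IsotropicLaw.charFun_smul {M : ℕ} {τ : Measure (CVec (1 + M))} (hτ : IsotropicLaw τ)
    (r : ℝ) {x : CVec (1 + M)} (hx : ‖x‖ = 1) :
    charFun τ (r • x) = ∫ v, Complex.exp (((r * (v 0).re : ℝ) : ℂ) * Complex.I) ∂τ := by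
  have hq : Orthonormal ℂ (fun _ : Fin 1 => x) := by
    rw [orthonormal_iff_ite]
    intro i j
    simp [Subsingleton.elim i j, inner_self_eq_norm_sq_to_K, hx]
  obtain ⟨U, hU⟩ := exists_isometry_inner_eq_coord hq
  conv_rhs => rw [← hτ.map_eq U]
  rw [integral_map (by fun_prop) (by fun_prop), charFun_apply]
  refine integral_congr_ae (ae_of_all _ fun v => ?_)
  have h1 : U v 0 = inner ℂ x v := (hU v 0).symm
  have h2 : (inner ℝ v (r • x) : ℝ) = r * (inner ℂ x v : ℂ).re := by
    rw [inner_smul_right, real_inner_comm, CVec.real_inner_eq]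
  simp only [h1, h2]

/-- There is only one isotropic law. -/
lemma IsotropicLaw.unique {M : ℕ} {τ₁ τ₂ : Measure (CVec (1 + M))} (h₁ : IsotropicLaw τ₁)
    (h₂ : IsotropicLaw τ₂) : τ₁ = τ₂ := by
  have := h₁.isProbabilityMeasure
  have := h₂.isProbabilityMeasure
  -- Integrate the characteristic function of each law against the other one. On the unit sphere the
  -- integrands are constant, and by Fubini and the symmetry of the inner product the two double
  -- integrals agree.
  have hΦ : ∀ r : ℝ, ∫ v, Complex.exp (((r * (v 0).re : ℝ) : ℂ) * Complex.I) ∂τ₁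
      = ∫ v, Complex.exp (((r * (v 0).re : ℝ) : ℂ) * Complex.I) ∂τ₂ := by
    intro r
    have e1 : ∫ y, charFun τ₁ (r • y) ∂τ₂
        = ∫ v, Complex.exp (((r * (v 0).re : ℝ) : ℂ) * Complex.I) ∂τ₁ := by
      rw [integral_congr_ae (g := fun _ => ∫ v, Complex.exp (((r * (v 0).re : ℝ) : ℂ) * Complex.I) ∂τ₁)
        (by filter_upwards [h₂.norm_eq_one] with y hy using h₁.charFun_smul r hy)]
      simp
    have e2 : ∫ y, charFun τ₂ (r • y) ∂τ₁
        = ∫ v, Complex.exp (((r * (v 0).re : ℝ) : ℂ) * Complex.I) ∂τ₂ := by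
      rw [integral_congr_ae (g := fun _ => ∫ v, Complex.exp (((r * (v 0).re : ℝ) : ℂ) * Complex.I) ∂τ₂)
        (by filter_upwards [h₁.norm_eq_one] with y hy using h₂.charFun_smul r hy)]
      simp
    rw [← e1, ← e2]
    simp_rw [charFun_apply]
    rw [integral_integral_swap]
    · refine integral_congr_ae (ae_of_all _ fun x => integral_congr_ae (ae_of_all _ fun y => ?_))
      simp only [inner_smul_right, real_inner_comm]
    · refine (integrable_const (1 : ℝ)).mono' (Continuous.aestronglyMeasurable ?_)
        (ae_of_all _ fun p => ?_)
      · simp only [Function.uncurry_def]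
        fun_prop
      · simp only [Function.uncurry_def, Complex.norm_exp_ofReal_mul_I, le_refl]
  refine Measure.ext_of_charFun (funext fun t => ?_)
  rcases eq_or_ne t 0 with rfl | ht
  · simp
  · have hn : ‖t‖ ≠ 0 := norm_ne_zero_iff.2 ht
    have hx : ‖(‖t‖⁻¹ : ℝ) • t‖ = 1 := by
      rw [norm_smul, norm_inv, norm_norm, inv_mul_cancel₀ hn]
    have ht2 : t = ‖t‖ • ((‖t‖⁻¹ : ℝ) • t) := by rw [smul_smul, mul_inv_cancel₀ hn, one_smul]
    rw [ht2, h₁.charFun_smul _ hx, h₂.charFun_smul _ hx, hΦ]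

/-- The law of a normalized Gaussian vector. -/
def gaussianDirection (M : ℕ) : Measure (CVec M) :=
  (gaussianVec M).map fun g => ((‖g‖⁻¹ : ℝ) : ℂ) • g

lemma measurable_normalize {M : ℕ} : Measurable fun g : CVec M => ((‖g‖⁻¹ : ℝ) : ℂ) • g := by
  fun_prop

lemma gaussianVec_ae_ne_zero (M : ℕ) : ∀ᵐ g ∂gaussianVec (M + 1), g ≠ 0 := by
  have h := (measurePreserving_eval (fun _ : Fin (M + 1) => stdComplexGaussian) 0).measure_preimage
    (measurableSet_singleton (0 : ℂ)).nullMeasurableSet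
  rw [stdComplexGaussian_singleton] at h
  rw [ae_iff, gaussianVec, Measure.map_apply (by fun_prop) (by simp)]
  refine measure_mono_null (fun x hx => ?_) h
  have hx' : WithLp.toLp 2 x = (0 : CVec (M + 1)) := by simpa using hx
  exact congrArg (fun y : CVec (M + 1) => y 0) hx'

lemma isotropicLaw_gaussianDirection (M : ℕ) : IsotropicLaw (gaussianDirection (M + 1)) where
  isProbabilityMeasure := Measure.isProbabilityMeasure_map measurable_normalize.aemeasurable
  norm_eq_one := by
    rw [gaussianDirection, ae_map_iff measurable_normalize.aemeasurable
      (measurableSet_eq_fun (by fun_prop) (by fun_prop))]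
    filter_upwards [gaussianVec_ae_ne_zero M] with g hg
    rw [norm_smul, Complex.norm_real, norm_inv, norm_norm,
      inv_mul_cancel₀ (norm_ne_zero_iff.2 hg)]
  map_eq U := by
    rw [gaussianDirection, Measure.map_map (by fun_prop) measurable_normalize]
    conv_rhs => rw [← gaussianVec_map_isometry U, Measure.map_map measurable_normalize (by fun_prop)]
    congr 1
    ext1 g
    simp

/-- Multiplied by `‖g‖ ^ 2`, the event compares the exponential variables `‖g i‖ ^ 2` with their
sum, as in `exponential_survival`. -/
lemma gaussianDirection_survival (M : ℕ) {a : Fin (M + 1) → ℝ} (ha : ∀ i, 0 ≤ a i)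
    (hsum : ∑ i, a i < 1) :
    gaussianDirection (M + 1) {v | ∀ i, a i ≤ ‖v i‖ ^ 2}
      = ENNReal.ofReal ((1 - ∑ i, a i) ^ M) := by
  have hmeas : MeasurableSet {v : CVec (M + 1) | ∀ i, a i ≤ ‖v i‖ ^ 2} := by
    have : {v : CVec (M + 1) | ∀ i, a i ≤ ‖v i‖ ^ 2} = ⋂ i, {v | a i ≤ ‖v i‖ ^ 2} := by ext; simp
    rw [this]
    exact MeasurableSet.iInter fun i => measurableSet_le (by fun_prop) (by fun_prop)
  have hA : MeasurableSet {x : Fin (M + 1) → ℝ | ∀ i, a i * ∑ j, x j ≤ x i} := by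
    have : {x : Fin (M + 1) → ℝ | ∀ i, a i * ∑ j, x j ≤ x i}
        = ⋂ i, {x | a i * ∑ j, x j ≤ x i} := by ext; simp
    rw [this]
    exact MeasurableSet.iInter fun i => measurableSet_le (by fun_prop) (by fun_prop)
  rw [← exponential_survival M ha hsum, ← stdComplexGaussian_map_sq, ← Measure.pi_map_pi
    (fun _ => by fun_prop), Measure.map_apply (by fun_prop) hA, gaussianDirection,
    Measure.map_apply measurable_normalize hmeas]
  have hset : ∀ᵐ g ∂gaussianVec (M + 1),
      g ∈ (fun g => ((‖g‖⁻¹ : ℝ) : ℂ) • g) ⁻¹' {v : CVec (M + 1) | ∀ i, a i ≤ ‖v i‖ ^ 2} ↔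
      g ∈ {g : CVec (M + 1) | ∀ i, a i * ‖g‖ ^ 2 ≤ ‖g i‖ ^ 2} := by
    filter_upwards [gaussianVec_ae_ne_zero M] with g hg
    refine forall_congr' fun i => ?_
    have hn : 0 < ‖g‖ := norm_pos_iff.2 hg
    have h1 : ‖(((‖g‖⁻¹ : ℝ) : ℂ) • g) i‖ ^ 2 = ‖g i‖ ^ 2 / ‖g‖ ^ 2 := by
      rw [PiLp.smul_apply, norm_smul, Complex.norm_real, norm_inv, norm_norm]
      field_simp
    rw [h1, le_div_iff₀ (by positivity)]
  rw [measure_congr (Filter.eventuallyEq_set.2 hset), gaussianVec, Measure.map_apply (by fun_prop)]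
  · congr 1
    ext x
    simp [EuclideanSpace.norm_sq_eq]
  · have : {g : CVec (M + 1) | ∀ i, a i * ‖g‖ ^ 2 ≤ ‖g i‖ ^ 2}
        = ⋂ i, {g | a i * ‖g‖ ^ 2 ≤ ‖g i‖ ^ 2} := by ext; simp
    rw [this]
    exact MeasurableSet.iInter fun i => measurableSet_le (by fun_prop) (by fun_prop)

/-! ### Inner products with orthonormal vectors have a Dirichlet law. -/

lemma Measure.ext_of_forall_le_coord {m : ℕ} {μ ν : Measure (Fin m → ℝ)} [IsProbabilityMeasure μ]
    [IsProbabilityMeasure ν]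
    (h : ∀ a : Fin m → ℝ, μ {t | ∀ i, a i ≤ t i} = ν {t | ∀ i, a i ≤ t i}) : μ = ν := by
  have hgen : (MeasurableSpace.pi : MeasurableSpace (Fin m → ℝ)) = MeasurableSpace.generateFrom
      (Set.pi Set.univ '' Set.pi Set.univ fun _ : Fin m => Set.range (Set.Ici (α := ℝ))) := by
    refine (generateFrom_eq_pi (fun _ => ?_) fun _ => ?_).symm
    · rw [← borel_eq_generateFrom_Ici]
      exact (BorelSpace.measurable_eq (α := ℝ)).symm
    · refine ⟨fun n => Set.Ici (-(n : ℝ)), fun n => ⟨_, rfl⟩, ?_⟩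
      refine Set.eq_univ_of_forall fun x => Set.mem_iUnion.2 ?_
      obtain ⟨n, hn⟩ := exists_nat_gt (-x)
      exact ⟨n, by simp only [Set.mem_Ici]; linarith⟩
  refine ext_of_generate_finite _ hgen (IsPiSystem.pi fun _ => by
    simpa using isPiSystem_image_Ici (Set.univ : Set ℝ)) ?_ (by simp)
  rintro - ⟨s, hs, rfl⟩
  choose a ha using fun i => hs i (Set.mem_univ i)
  have : Set.pi Set.univ s = {t | ∀ i, a i ≤ t i} := by
    ext t
    simp [← ha, Set.mem_pi]
  rw [this, h]

/-- The squared moduli of the inner products of an isotropic unit vector with orthonormal vectors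
have a Dirichlet law. -/
lemma IsotropicLaw.map_sq_inner {m k : ℕ} {τ : Measure (CVec (m + 1 + (k + 1)))}
    (hτ : IsotropicLaw τ) {q : Fin (m + 1) → CVec (m + 1 + (k + 1))} (hq : Orthonormal ℂ q) :
    τ.map (fun v i => ‖(inner ℂ v (q i) : ℂ)‖ ^ 2) = dirichlet (m + 1) k := by
  have hprob := hτ.isProbabilityMeasure
  obtain ⟨U, hU⟩ := exists_isometry_inner_eq_coord hq
  have hT : Measurable fun (v : CVec (m + 1 + (k + 1))) (i : Fin (m + 1)) =>
      ‖v (Fin.castAdd (k + 1) i)‖ ^ 2 := by fun_prop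
  have e0 : (fun (v : CVec (m + 1 + (k + 1))) i => ‖(inner ℂ v (q i) : ℂ)‖ ^ 2)
      = (fun v i => ‖v (Fin.castAdd (k + 1) i)‖ ^ 2) ∘ U := by
    ext v i
    rw [norm_inner_symm, hU]
    rfl
  have hτ2 : τ = gaussianDirection (m + 1 + (k + 1)) := by
    have h2 := isotropicLaw_gaussianDirection (m + 1 + k)
    -- `IsotropicLaw.unique` needs the dimension in the form `1 + l`; everything else that depends
    -- on the dimension is cleared before it is rewritten.
    obtain ⟨l, hl⟩ : ∃ l, m + 1 + (k + 1) = 1 + l := ⟨m + 1 + k, by ring⟩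
    have h3 : IsotropicLaw (gaussianDirection (m + 1 + (k + 1))) := h2
    clear h2 e0 hT hU U hq
    revert h3 hτ
    clear hprob
    revert q τ
    rw [hl]
    intro τ _ h1 h2
    exact h1.unique h2
  rw [e0, ← Measure.map_map hT (by fun_prop), hτ.map_eq U, hτ2]
  have hG : IsProbabilityMeasure (gaussianDirection (m + 1 + (k + 1))) := hτ2 ▸ hprob
  have hG2 : IsProbabilityMeasure ((gaussianDirection (m + 1 + (k + 1))).map
      fun (v : CVec (m + 1 + (k + 1))) (i : Fin (m + 1)) => ‖v (Fin.castAdd (k + 1) i)‖ ^ 2) :=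
    Measure.isProbabilityMeasure_map hT.aemeasurable
  set ν := (gaussianDirection (m + 1 + (k + 1))).map
      fun (v : CVec (m + 1 + (k + 1))) (i : Fin (m + 1)) => ‖v (Fin.castAdd (k + 1) i)‖ ^ 2
  have hset : ∀ a : Fin (m + 1) → ℝ, MeasurableSet {t : Fin (m + 1) → ℝ | ∀ i, a i ≤ t i} := by
    intro a
    measurability
  have hlt : ∀ a : Fin (m + 1) → ℝ, (∀ i, 0 ≤ a i) → ∑ i, a i < 1 →
      ν {t | ∀ i, a i ≤ t i} = ENNReal.ofReal ((1 - ∑ i, a i) ^ (m + 1 + k)) := by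
    intro a ha hsum
    have hs : ∑ i, Fin.append a (fun _ : Fin (k + 1) => (0 : ℝ)) i = ∑ i, a i := by
      rw [Fin.sum_univ_add]
      simp
    have h := gaussianDirection_survival (m + 1 + k)
      (a := (Fin.append a (fun _ : Fin (k + 1) => (0 : ℝ)) : Fin (m + 1 + (k + 1)) → ℝ))
      (fun i => by
        refine Fin.addCases (m := m + 1) (n := k + 1) (fun i => ?_) (fun i => ?_) i
        · rw [Fin.append_left]; exact ha i
        · rw [Fin.append_right]) (by rw [← hs] at hsum; exact hsum)
    rw [Measure.map_apply hT (hset a)]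
    have hs' : ∑ i : Fin (m + 1 + k + 1), Fin.append a (fun _ : Fin (k + 1) => (0 : ℝ)) i = ∑ i, a i :=
      hs
    rw [hs'] at h
    rw [← h]
    congr 1
    ext v
    simp only [Set.mem_preimage, Set.mem_ofPred_eq]
    constructor
    · intro h i
      refine Fin.addCases (m := m + 1) (n := k + 1) (fun i => ?_) (fun i => ?_) i
      · rw [Fin.append_left]; exact h i
      · rw [Fin.append_right]; positivity
    · intro h i
      have := h (Fin.castAdd (k + 1) i)
      rwa [Fin.append_left] at this
  -- Scaling `a` down to the sum `s < 1` enlarges the event to one of probability `(1 - s) ^ (m + 1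
  -- + k)`; then `s → 1`.
  have hge : ∀ a : Fin (m + 1) → ℝ, (∀ i, 0 ≤ a i) → 1 ≤ ∑ i, a i →
      ν {t | ∀ i, a i ≤ t i} = 0 := by
    intro a ha hsum
    have hb : 0 < ∑ i, a i := by linarith
    have hbound : ∀ s : ℝ, 0 ≤ s → s < 1 →
        ν {t | ∀ i, a i ≤ t i} ≤ ENNReal.ofReal ((1 - s) ^ (m + 1 + k)) := by
      intro s hs hs1
      have hsc : ∑ i, s / (∑ j, a j) * a i = s := by
        rw [← Finset.mul_sum, div_mul_cancel₀ _ hb.ne']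
      have h := hlt (fun i => s / (∑ j, a j) * a i)
        (fun i => mul_nonneg (by positivity) (ha i)) (by rw [hsc]; exact hs1)
      rw [hsc] at h
      rw [← h]
      refine measure_mono fun t ht i => le_trans ?_ (ht i)
      refine mul_le_of_le_one_left (ha i) ?_
      rw [div_le_one hb]
      linarith
    have hlim : Tendsto (fun s : ℝ => ENNReal.ofReal ((1 - s) ^ (m + 1 + k)))
        (nhdsWithin 1 (Set.Iio 1)) (nhds 0) := by
      have : Continuous fun s : ℝ => ENNReal.ofReal ((1 - s) ^ (m + 1 + k)) :=
        ENNReal.continuous_ofReal.comp (by fun_prop)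
      have h2 := this.tendsto 1
      simp only [sub_self] at h2
      rw [zero_pow (by omega), ENNReal.ofReal_zero] at h2
      exact h2.mono_left nhdsWithin_le_nhds
    refine le_antisymm (ge_of_tendsto hlim ?_) zero_le
    filter_upwards [Ioo_mem_nhdsLT (show (0 : ℝ) < 1 by norm_num)] with s hs
    exact hbound s hs.1.le hs.2
  have hgeD : ∀ a : Fin (m + 1) → ℝ, (∀ i, 0 ≤ a i) → 1 ≤ ∑ i, a i →
      dirichlet (m + 1) k {t | ∀ i, a i ≤ t i} = 0 := by
    intro a ha hsum
    rw [← le_zero_iff, ← dirichlet_sum_eq m k 1]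
    refine measure_mono_ae ?_
    filter_upwards [ae_mem_solidSimplex (m + 1) k] with t ht h
    refine le_antisymm ht.2 (hsum.trans (Finset.sum_le_sum fun i _ => h i))
  refine Measure.ext_of_forall_le_coord fun a => ?_
  have hν0 : ∀ᵐ t ∂ν, ∀ i, 0 ≤ t i := by
    refine (ae_map_iff hT.aemeasurable (by measurability)).2 (ae_of_all _ fun v i => by positivity)
  -- Both laws live on nonnegative coordinates, so negative thresholds may be raised to `0`.
  have hmax : ∀ (ξ : Measure (Fin (m + 1) → ℝ)), (∀ᵐ t ∂ξ, ∀ i, 0 ≤ t i) →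
      ξ {t | ∀ i, a i ≤ t i} = ξ {t | ∀ i, max (a i) 0 ≤ t i} := by
    intro ξ hξ
    refine measure_congr ?_
    filter_upwards [hξ] with t ht
    exact propext ⟨fun h i => max_le (h i) (ht i), fun h i => (le_max_left _ _).trans (h i)⟩
  rw [hmax ν hν0, hmax _ ((ae_mem_solidSimplex (m + 1) k).mono fun t ht => ht.1)]
  have hmax0 : ∀ i, 0 ≤ max (a i) 0 := fun i => le_max_right _ _
  rcases lt_or_ge (∑ i, max (a i) 0) 1 with hs | hs
  · rw [hlt _ hmax0 hs, dirichlet_survival m k hmax0 hs.le]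
  · rw [hge _ hmax0 hs, hgeD _ hmax0 hs]

lemma norm_sub_sum_inner_sq {E : Type*} [NormedAddCommGroup E] [InnerProductSpace ℂ E] {m : ℕ}
    {q : Fin m → E} (hq : Orthonormal ℂ q) (v : E) :
    ‖v - ∑ i, inner ℂ (q i) v • q i‖ ^ 2 = ‖v‖ ^ 2 - ∑ i, ‖(inner ℂ v (q i) : ℂ)‖ ^ 2 := by
  have h1 : ‖∑ i, inner ℂ (q i) v • q i‖ ^ 2 = ∑ i, ‖(inner ℂ v (q i) : ℂ)‖ ^ 2 := by
    have h := hq.inner_sum (fun i => inner ℂ (q i) v) (fun i => inner ℂ (q i) v) Finset.univ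
    rw [inner_self_eq_norm_sq_to_K] at h
    have h2 := congrArg Complex.re h
    rw [Complex.re_sum] at h2
    have h3 : ∀ i, ((starRingEnd ℂ) (inner ℂ (q i) v) * inner ℂ (q i) v).re
        = ‖(inner ℂ v (q i) : ℂ)‖ ^ 2 := by
      intro i
      rw [← Complex.normSq_eq_conj_mul_self, Complex.ofReal_re, ← Complex.sq_norm, norm_inner_symm]
    simp_rw [h3] at h2
    rw [← h2]
    norm_cast
  have h2 : RCLike.re (inner ℂ v (∑ i, inner ℂ (q i) v • q i)) = ∑ i, ‖(inner ℂ v (q i) : ℂ)‖ ^ 2 := by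
    rw [inner_sum, map_sum]
    refine Finset.sum_congr rfl fun i _ => ?_
    rw [inner_smul_right, inner_mul_symm_re_eq_norm, norm_mul, norm_inner_symm, sq]
  rw [norm_sub_sq (𝕜 := ℂ), h1, h2]
  ring

lemma measurableSet_orthonormal {M m : ℕ} : MeasurableSet {q : Fin m → CVec M | Orthonormal ℂ q} := by
  have : {q : Fin m → CVec M | Orthonormal ℂ q}
      = ⋂ i, ⋂ j, {q | (inner ℂ (q i) (q j) : ℂ) = if i = j then 1 else 0} := by
    ext q
    simp [orthonormal_iff_ite]
  rw [this]
  exact MeasurableSet.iInter fun i => MeasurableSet.iInter fun j =>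
    measurableSet_eq_fun (by fun_prop) measurable_const

/-! ### The conditional c.d.f. for an isotropic vector and independent orthonormal vectors. -/

section Isotropic

variable {Ω : Type*} [MeasurableSpace Ω] {P : Measure Ω} [IsProbabilityMeasure P]

lemma IsIsotropicUnit.isotropicLaw {M : ℕ} {v : Ω → CVec M} (hv : IsIsotropicUnit P v) :
    IsotropicLaw (P.map v) where
  isProbabilityMeasure := Measure.isProbabilityMeasure_map hv.measurable.aemeasurable
  norm_eq_one := (ae_map_iff hv.measurable.aemeasurable
    (measurableSet_eq_fun (by fun_prop) (by fun_prop))).2 hv.norm_eq_one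
  map_eq U := by
    rw [Measure.map_map (by fun_prop) hv.measurable]
    exact hv.map_eq U

variable {m k : ℕ} {v : Ω → CVec (m + 1 + (k + 1))} {q : Fin (m + 1) → Ω → CVec (m + 1 + (k + 1))}

/-- The squared moduli of the inner products with independent random orthonormal vectors. -/
lemma measure_sq_inner_mem (hv : IsIsotropicUnit P v) (hqm : ∀ i, Measurable (q i))
    (hq : ∀ᵐ ω ∂P, Orthonormal ℂ fun i => q i ω) (hind : IndepFun v (fun ω i => q i ω) P)
    {B : Set (Fin (m + 1) → ℝ)} (hB : MeasurableSet B) :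
    P {ω | (fun i => ‖(inner ℂ (v ω) (q i ω) : ℂ)‖ ^ 2) ∈ B} = dirichlet (m + 1) k B := by
  have hQm : Measurable fun ω i => q i ω := measurable_pi_lambda _ hqm
  have hprod := (indepFun_iff_map_prod_eq_prod_map_map hv.measurable.aemeasurable
    hQm.aemeasurable).1 hind
  have hT : Measurable fun (p : CVec (m + 1 + (k + 1)) × (Fin (m + 1) → CVec (m + 1 + (k + 1))))
      (i : Fin (m + 1)) => ‖(inner ℂ p.1 (p.2 i) : ℂ)‖ ^ 2 := by fun_prop
  have : IsProbabilityMeasure (P.map fun ω i => q i ω) :=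
    Measure.isProbabilityMeasure_map hQm.aemeasurable
  have : IsProbabilityMeasure (P.map v) :=
    Measure.isProbabilityMeasure_map hv.measurable.aemeasurable
  have h1 : P {ω | (fun i => ‖(inner ℂ (v ω) (q i ω) : ℂ)‖ ^ 2) ∈ B}
      = (P.map fun ω => (v ω, fun i => q i ω))
        ((fun p i => ‖(inner ℂ p.1 (p.2 i) : ℂ)‖ ^ 2) ⁻¹' B) := by
    rw [Measure.map_apply (hv.measurable.prodMk hQm) (hT hB)]
    rfl
  rw [h1, hprod, Measure.prod_apply_symm (hT hB)]
  -- By independence the orthonormal family can be frozen, and the answer does not depend on it.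
  have h2 : ∀ᵐ y ∂(P.map fun ω i => q i ω), (P.map v)
      ((fun x => (x, y)) ⁻¹' ((fun (p : CVec (m + 1 + (k + 1)) × (Fin (m + 1) → CVec (m + 1 + (k + 1))))
        i => ‖(inner ℂ p.1 (p.2 i) : ℂ)‖ ^ 2) ⁻¹' B))
      = dirichlet (m + 1) k B := by
    have hon : ∀ᵐ y ∂(P.map fun ω i => q i ω), Orthonormal ℂ y :=
      (ae_map_iff hQm.aemeasurable measurableSet_orthonormal).2 hq
    filter_upwards [hon] with y hy
    rw [← hv.isotropicLaw.map_sq_inner hy, Measure.map_apply (by fun_prop) hB]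
    rfl
  rw [lintegral_congr_ae h2]
  simp

variable {δ : ℝ}

lemma semiOrthEvent_eq (hv : IsIsotropicUnit P v) (hqm : ∀ i, Measurable (q i))
    (hq : ∀ᵐ ω ∂P, Orthonormal ℂ fun i => q i ω) (hind : IndepFun v (fun ω i => q i ω) P)
    (hδ : 0 < δ) (hδ1 : δ < 1 / (m + 1 + k : ℝ)) :
    P.real (semiOrthEvent v q δ) = muPoly (m + 1 + k + 1) (m + 2) δ := by
  rw [← dirichlet_box_eq_muPoly m k hδ.le (succ_mul_le_one hδ1).le, measureReal_def,
    measureReal_def, ← measure_sq_inner_mem hv hqm hq hind (by measurability)]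
  rfl

lemma betaCDF_eq_betaFormula (hv : IsIsotropicUnit P v) (hqm : ∀ i, Measurable (q i))
    (hq : ∀ᵐ ω ∂P, Orthonormal ℂ fun i => q i ω) (hind : IndepFun v (fun ω i => q i ω) P)
    (hδ : 0 < δ) (hδ1 : δ < 1 / (m + 1 + k : ℝ)) (x : ℝ) :
    betaCDF P v q δ x = betaFormula (m + 1 + k + 1) (m + 2) δ x := by
  have hvm := hv.measurable
  have hs : MeasurableSet (semiOrthEvent v q δ) := by
    have : semiOrthEvent v q δ = ⋂ i, {ω | ‖(inner ℂ (v ω) (q i ω) : ℂ)‖ ^ 2 < δ} := by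
      ext; simp [semiOrthEvent]
    rw [this]
    exact MeasurableSet.iInter fun i => measurableSet_lt (by fun_prop) measurable_const
  have hB : MeasurableSet {t : Fin (m + 1) → ℝ | (∀ i, t i < δ) ∧ 1 - ∑ i, t i ≤ x} := by
    measurability
  rw [betaFormula_eq m k hδ hδ1, betaCDF, measureReal_def, cond_apply hs, ENNReal.toReal_mul, ENNReal.toReal_inv,
    ← measureReal_def, ← measureReal_def,
    semiOrthEvent_eq hv hqm hq hind hδ hδ1, inv_mul_eq_div]
  congr 1
  rw [measureReal_def, measureReal_def, ← measure_sq_inner_mem hv hqm hq hind hB]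
  congr 1
  refine measure_congr ?_
  filter_upwards [hq, hv.norm_eq_one] with ω h1 h2
  have h3 := norm_sub_sum_inner_sq h1 (v ω)
  rw [h2, one_pow] at h3
  refine propext (and_congr Iff.rfl ?_)
  change ‖v ω - ∑ i, inner ℂ (q i ω) (v ω) • q i ω‖ ^ 2 ≤ x ↔ _
  rw [h3]

end Isotropic

/-! ### User selection as a deterministic procedure: deletion of a user, phases, relabelling. -/

section Deterministic

variable {M K : ℕ}

/-- The vectors that semi-orthogonal user selection generates when it selects the users in `p`. -/
def gsList (v : Fin K → CVec M) (p : List (Fin K)) : List (CVec M) :=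
  p.foldl (fun b a => b ++ [((‖gsResidual b (v a)‖⁻¹ : ℝ) : ℂ) • gsResidual b (v a)]) []

open Classical in
/-- The candidates from `S` that are left after the users in `p` have been selected. -/
def susCand (v : Fin K → CVec M) (δ : ℝ) (S : Finset (Fin K)) (p : List (Fin K)) :
    Finset (Fin K) :=
  S.filter fun k => k ∉ p ∧ ∀ u ∈ gsList v p, ‖(inner ℂ (v k) u : ℂ)‖ ^ 2 < δ

/-- The selection metric after the users in `p` have been selected. -/
def susScore (lam : Fin K → ℝ) (v : Fin K → CVec M) (p : List (Fin K)) (k : Fin K) : ℝ :=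
  lam k * ‖gsResidual (gsList v p) (v k)‖ ^ 2

/-- The list of the first (at most) `j` selected users, when the selection starts from `S`. -/
def susHist (lam : Fin K → ℝ) (v : Fin K → CVec M) (δ : ℝ) (S : Finset (Fin K)) :
    ℕ → List (Fin K)
  | 0 => []
  | j + 1 => susHist lam v δ S j ++ (susSelect (susCand v δ S (susHist lam v δ S j))
      (susScore lam v (susHist lam v δ S j))).toList

lemma gsList_nil (v : Fin K → CVec M) : gsList v [] = [] := rfl

lemma gsList_append (v : Fin K → CVec M) (p : List (Fin K)) (a : Fin K) :
    gsList v (p ++ [a]) = gsList v p ++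
      [((‖gsResidual (gsList v p) (v a)‖⁻¹ : ℝ) : ℂ) • gsResidual (gsList v p) (v a)] := by
  simp [gsList, List.foldl_append]

lemma length_gsList (v : Fin K → CVec M) (p : List (Fin K)) : (gsList v p).length = p.length := by
  induction p using List.reverseRecOn with
  | nil => rfl
  | append_singleton p a ih => simp [gsList_append, ih]

lemma susSelect_eq_none_iff {S : Finset (Fin K)} {γ : Fin K → ℝ} :
    susSelect S γ = none ↔ S = ∅ := by
  rw [susSelect, List.argmax_eq_none, List.filter_eq_nil_iff]
  simp [Finset.eq_empty_iff_forall_notMem]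

/-- `List.argmax` takes the first maximizer, and the filtered list is increasing. So the set and the
metric determine the choice, whatever list represents the set. -/
lemma susSelect_eq_some_iff {S : Finset (Fin K)} {γ : Fin K → ℝ} {a : Fin K} :
    susSelect S γ = some a ↔ a ∈ S ∧ ∀ b ∈ S, γ b ≤ γ a ∧ (γ a ≤ γ b → a ≤ b) := by
  have hmem : ∀ b, b ∈ (List.finRange K).filter (fun k => k ∈ S) ↔ b ∈ S := by simp
  have hsorted : ((List.finRange K).filter fun k => k ∈ S).Pairwise (· < ·) :=
    (List.pairwise_lt_finRange K).filter _
  have hfwd : ∀ c, susSelect S γ = some c →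
      c ∈ S ∧ ∀ b ∈ S, γ b ≤ γ c ∧ (γ c ≤ γ b → c ≤ b) := by
    intro c hc
    obtain ⟨h1, h2, h3⟩ := List.mem_argmax_iff.1 hc
    refine ⟨(hmem c).1 h1, fun b hb => ⟨h2 b ((hmem b).2 hb), fun h => ?_⟩⟩
    have hb' := (hmem b).2 hb
    have hidx := h3 b hb' h
    rcases hidx.eq_or_lt with heq | hlt
    · exact le_of_eq ((List.idxOf_inj h1).1 heq)
    · have hcl := List.idxOf_lt_length_of_mem h1
      have hbl := List.idxOf_lt_length_of_mem hb'
      have := List.pairwise_iff_getElem.1 hsorted _ _ hcl hbl hlt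
      rw [List.getElem_idxOf hcl, List.getElem_idxOf hbl] at this
      exact this.le
  refine ⟨hfwd a, fun ⟨h1, h2⟩ => ?_⟩
  rcases hs : susSelect S γ with - | c
  · rw [susSelect_eq_none_iff] at hs
    simp [hs] at h1
  · obtain ⟨h3, h4⟩ := hfwd c hs
    have hle := (h4 a h1).2 (h2 c h3).1
    have hle2 := (h2 c h3).2 (h4 a h1).1
    rw [le_antisymm hle hle2]

lemma mem_susCand {v : Fin K → CVec M} {δ : ℝ} {S : Finset (Fin K)} {p : List (Fin K)} {k : Fin K} :
    k ∈ susCand v δ S p ↔ k ∈ S ∧ k ∉ p ∧ ∀ u ∈ gsList v p, ‖(inner ℂ (v k) u : ℂ)‖ ^ 2 < δ := by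
  classical
  simp [susCand]

variable {lam : Fin K → ℝ} {v : Fin K → CVec M} {δ : ℝ} {S : Finset (Fin K)}

lemma susHist_succ_of_none {j : ℕ} (h : susSelect (susCand v δ S (susHist lam v δ S j))
      (susScore lam v (susHist lam v δ S j)) = none) :
    susHist lam v δ S (j + 1) = susHist lam v δ S j := by
  rw [susHist, h]
  simp

lemma susHist_succ_of_some {j : ℕ} {a : Fin K}
    (h : susSelect (susCand v δ S (susHist lam v δ S j))
      (susScore lam v (susHist lam v δ S j)) = some a) :
    susHist lam v δ S (j + 1) = susHist lam v δ S j ++ [a] := by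
  rw [susHist, h]
  rfl

/-- The list of selected users determines the whole state. Conditioning on this list, which has
countably many values, is what makes measurability and union bounds possible. Iteration `j + 1` has
made at most `j` selections; a stopped procedure has a constant history. -/
lemma susState_eq (lam : Fin K → ℝ) (v : Fin K → CVec M) (δ : ℝ) (j : ℕ) :
    susState lam v δ (j + 1) = { cand := susCand v δ Finset.univ (susHist lam v δ Finset.univ j)
                                 basis := gsList v (susHist lam v δ Finset.univ j) } := by
  classical
  rw [susState, Nat.add_sub_cancel]
  induction j with
  | zero => simp [susHist, gsList_nil, susCand]
  | succ j ih =>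
    rw [Function.iterate_succ_apply', ih, susStep]
    rcases hs : susSelect (susCand v δ Finset.univ (susHist lam v δ Finset.univ j))
      (susScore lam v (susHist lam v δ Finset.univ j)) with - | a
    · have hs' := hs
      unfold susScore at hs'
      simp only [hs', susHist_succ_of_none hs]
    · have hs' := hs
      unfold susScore at hs'
      simp only [hs', susHist_succ_of_some hs, gsList_append, SUSState.mk.injEq, and_true]
      ext k
      simp only [Finset.mem_filter, mem_susCand, gsList_append, List.mem_append,
        List.mem_singleton, not_or, Finset.mem_univ, true_and]
      constructor
      · rintro ⟨⟨h1, h2⟩, h3, h4⟩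
        refine ⟨⟨h1, h3⟩, ?_⟩
        rintro u (hu | rfl)
        · exact h2 u hu
        · exact h4
      · rintro ⟨⟨h1, h3⟩, h2⟩
        exact ⟨⟨h1, fun u hu => h2 u (Or.inl hu)⟩, h3, h2 _ (Or.inr rfl)⟩

lemma susHist_succ_cases (lam : Fin K → ℝ) (v : Fin K → CVec M) (δ : ℝ) (S : Finset (Fin K))
    (j : ℕ) :
    (susCand v δ S (susHist lam v δ S j) = ∅ ∧ susHist lam v δ S (j + 1) = susHist lam v δ S j) ∨
    ∃ a ∈ susCand v δ S (susHist lam v δ S j), susSelect (susCand v δ S (susHist lam v δ S j))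
      (susScore lam v (susHist lam v δ S j)) = some a ∧
      susHist lam v δ S (j + 1) = susHist lam v δ S j ++ [a] := by
  rcases hs : susSelect (susCand v δ S (susHist lam v δ S j))
      (susScore lam v (susHist lam v δ S j)) with - | a
  · exact Or.inl ⟨susSelect_eq_none_iff.1 hs, susHist_succ_of_none hs⟩
  · exact Or.inr ⟨a, (susSelect_eq_some_iff.1 hs).1, rfl, susHist_succ_of_some hs⟩

lemma nodup_susHist (lam : Fin K → ℝ) (v : Fin K → CVec M) (δ : ℝ) (S : Finset (Fin K)) (j : ℕ) :
    (susHist lam v δ S j).Nodup := by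
  induction j with
  | zero => exact List.nodup_nil
  | succ j ih =>
    rcases susHist_succ_cases lam v δ S j with ⟨-, h⟩ | ⟨a, ha, -, h⟩
    · rwa [h]
    · rw [h, List.nodup_append_comm]
      simpa [ih] using (mem_susCand.1 ha).2.1

lemma mem_of_mem_susHist {j : ℕ} {k : Fin K} (hk : k ∈ susHist lam v δ S j) : k ∈ S := by
  induction j with
  | zero => simp [susHist] at hk
  | succ j ih =>
    rcases susHist_succ_cases lam v δ S j with ⟨-, h⟩ | ⟨a, ha, -, h⟩
    · exact ih (h ▸ hk)
    · rw [h, List.mem_append, List.mem_singleton] at hk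
      rcases hk with hk | rfl
      · exact ih hk
      · exact (mem_susCand.1 ha).1

lemma length_susHist_le (lam : Fin K → ℝ) (v : Fin K → CVec M) (δ : ℝ) (S : Finset (Fin K))
    (j : ℕ) : (susHist lam v δ S j).length ≤ j := by
  induction j with
  | zero => simp [susHist]
  | succ j ih =>
    rcases susHist_succ_cases lam v δ S j with ⟨-, h⟩ | ⟨a, ha, -, h⟩
    · rw [h]; omega
    · rw [h, List.length_append]; simpa using ih

lemma susHist_subset_succ {j : ℕ} {k : Fin K} (hk : k ∈ susHist lam v δ S j) :
    k ∈ susHist lam v δ S (j + 1) := by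
  rw [susHist]
  exact List.mem_append_left _ hk

/-- Deleting a user that is not selected does not change the selection. -/
lemma susHist_erase_eq {j : ℕ} {k : Fin K} (hk : k ∉ susHist lam v δ Finset.univ j) :
    susHist lam v δ (Finset.univ.erase k) j = susHist lam v δ Finset.univ j := by
  induction j with
  | zero => rfl
  | succ j ih =>
    have ih := ih fun h => hk (susHist_subset_succ h)
    have hsub : ∀ {p : List (Fin K)} {b : Fin K}, b ∈ susCand v δ (Finset.univ.erase k) p ↔
        b ≠ k ∧ b ∈ susCand v δ Finset.univ p := by
      intro p b
      simp [mem_susCand]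
    rcases susHist_succ_cases lam v δ Finset.univ j with ⟨h0, h⟩ | ⟨a, ha, hs, h⟩
    · rw [h, susHist_succ_of_none, ih]
      rw [ih, susSelect_eq_none_iff]
      refine Finset.eq_empty_of_forall_notMem fun b hb => ?_
      have := (hsub.1 hb).2
      simp [h0] at this
    · rw [h] at hk ⊢
      have hak : a ≠ k := by
        rintro rfl
        exact hk (by simp)
      rw [susHist_succ_of_some (a := a), ih]
      rw [ih]
      obtain ⟨h1, h2⟩ := susSelect_eq_some_iff.1 hs
      exact susSelect_eq_some_iff.2 ⟨hsub.2 ⟨hak, h1⟩, fun b hb => h2 b (hsub.1 hb).2⟩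

lemma mem_susCand_of_succ {j : ℕ} {k : Fin K} (hk : k ∈ susCand v δ S (susHist lam v δ S (j + 1))) :
    k ∈ susCand v δ S (susHist lam v δ S j) := by
  rcases susHist_succ_cases lam v δ S j with ⟨-, h⟩ | ⟨a, ha, -, h⟩
  · rwa [h] at hk
  · rw [h] at hk
    obtain ⟨h1, h2, h3⟩ := mem_susCand.1 hk
    refine mem_susCand.2 ⟨h1, fun h => h2 (List.mem_append_left _ h), fun u hu => h3 u ?_⟩
    rw [gsList_append]
    exact List.mem_append_left _ hu

/-- A present candidate was a candidate at every earlier iteration, so none of them lacked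
candidates. -/
lemma length_susHist_of_mem {j : ℕ} {k : Fin K} (hk : k ∈ susCand v δ S (susHist lam v δ S j)) :
    (susHist lam v δ S j).length = j := by
  induction j with
  | zero => rfl
  | succ j ih =>
    have h1 := mem_susCand_of_succ hk
    rcases susHist_succ_cases lam v δ S j with ⟨h0, -⟩ | ⟨a, ha, -, h⟩
    · simp [h0] at h1
    · rw [h, List.length_append, ih h1, List.length_singleton]

/-- The event that user `k` passes the tests against the vectors that are selected without it. -/
def passEvent (lam : Fin K → ℝ) (v : Fin K → CVec M) (δ : ℝ) (k : Fin K) (j : ℕ) : Prop :=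
  (susHist lam v δ (Finset.univ.erase k) j).length = j ∧
    ∀ u ∈ gsList v (susHist lam v δ (Finset.univ.erase k) j), ‖(inner ℂ (v k) u : ℂ)‖ ^ 2 < δ

/-- This decouples user `k`: `passEvent` only tests `v k` against a selection that ignores `k`, and
the second condition is violated with small probability. -/
lemma mem_susCand_univ_iff {j : ℕ} {k : Fin K} :
    k ∈ susCand v δ Finset.univ (susHist lam v δ Finset.univ j) ↔
      passEvent lam v δ k j ∧ k ∉ susHist lam v δ Finset.univ j := by
  constructor
  · intro h
    have hl := length_susHist_of_mem h
    obtain ⟨-, h2, h3⟩ := mem_susCand.1 h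
    refine ⟨?_, h2⟩
    rw [passEvent, susHist_erase_eq h2]
    exact ⟨hl, h3⟩
  · rintro ⟨⟨-, h1⟩, h2⟩
    rw [susHist_erase_eq h2] at h1
    exact mem_susCand.2 ⟨Finset.mem_univ _, h2, h1⟩

/-- The index `i` is the first iteration that finds no candidates; up to then every iteration has
selected a user. -/
lemma exists_susCand_empty {j : ℕ} (h : (susHist lam v δ S j).length ≠ j) :
    ∃ i < j, (susHist lam v δ S i).length = i ∧ susCand v δ S (susHist lam v δ S i) = ∅ := by
  induction j with
  | zero => simp [susHist] at h
  | succ j ih =>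
    by_cases hj : (susHist lam v δ S j).length = j
    · rcases susHist_succ_cases lam v δ S j with ⟨h0, -⟩ | ⟨a, ha, -, h'⟩
      · exact ⟨j, by omega, hj, h0⟩
      · exact absurd (by rw [h', List.length_append, hj, List.length_singleton]) h
    · obtain ⟨i, hi, h2⟩ := ih hj
      exact ⟨i, by omega, h2⟩

lemma gsList_congr {v' : Fin K → CVec M} {p : List (Fin K)} (h : ∀ k ∈ p, v k = v' k) :
    gsList v p = gsList v' p := by
  induction p using List.reverseRecOn with
  | nil => rw [gsList_nil, gsList_nil]
  | append_singleton p a ih =>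
    rw [gsList_append, gsList_append, ih fun k hk => h k (List.mem_append_left _ hk), h a (by simp)]

/-- The selection only depends on the users it starts from. -/
lemma susHist_congr {lam' : Fin K → ℝ} {v' : Fin K → CVec M} (h1 : ∀ k ∈ S, lam k = lam' k)
    (h2 : ∀ k ∈ S, v k = v' k) (j : ℕ) : susHist lam v δ S j = susHist lam' v' δ S j := by
  induction j with
  | zero => rfl
  | succ j ih =>
    have hgs : gsList v (susHist lam v δ S j) = gsList v' (susHist lam v δ S j) :=
      gsList_congr fun k hk => h2 k (mem_of_mem_susHist hk)
    have hc : susCand v δ S (susHist lam v δ S j) = susCand v' δ S (susHist lam v δ S j) := by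
      ext k
      rw [mem_susCand, mem_susCand, hgs]
      exact and_congr_right fun hk => by rw [h2 k hk]
    have hsel : susSelect (susCand v δ S (susHist lam v δ S j))
          (susScore lam v (susHist lam v δ S j))
        = susSelect (susCand v' δ S (susHist lam v δ S j))
          (susScore lam' v' (susHist lam v δ S j)) := by
      rcases hs : susSelect (susCand v' δ S (susHist lam v δ S j))
          (susScore lam' v' (susHist lam v δ S j)) with - | a
      · rw [hc]
        exact susSelect_eq_none_iff.2 (susSelect_eq_none_iff.1 hs)
      · rw [susSelect_eq_some_iff] at hs ⊢
        rw [hc]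
        refine ⟨hs.1, fun b hb => ?_⟩
        have ha' := (mem_susCand.1 hs.1).1
        have hb' := (mem_susCand.1 hb).1
        have h3 := hs.2 b hb
        simp only [susScore, hgs, h1 a ha', h1 b hb', h2 a ha', h2 b hb'] at h3 ⊢
        exact h3
    rw [susHist, susHist, hsel, ih]

section Phase

/-- Equality up to a unimodular factor. -/
def PhaseEq (x y : CVec M) : Prop := ∃ c : ℂ, ‖c‖ = 1 ∧ x = c • y

lemma gsResidual_smul (q : List (CVec M)) (c : ℂ) (x : CVec M) :
    gsResidual q (c • x) = c • gsResidual q x := by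
  simp only [gsResidual, smul_sub, inner_smul_right]
  congr 1
  induction q with
  | nil => simp
  | cons u q ih => simp [ih, smul_smul]

lemma gsResidual_phase {q q' : List (CVec M)} (h : List.Forall₂ PhaseEq q q') (x : CVec M) :
    gsResidual q x = gsResidual q' x := by
  unfold gsResidual
  congr 1
  induction h with
  | nil => rfl
  | @cons u u' q q' hu _ ih =>
    obtain ⟨c, hc, rfl⟩ := hu
    simp only [List.map_cons, List.sum_cons, ih, inner_smul_left, smul_smul]
    congr 2
    have : (starRingEnd ℂ) c * c = 1 := by
      rw [← Complex.normSq_eq_conj_mul_self, Complex.normSq_eq_norm_sq, hc]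
      simp
    linear_combination (inner ℂ u' x) * this

variable {v' : Fin K → CVec M}

lemma gsList_phase (h : ∀ k, PhaseEq (v k) (v' k)) (p : List (Fin K)) :
    List.Forall₂ PhaseEq (gsList v p) (gsList v' p) := by
  induction p using List.reverseRecOn with
  | nil => exact List.Forall₂.nil
  | append_singleton p a ih =>
    rw [gsList_append, gsList_append]
    refine List.rel_append ih (List.Forall₂.cons ?_ List.Forall₂.nil)
    obtain ⟨c, hc, hca⟩ := h a
    refine ⟨c, hc, ?_⟩
    rw [gsResidual_phase ih, hca, gsResidual_smul, norm_smul, hc, one_mul, smul_comm]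

lemma norm_gsResidual_phase (h : ∀ k, PhaseEq (v k) (v' k)) (p : List (Fin K)) (k : Fin K) :
    ‖gsResidual (gsList v p) (v k)‖ = ‖gsResidual (gsList v' p) (v' k)‖ := by
  obtain ⟨c, hc, hca⟩ := h k
  rw [gsResidual_phase (gsList_phase h p), hca, gsResidual_smul, norm_smul, hc, one_mul]

lemma susCand_phase (h : ∀ k, PhaseEq (v k) (v' k)) (p : List (Fin K)) :
    susCand v δ S p = susCand v' δ S p := by
  ext k
  rw [mem_susCand, mem_susCand]
  refine and_congr_right fun _ => and_congr_right fun _ => ?_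
  obtain ⟨c, hc, hca⟩ := h k
  have hinner : ∀ u, ‖(inner ℂ (v k) u : ℂ)‖ = ‖(inner ℂ (v' k) u : ℂ)‖ := fun u => by
    rw [hca, inner_smul_left, norm_mul, RCLike.norm_conj, hc, one_mul]
  simp_rw [hinner]
  have hp := gsList_phase h p
  generalize gsList v p = q at hp
  generalize gsList v' p = q' at hp
  induction hp with
  | nil => simp
  | @cons u u' q q' hu _ ih =>
    obtain ⟨d, hd, rfl⟩ := hu
    simp only [List.mem_cons, forall_eq_or_imp, ih, inner_smul_right, norm_mul, hd, one_mul]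

/-- The metric and the tests only use norms of residuals and moduli of inner products. Thus any
choice of principal vectors may be replaced by a canonical measurable one. -/
lemma susHist_phase (h : ∀ k, PhaseEq (v k) (v' k)) (j : ℕ) :
    susHist lam v δ S j = susHist lam v' δ S j := by
  induction j with
  | zero => rfl
  | succ j ih =>
    have hsc : ∀ p, susScore lam v p = susScore lam v' p := fun p => by
      ext k
      rw [susScore, susScore, norm_gsResidual_phase h]
    rw [susHist, susHist, ih, susCand_phase h, hsc]

end Phase

section Permutation

lemma gsList_comp (v : Fin K → CVec M) (σ : Equiv.Perm (Fin K)) (p : List (Fin K)) :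
    gsList (v ∘ σ) p = gsList v (p.map σ) := by
  induction p using List.reverseRecOn with
  | nil => rw [gsList_nil, List.map_nil, gsList_nil]
  | append_singleton p a ih =>
    rw [List.map_append, List.map_singleton, gsList_append, gsList_append, ih,
      Function.comp_apply]

/-- No two users have the same selection metric in the first `j` iterations. -/
def NoTie (lam : Fin K → ℝ) (v : Fin K → CVec M) (j : ℕ) : Prop :=
  ∀ p : List (Fin K), p.Nodup → p.length < j → ∀ a b, a ≠ b → a ∉ p → b ∉ p →
    susScore lam v p a ≠ susScore lam v p b

/-- The least-index rule is the only part of the selection that sees the labels, and without ties it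
is never invoked. -/
lemma susHist_comp {j : ℕ} (h : NoTie lam v j) (σ : Equiv.Perm (Fin K)) :
    (susHist (lam ∘ σ) (v ∘ σ) δ Finset.univ j).map σ = susHist lam v δ Finset.univ j := by
  induction j with
  | zero => rfl
  | succ j ih =>
    have ih := ih fun p hp hl => h p hp (by omega)
    set p' := susHist (lam ∘ σ) (v ∘ σ) δ Finset.univ j with hp'
    set p := susHist lam v δ Finset.univ j with hp
    have hc : ∀ b, b ∈ susCand (v ∘ σ) δ Finset.univ p' ↔ σ b ∈ susCand v δ Finset.univ p := by
      intro b
      rw [mem_susCand, mem_susCand, gsList_comp, ih, ← ih, List.mem_map_of_injective σ.injective]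
      simp
    have hsc : ∀ b, susScore (lam ∘ σ) (v ∘ σ) p' b = susScore lam v p (σ b) := by
      intro b
      rw [susScore, susScore, gsList_comp, ih]
      rfl
    rcases susHist_succ_cases lam v δ Finset.univ j with ⟨h0, h1⟩ | ⟨a, ha, hs, h1⟩
    · rw [h1, susHist_succ_of_none, ih]
      rw [susSelect_eq_none_iff]
      refine Finset.eq_empty_of_forall_notMem fun b hb => ?_
      have := (hc b).1 hb
      rw [← hp] at h0
      simp [h0] at this
    · have hstep : susHist (lam ∘ σ) (v ∘ σ) δ Finset.univ (j + 1) = p' ++ [σ.symm a] := by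
        refine susHist_succ_of_some (susSelect_eq_some_iff.2 ⟨?_, fun b hb => ?_⟩)
        · rw [hc, σ.apply_symm_apply]; exact ha
        · have h2 := (susSelect_eq_some_iff.1 hs).2 (σ b) ((hc b).1 hb)
          rw [← hp'] at *
          rw [hsc, hsc, σ.apply_symm_apply]
          refine ⟨h2.1, fun h3 => ?_⟩
          by_contra hne
          have hab : a ≠ σ b := by
            rintro rfl
            simp at hne
          refine h p (nodup_susHist _ _ _ _ _) (lt_of_le_of_lt (length_susHist_le _ _ _ _ _)
            (Nat.lt_succ_self j)) a (σ b) hab (mem_susCand.1 ha).2.1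
            (mem_susCand.1 ((hc b).1 hb)).2.1 (le_antisymm h3 h2.1)
      rw [hstep, h1, List.map_append, ih]
      simp [hp]

end Permutation

end Deterministic

/-! ### Resampling and permuting the coordinates of a product law. -/

section Resample

variable {ι : Type*} [Fintype ι] [DecidableEq ι] {X : Type*} [MeasurableSpace X]
  (ρ : Measure X) [IsProbabilityMeasure ρ]

/-- Replacing one coordinate by an independent copy does not change a product law. -/
lemma lintegral_resample {f : (ι → X) → ℝ≥0∞} (hf : Measurable f) (i : ι) :
    ∫⁻ z, f z ∂Measure.pi (fun _ : ι => ρ)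
      = ∫⁻ z, ∫⁻ y, f (Function.update z i y) ∂ρ ∂Measure.pi (fun _ : ι => ρ) := by
  rcases isEmpty_or_nonempty X with h | ⟨⟨x0⟩⟩
  · have : IsEmpty (ι → X) := ⟨fun z => h.elim (z i)⟩
    simp [lintegral_of_isEmpty]
  have hup : Measurable fun p : (ι → X) × X => Function.update p.1 i p.2 := measurable_update'
  have hg : Measurable fun z : ι → X => ∫⁻ y, f (Function.update z i y) ∂ρ :=
    (hf.comp hup).lintegral_prod_right'
  rw [lintegral_eq_lmarginal_univ (μ := fun _ : ι => ρ) (fun _ => x0),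
    lintegral_eq_lmarginal_univ (μ := fun _ : ι => ρ) (fun _ => x0),
    lmarginal_erase' _ hf (Finset.mem_univ i), lmarginal_erase' _ hg (Finset.mem_univ i)]
  simp

lemma measure_resample {A : Set (ι → X)} (hA : MeasurableSet A) (i : ι) :
    Measure.pi (fun _ : ι => ρ) A
      = ∫⁻ z, ρ {y | Function.update z i y ∈ A} ∂Measure.pi (fun _ : ι => ρ) := by
  rw [← lintegral_indicator_one hA, lintegral_resample ρ (measurable_one.indicator hA) i]
  refine lintegral_congr fun z => ?_
  have hm : MeasurableSet {y | Function.update z i y ∈ A} := measurable_update z hA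
  rw [← lintegral_indicator_one hm]
  rfl

/-- Used to freeze all users but one: whatever the others determine stays fixed while user `i` is
redrawn. -/
lemma measure_eq_zero_of_resample {A : Set (ι → X)} (hA : MeasurableSet A) (i : ι)
    (h : ∀ᵐ z ∂Measure.pi (fun _ : ι => ρ), ρ {y | Function.update z i y ∈ A} = 0) :
    Measure.pi (fun _ : ι => ρ) A = 0 := by
  rw [measure_resample ρ hA i, lintegral_congr_ae h, lintegral_zero]

end Resample

lemma pi_map_comp_perm {ι : Type*} [Fintype ι] {X : Type*} [MeasurableSpace X]
    (ρ : Measure X) [IsProbabilityMeasure ρ] (σ : Equiv.Perm ι) :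
    MeasurePreserving (fun z : ι → X => z ∘ σ) (Measure.pi fun _ : ι => ρ)
      (Measure.pi fun _ : ι => ρ) := by
  have h := measurePreserving_piCongrLeft (fun _ : ι => ρ) σ.symm
  have e : (MeasurableEquiv.piCongrLeft (fun _ : ι => X) σ.symm : (ι → X) → (ι → X))
      = fun z => z ∘ σ := by
    ext z a
    rw [MeasurableEquiv.coe_piCongrLeft]
    have := Equiv.piCongrLeft_apply_apply (fun _ : ι => X) σ.symm z (σ a)
    simpa using this
  rwa [e] at h

/-! ### Gram-Schmidt residuals for lists of vectors. -/

section OrthonormalList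

variable {M : ℕ}

/-- The vectors of a list are orthonormal. -/
def OrthonormalList (q : List (CVec M)) : Prop :=
  (∀ u ∈ q, ‖u‖ = 1) ∧ q.Pairwise fun u w => (inner ℂ u w : ℂ) = 0

lemma OrthonormalList.orthonormal_get {q : List (CVec M)} (hq : OrthonormalList q) :
    Orthonormal ℂ q.get := by
  refine ⟨fun i => hq.1 _ (List.get_mem q i), fun i j hij => ?_⟩
  rcases lt_or_gt_of_ne hij with h | h
  · exact List.pairwise_iff_get.1 hq.2 i j h
  · rw [inner_eq_zero_symm]
    exact List.pairwise_iff_get.1 hq.2 j i h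

lemma gsResidual_eq_sum (q : List (CVec M)) (x : CVec M) :
    gsResidual q x = x - ∑ i, inner ℂ (q.get i) x • q.get i := by
  rw [gsResidual]
  congr 1
  rw [← List.sum_ofFn]
  congr 1
  have := List.ofFn_get q
  conv_lhs => rw [← this]
  rw [List.map_ofFn]
  rfl

lemma OrthonormalList.norm_gsResidual_sq {q : List (CVec M)} (hq : OrthonormalList q) (x : CVec M) :
    ‖gsResidual q x‖ ^ 2 = ‖x‖ ^ 2 - ∑ i, ‖(inner ℂ x (q.get i) : ℂ)‖ ^ 2 := by
  rw [gsResidual_eq_sum, norm_sub_sum_inner_sq hq.orthonormal_get]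

lemma OrthonormalList.inner_gsResidual {q : List (CVec M)} (hq : OrthonormalList q) (x : CVec M)
    {u : CVec M} (hu : u ∈ q) : (inner ℂ u (gsResidual q x) : ℂ) = 0 := by
  obtain ⟨i, rfl⟩ := List.mem_iff_get.1 hu
  rw [gsResidual_eq_sum, inner_sub_right, hq.orthonormal_get.inner_right_fintype, sub_self]

lemma OrthonormalList.append {q : List (CVec M)} (hq : OrthonormalList q) {x : CVec M}
    (hx : gsResidual q x ≠ 0) :
    OrthonormalList (q ++ [((‖gsResidual q x‖⁻¹ : ℝ) : ℂ) • gsResidual q x]) := by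
  constructor
  · intro u hu
    rw [List.mem_append, List.mem_singleton] at hu
    rcases hu with hu | rfl
    · exact hq.1 u hu
    · rw [norm_smul, Complex.norm_real, norm_inv, norm_norm,
        inv_mul_cancel₀ (norm_ne_zero_iff.2 hx)]
  · refine List.pairwise_append.2 ⟨hq.2, List.pairwise_singleton _ _, fun u hu w hw => ?_⟩
    rw [List.mem_singleton] at hw
    rw [hw, inner_smul_right, hq.inner_gsResidual x hu, mul_zero]

end OrthonormalList

/-! ### Measurability of the selection. -/

section Measurability

variable {M K : ℕ} {Z : Type*} [MeasurableSpace Z]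

/-- A random list is replaced by a fixed list of measurable functions. This works for a fixed list
`p` of users; random histories are treated in `measurableSet_susHist` by a countable union over
their values. -/
lemma exists_measurable_gsList {v : Fin K → Z → CVec M} (hv : ∀ k, Measurable (v k))
    (p : List (Fin K)) :
    ∃ F : List (Z → CVec M), (∀ f ∈ F, Measurable f) ∧
      ∀ z, gsList (fun k => v k z) p = F.map fun f => f z := by
  induction p using List.reverseRecOn with
  | nil => exact ⟨[], by simp, fun z => by simp [gsList_nil]⟩
  | append_singleton p a ih =>
    obtain ⟨F, hF, hFz⟩ := ih
    have hres : Measurable fun z => gsResidual (F.map fun f => f z) (v a z) := by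
      simp only [gsResidual, List.map_map]
      refine (hv a).sub ?_
      clear hFz
      induction F with
      | nil => simp
      | cons f F ih =>
        have hf := hF f (by simp)
        have := ih fun g hg => hF g (by simp [hg])
        have hva := hv a
        simp only [List.map_cons, List.sum_cons, Function.comp_apply]
        fun_prop
    refine ⟨F ++ [fun z => ((‖gsResidual (F.map fun f => f z) (v a z)‖⁻¹ : ℝ) : ℂ)
      • gsResidual (F.map fun f => f z) (v a z)], ?_, fun z => ?_⟩
    · intro f hf
      rw [List.mem_append, List.mem_singleton] at hf
      rcases hf with hf | rfl
      · exact hF f hf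
      · fun_prop
    · rw [gsList_append, hFz]
      simp

lemma measurable_gsResidual {v : Fin K → Z → CVec M} (hv : ∀ k, Measurable (v k))
    (p : List (Fin K)) {x : Z → CVec M} (hx : Measurable x) :
    Measurable fun z => gsResidual (gsList (fun k => v k z) p) (x z) := by
  obtain ⟨F, hF, hFz⟩ := exists_measurable_gsList hv p
  simp only [hFz, gsResidual, List.map_map]
  refine hx.sub ?_
  clear hFz
  induction F with
  | nil => simp
  | cons f F ih =>
    have hf := hF f (by simp)
    have := ih fun g hg => hF g (by simp [hg])
    simp only [List.map_cons, List.sum_cons, Function.comp_apply]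
    fun_prop

lemma measurableSet_pass {v : Fin K → Z → CVec M} (hv : ∀ k, Measurable (v k))
    (p : List (Fin K)) {x : Z → CVec M} (hx : Measurable x) (δ : ℝ) :
    MeasurableSet {z | ∀ u ∈ gsList (fun k => v k z) p, ‖(inner ℂ (x z) u : ℂ)‖ ^ 2 < δ} := by
  obtain ⟨F, hF, hFz⟩ := exists_measurable_gsList hv p
  simp only [hFz, List.mem_map, forall_exists_index, and_imp, forall_apply_eq_imp_iff₂]
  clear hFz
  induction F with
  | nil => simp
  | cons f F ih =>
    have hf := hF f (by simp)
    have h2 := ih fun g hg => hF g (by simp [hg])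
    simp only [List.mem_cons, forall_eq_or_imp]
    have h3 : Measurable fun z => ‖(inner ℂ (x z) (f z) : ℂ)‖ ^ 2 := by fun_prop
    exact (measurableSet_lt h3 measurable_const).inter h2

variable {lam : Fin K → Z → ℝ} {v : Fin K → Z → CVec M}

lemma measurableSet_mem_susCand (hv : ∀ k, Measurable (v k)) (δ : ℝ) (S : Finset (Fin K))
    (p : List (Fin K)) (k : Fin K) :
    MeasurableSet {z | k ∈ susCand (fun k => v k z) δ S p} := by
  simp only [mem_susCand]
  by_cases h : k ∈ S ∧ k ∉ p
  · simpa [h.1, h.2] using measurableSet_pass hv p (hv k) δ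
  · have : {z | k ∈ S ∧ k ∉ p ∧ ∀ u ∈ gsList (fun k => v k z) p,
        ‖(inner ℂ (v k z) u : ℂ)‖ ^ 2 < δ} = ∅ := by
      ext z
      simp only [Set.mem_ofPred_eq, Set.mem_empty_iff_false, iff_false]
      tauto
    rw [this]
    exact MeasurableSet.empty

lemma measurable_susScore (hlam : ∀ k, Measurable (lam k)) (hv : ∀ k, Measurable (v k))
    (p : List (Fin K)) (k : Fin K) :
    Measurable fun z => susScore (fun k => lam k z) (fun k => v k z) p k := by
  have := measurable_gsResidual hv p (hv k)
  have := hlam k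
  unfold susScore
  fun_prop

lemma measurableSet_susSelect_eq (hlam : ∀ k, Measurable (lam k)) (hv : ∀ k, Measurable (v k))
    (δ : ℝ) (S : Finset (Fin K)) (p : List (Fin K)) (o : Option (Fin K)) :
    MeasurableSet {z | susSelect (susCand (fun k => v k z) δ S p)
      (susScore (fun k => lam k z) (fun k => v k z) p) = o} := by
  have hc := measurableSet_mem_susCand hv δ S p
  have hs := measurable_susScore hlam hv p
  rcases o with - | a
  · simp only [susSelect_eq_none_iff, Finset.eq_empty_iff_forall_notMem]
    have : {z | ∀ k, k ∉ susCand (fun k => v k z) δ S p}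
        = ⋂ k, {z | k ∈ susCand (fun k => v k z) δ S p}ᶜ := by ext; simp
    rw [this]
    exact MeasurableSet.iInter fun k => (hc k).compl
  · simp only [susSelect_eq_some_iff]
    have : {z | a ∈ susCand (fun k => v k z) δ S p ∧ ∀ b ∈ susCand (fun k => v k z) δ S p,
          susScore (fun k => lam k z) (fun k => v k z) p b
            ≤ susScore (fun k => lam k z) (fun k => v k z) p a ∧
          (susScore (fun k => lam k z) (fun k => v k z) p a
            ≤ susScore (fun k => lam k z) (fun k => v k z) p b → a ≤ b)}
        = {z | a ∈ susCand (fun k => v k z) δ S p} ∩ ⋂ b,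
          ({z | b ∈ susCand (fun k => v k z) δ S p}ᶜ ∪
          ({z | susScore (fun k => lam k z) (fun k => v k z) p b
            ≤ susScore (fun k => lam k z) (fun k => v k z) p a} ∩
          ({z | susScore (fun k => lam k z) (fun k => v k z) p a
            ≤ susScore (fun k => lam k z) (fun k => v k z) p b}ᶜ ∪ {_z | a ≤ b}))) := by
      ext z
      simp only [Set.mem_ofPred_eq, Set.mem_inter_iff, Set.mem_iInter, Set.mem_union,
        Set.mem_compl_iff, imp_iff_not_or]
    rw [this]
    exact (hc a).inter (MeasurableSet.iInter fun b => (hc b).compl.union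
      ((measurableSet_le (hs b) (hs a)).inter
        ((measurableSet_le (hs a) (hs b)).compl.union (MeasurableSet.const _))))

lemma measurableSet_susHist_eq (hlam : ∀ k, Measurable (lam k)) (hv : ∀ k, Measurable (v k))
    (δ : ℝ) (S : Finset (Fin K)) (j : ℕ) (p : List (Fin K)) :
    MeasurableSet {z | susHist (fun k => lam k z) (fun k => v k z) δ S j = p} := by
  induction j generalizing p with
  | zero =>
    simp only [susHist]
    exact MeasurableSet.const _
  | succ j ih =>
    have : {z | susHist (fun k => lam k z) (fun k => v k z) δ S (j + 1) = p}
        = ⋃ p' : List (Fin K), ⋃ o : Option (Fin K),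
          ({z | susHist (fun k => lam k z) (fun k => v k z) δ S j = p'} ∩
            {z | susSelect (susCand (fun k => v k z) δ S p')
              (susScore (fun k => lam k z) (fun k => v k z) p') = o}) ∩
            {_z | p' ++ o.toList = p} := by
      ext z
      simp only [Set.mem_ofPred_eq, Set.mem_iUnion, Set.mem_inter_iff]
      constructor
      · intro h
        exact ⟨_, _, ⟨rfl, rfl⟩, h⟩
      · rintro ⟨p', o, ⟨rfl, rfl⟩, h⟩
        exact h
    rw [this]
    exact MeasurableSet.iUnion fun p' => MeasurableSet.iUnion fun o =>
      ((ih p').inter (measurableSet_susSelect_eq hlam hv δ S p' o)).inter (MeasurableSet.const _)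

/-- An event that is measurable for each value of the history is measurable. -/
lemma measurableSet_susHist (hlam : ∀ k, Measurable (lam k)) (hv : ∀ k, Measurable (v k))
    (δ : ℝ) (S : Finset (Fin K)) (j : ℕ) {Φ : List (Fin K) → Z → Prop}
    (hΦ : ∀ p, MeasurableSet {z | Φ p z}) :
    MeasurableSet {z | Φ (susHist (fun k => lam k z) (fun k => v k z) δ S j) z} := by
  have : {z | Φ (susHist (fun k => lam k z) (fun k => v k z) δ S j) z}
      = ⋃ p, {z | susHist (fun k => lam k z) (fun k => v k z) δ S j = p} ∩ {z | Φ p z} := by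
    ext z
    simp
  rw [this]
  exact MeasurableSet.iUnion fun p => (measurableSet_susHist_eq hlam hv δ S j p).inter (hΦ p)

end Measurability

/-! ### Independent, identically distributed users. -/

section Users

variable {M K : ℕ}

/-- The eigenvalues in a configuration of users. -/
abbrev lamOf (z : Fin K → ℝ × CVec M) : Fin K → ℝ := fun i => (z i).1

/-- The directions in a configuration of users. -/
abbrev vecOf (z : Fin K → ℝ × CVec M) : Fin K → CVec M := fun i => (z i).2

/-- The properties of the law of the eigenvalue and the direction of a user that the analysis of
semi-orthogonal user selection needs. -/
structure UserLaw (ρ : Measure (ℝ × CVec M)) : Prop where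
  isProbabilityMeasure : IsProbabilityMeasure ρ
  isotropic : IsotropicLaw (ρ.map Prod.snd)
  score_ne : ∀ q : List (CVec M), OrthonormalList q → q.length < M → ∀ c : ℝ,
    ρ {y | y.1 * ‖gsResidual q y.2‖ ^ 2 = c} = 0

lemma measurable_lamOf (k : Fin K) : Measurable fun z : Fin K → ℝ × CVec M => lamOf z k := by
  fun_prop

lemma measurable_vecOf (k : Fin K) : Measurable fun z : Fin K → ℝ × CVec M => vecOf z k := by
  fun_prop

lemma gsList_vecOf_update {z : Fin K → ℝ × CVec M} {k : Fin K} {y : ℝ × CVec M} {p : List (Fin K)}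
    (hk : k ∉ p) : gsList (vecOf (Function.update z k y)) p = gsList (vecOf z) p :=
  gsList_congr fun l hl => by
    have : l ≠ k := fun h => hk (h ▸ hl)
    simp [vecOf, this]

lemma susHist_update {z : Fin K → ℝ × CVec M} {k : Fin K} {y : ℝ × CVec M} {δ : ℝ} {j : ℕ} :
    susHist (lamOf (Function.update z k y)) (vecOf (Function.update z k y)) δ
      (Finset.univ.erase k) j = susHist (lamOf z) (vecOf z) δ (Finset.univ.erase k) j :=
  susHist_congr (fun l hl => by simp [lamOf, Finset.ne_of_mem_erase hl])
    (fun l hl => by simp [vecOf, Finset.ne_of_mem_erase hl]) j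

variable {ρ : Measure (ℝ × CVec M)}

/-- A vanishing residual gives the metric the value `0`, which is not an atom. -/
lemma UserLaw.gsResidual_ne (hρ : UserLaw ρ) {q : List (CVec M)} (hq : OrthonormalList q)
    (hl : q.length < M) : ρ {y | gsResidual q y.2 = 0} = 0 := by
  refine measure_mono_null (fun y hy => ?_) (hρ.score_ne q hq hl 0)
  have hy : gsResidual q y.2 = 0 := hy
  simp [hy]

lemma UserLaw.ae_norm_eq_one (hρ : UserLaw ρ) : ∀ᵐ y ∂ρ, ‖y.2‖ = 1 :=
  ae_of_ae_map measurable_snd.aemeasurable hρ.isotropic.norm_eq_one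

/-- The Gram-Schmidt vectors of distinct users are orthonormal. -/
lemma UserLaw.ae_orthonormalList (hρ : UserLaw ρ) {p : List (Fin K)} (hp : p.Nodup)
    (hl : p.length ≤ M) :
    ∀ᵐ z ∂Measure.pi (fun _ : Fin K => ρ), OrthonormalList (gsList (vecOf z) p) := by
  have := hρ.isProbabilityMeasure
  induction p using List.reverseRecOn with
  | nil => exact ae_of_all _ fun z => by rw [gsList_nil]; exact ⟨by simp, List.Pairwise.nil⟩
  | append_singleton p a ih =>
    rw [List.length_append, List.length_singleton] at hl
    have hp1 := List.nodup_append_comm.1 hp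
    rw [List.singleton_append, List.nodup_cons] at hp1
    have ih := ih hp1.2 (by omega)
    have hmeas : MeasurableSet {z : Fin K → ℝ × CVec M |
        gsResidual (gsList (vecOf z) p) (vecOf z a) = 0} :=
      measurableSet_eq_fun (measurable_gsResidual measurable_vecOf p (measurable_vecOf a))
        measurable_const
    have hnull := measure_eq_zero_of_resample ρ hmeas a (by
      filter_upwards [ih] with z hz
      have h := hρ.gsResidual_ne hz (by rw [length_gsList]; omega)
      refine measure_mono_null (fun y hy => ?_) h
      simp only [Set.mem_ofPred_eq] at hy ⊢
      rwa [gsList_vecOf_update hp1.1, vecOf, Function.update_self] at hy)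
    have hne : ∀ᵐ z ∂Measure.pi (fun _ : Fin K => ρ),
        gsResidual (gsList (vecOf z) p) (vecOf z a) ≠ 0 := by
      rw [ae_iff]; simpa using hnull
    filter_upwards [ih, hne] with z h1 h2
    rw [gsList_append]
    exact h1.append h2

lemma UserLaw.ae_forall_orthonormalList (hρ : UserLaw ρ) :
    ∀ᵐ z ∂Measure.pi (fun _ : Fin K => ρ), ∀ p : List (Fin K), p.Nodup → p.length ≤ M →
      OrthonormalList (gsList (vecOf z) p) := by
  rw [ae_all_iff]
  intro p
  by_cases h : p.Nodup ∧ p.length ≤ M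
  · filter_upwards [hρ.ae_orthonormalList h.1 h.2] with z hz _ _ using hz
  · exact ae_of_all _ fun z h1 h2 => absurd ⟨h1, h2⟩ h

/-- Redraw user `a`: the vectors from `p` and the metric of `b` stay fixed, and the metric of `a`
has no atoms. -/
lemma UserLaw.ae_noTie (hρ : UserLaw ρ) {j : ℕ} (hj : j ≤ M) :
    ∀ᵐ z ∂Measure.pi (fun _ : Fin K => ρ), NoTie (lamOf z) (vecOf z) j := by
  have := hρ.isProbabilityMeasure
  unfold NoTie
  rw [ae_all_iff]
  intro p
  by_cases hpl : p.Nodup ∧ p.length < j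
  swap
  · exact ae_of_all _ fun z h1 h2 => absurd ⟨h1, h2⟩ hpl
  obtain ⟨hp, hl⟩ := hpl
  have hmain : ∀ a b, a ≠ b → a ∉ p → b ∉ p → ∀ᵐ z ∂Measure.pi (fun _ : Fin K => ρ),
      susScore (lamOf z) (vecOf z) p a ≠ susScore (lamOf z) (vecOf z) p b := by
    intro a b hab ha hb
    have hmeas : MeasurableSet {z : Fin K → ℝ × CVec M |
        susScore (lamOf z) (vecOf z) p a = susScore (lamOf z) (vecOf z) p b} :=
      measurableSet_eq_fun (measurable_susScore measurable_lamOf measurable_vecOf p a)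
        (measurable_susScore measurable_lamOf measurable_vecOf p b)
    have hnull := measure_eq_zero_of_resample ρ hmeas a (by
      filter_upwards [hρ.ae_orthonormalList hp (by omega)] with z hz
      have h := hρ.score_ne _ hz (by rw [length_gsList]; omega) (susScore (lamOf z) (vecOf z) p b)
      refine measure_mono_null (fun y hy => ?_) h
      simp only [Set.mem_ofPred_eq] at hy ⊢
      simp only [susScore, gsList_vecOf_update ha] at hy
      simpa [susScore, lamOf, vecOf, hab.symm] using hy)
    rw [ae_iff]
    simpa using hnull
  have h2 : ∀ᵐ z ∂Measure.pi (fun _ : Fin K => ρ), ∀ a b, a ≠ b → a ∉ p → b ∉ p →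
      susScore (lamOf z) (vecOf z) p a ≠ susScore (lamOf z) (vecOf z) p b := by
    rw [ae_all_iff]
    intro a
    rw [ae_all_iff]
    intro b
    by_cases h : a ≠ b ∧ a ∉ p ∧ b ∉ p
    · filter_upwards [hmain a b h.1 h.2.1 h.2.2] with z hz _ _ _ using hz
    · exact ae_of_all _ fun z h1 h2 h3 => absurd ⟨h1, h2, h3⟩ h
  filter_upwards [h2] with z hz _ _ using hz

/-- By exchangeability, a given user is selected in the first `j` iterations with probability at
most `j / K`. -/
lemma UserLaw.measure_mem_susHist_le (hρ : UserLaw ρ) {j : ℕ} (hj : j ≤ M) (δ : ℝ) (k : Fin K) :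
    (Measure.pi (fun _ : Fin K => ρ)).real
      {z | k ∈ susHist (lamOf z) (vecOf z) δ Finset.univ j} ≤ j / K := by
  classical
  have := hρ.isProbabilityMeasure
  set Q := Measure.pi (fun _ : Fin K => ρ)
  have hm : ∀ l : Fin K, MeasurableSet {z : Fin K → ℝ × CVec M |
      l ∈ susHist (lamOf z) (vecOf z) δ Finset.univ j} := fun l =>
    measurableSet_susHist measurable_lamOf measurable_vecOf δ Finset.univ j
      (Φ := fun p _ => l ∈ p) fun p => MeasurableSet.const _
  -- Transposing `k` and `l` preserves the product law and, outside the null set of ties, transposes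
  -- them in the history.
  have heq : ∀ l, Q.real {z | k ∈ susHist (lamOf z) (vecOf z) δ Finset.univ j}
      = Q.real {z | l ∈ susHist (lamOf z) (vecOf z) δ Finset.univ j} := by
    intro l
    have hp := (pi_map_comp_perm ρ (Equiv.swap k l)).measure_preimage (hm k).nullMeasurableSet
    rw [measureReal_def, measureReal_def, ← hp]
    congr 1
    refine measure_congr ?_
    filter_upwards [hρ.ae_noTie hj] with z hz
    have h := susHist_comp (δ := δ) hz (Equiv.swap k l)
    refine propext ?_
    change k ∈ susHist (lamOf z ∘ Equiv.swap k l) (vecOf z ∘ Equiv.swap k l) δ Finset.univ j ↔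
      l ∈ susHist (lamOf z) (vecOf z) δ Finset.univ j
    have h2 := List.mem_map_of_injective (Equiv.swap k l).injective (a := k)
      (l := susHist (lamOf z ∘ Equiv.swap k l) (vecOf z ∘ Equiv.swap k l) δ Finset.univ j)
    rw [Equiv.swap_apply_left, h] at h2
    exact h2.symm
  -- The sum is the expected number of selected users.
  have hsum : ∑ l, Q.real {z | l ∈ susHist (lamOf z) (vecOf z) δ Finset.univ j} ≤ j := by
    set f : Fin K → (Fin K → ℝ × CVec M) → ℝ := fun l =>
      Set.indicator {z | l ∈ susHist (lamOf z) (vecOf z) δ Finset.univ j} 1 with hf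
    have hint : ∀ l, Integrable (f l) Q := fun l => (integrable_const (1 : ℝ)).indicator (hm l)
    have h1 : ∀ l, Q.real {z | l ∈ susHist (lamOf z) (vecOf z) δ Finset.univ j}
        = ∫ z, f l z ∂Q := fun l => (integral_indicator_one (hm l)).symm
    calc ∑ l, Q.real {z | l ∈ susHist (lamOf z) (vecOf z) δ Finset.univ j}
        = ∫ z, ∑ l, f l z ∂Q := by
          rw [integral_finsetSum _ fun l _ => hint l]
          exact Finset.sum_congr rfl fun l _ => h1 l
      _ ≤ ∫ _z, (j : ℝ) ∂Q := by
          refine integral_mono (integrable_finsetSum _ fun l _ => hint l)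
            (integrable_const _) fun z => ?_
          have h2 : ∑ l, f l z
              = ((susHist (lamOf z) (vecOf z) δ Finset.univ j).toFinset.card : ℝ) := by
            have h4 : (Finset.univ.filter fun l => l ∈ susHist (lamOf z) (vecOf z) δ Finset.univ j)
                = (susHist (lamOf z) (vecOf z) δ Finset.univ j).toFinset := by
              ext l
              simp
            simp [hf, Set.indicator_apply, ← h4]
          have h3 := (List.toFinset_card_le (susHist (lamOf z) (vecOf z) δ Finset.univ j)).trans
            (length_susHist_le (lamOf z) (vecOf z) δ Finset.univ j)
          change ∑ l, f l z ≤ (j : ℝ)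
          rw [h2]
          exact_mod_cast h3
      _ = j := by simp
  simp_rw [← heq] at hsum
  rw [Finset.sum_const, Finset.card_univ, Fintype.card_fin, nsmul_eq_mul] at hsum
  have hK : (0 : ℝ) < K := by exact_mod_cast k.pos
  rw [le_div_iff₀ hK]
  linarith

/-- Bound for the probability that no user from `T` passes the tests against the Gram-Schmidt
vectors of the users in `p`. -/
lemma UserLaw.measure_forall_fail_le (hρ : UserLaw ρ) {p : List (Fin K)} (hp : p.Nodup)
    (hl : p.length ≤ M) {δ : ℝ} {θ : ℝ≥0∞}
    (hθ : ∀ q : List (CVec M), OrthonormalList q → q.length = p.length →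
      ρ {y | ¬ ∀ u ∈ q, ‖(inner ℂ y.2 u : ℂ)‖ ^ 2 < δ} ≤ θ)
    (T : Finset (Fin K)) (hT : ∀ l ∈ T, l ∉ p) :
    Measure.pi (fun _ : Fin K => ρ)
      {z | ∀ l ∈ T, ¬ ∀ u ∈ gsList (vecOf z) p, ‖(inner ℂ (vecOf z l) u : ℂ)‖ ^ 2 < δ}
      ≤ θ ^ T.card := by
  classical
  have := hρ.isProbabilityMeasure
  have hm : ∀ l : Fin K, MeasurableSet {z : Fin K → ℝ × CVec M |
      ¬ ∀ u ∈ gsList (vecOf z) p, ‖(inner ℂ (vecOf z l) u : ℂ)‖ ^ 2 < δ} := fun l =>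
    (measurableSet_pass measurable_vecOf p (measurable_vecOf l) δ).compl
  have hmT : ∀ T : Finset (Fin K), MeasurableSet {z : Fin K → ℝ × CVec M |
      ∀ l ∈ T, ¬ ∀ u ∈ gsList (vecOf z) p, ‖(inner ℂ (vecOf z l) u : ℂ)‖ ^ 2 < δ} := by
    intro T
    have : {z : Fin K → ℝ × CVec M |
        ∀ l ∈ T, ¬ ∀ u ∈ gsList (vecOf z) p, ‖(inner ℂ (vecOf z l) u : ℂ)‖ ^ 2 < δ}
        = ⋂ l ∈ T, {z | ¬ ∀ u ∈ gsList (vecOf z) p, ‖(inner ℂ (vecOf z l) u : ℂ)‖ ^ 2 < δ} := by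
      ext z; simp only [Set.mem_ofPred_eq, Set.mem_iInter]
    rw [this]
    exact Finset.measurableSet_biInter _ fun l _ => hm l
  -- Redraw the users of `T` one after another: none of them belongs to `p`, so the Gram-Schmidt
  -- vectors stay fixed and each new user contributes a factor `θ`.
  induction T using Finset.induction_on with
  | empty => simp
  | insert a T haT ih =>
    have ih := ih fun l hl => hT l (Finset.mem_insert_of_mem hl)
    have hap : a ∉ p := hT a (Finset.mem_insert_self _ _)
    rw [measure_resample ρ (hmT _) a, Finset.card_insert_of_notMem haT, pow_succ]
    calc _ ≤ ∫⁻ z, Set.indicator {z : Fin K → ℝ × CVec M |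
          ∀ l ∈ T, ¬ ∀ u ∈ gsList (vecOf z) p, ‖(inner ℂ (vecOf z l) u : ℂ)‖ ^ 2 < δ}
          (fun _ => θ) z ∂Measure.pi (fun _ : Fin K => ρ) := by
          refine lintegral_mono_ae ?_
          filter_upwards [hρ.ae_orthonormalList hp hl] with z hz
          by_cases hzT : ∀ l ∈ T, ¬ ∀ u ∈ gsList (vecOf z) p, ‖(inner ℂ (vecOf z l) u : ℂ)‖ ^ 2 < δ
          · rw [Set.indicator_of_mem (by exact hzT)]
            refine le_trans (measure_mono fun y hy => ?_) (hθ _ hz (length_gsList _ _))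
            have := hy a (Finset.mem_insert_self _ _)
            rw [gsList_vecOf_update hap] at this
            simpa [vecOf] using this
          · rw [Set.indicator_of_notMem (by exact hzT), nonpos_iff_eq_zero]
            convert measure_empty (μ := ρ)
            refine Set.eq_empty_of_forall_notMem fun y hy => hzT fun l hl => ?_
            have := hy l (Finset.mem_insert_of_mem hl)
            rw [gsList_vecOf_update hap] at this
            have hla : l ≠ a := fun h => haT (h ▸ hl)
            simpa only [vecOf, Function.update_of_ne hla] using this
      _ = θ * Measure.pi (fun _ : Fin K => ρ) {z : Fin K → ℝ × CVec M |
          ∀ l ∈ T, ¬ ∀ u ∈ gsList (vecOf z) p, ‖(inner ℂ (vecOf z l) u : ℂ)‖ ^ 2 < δ} := by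
          rw [lintegral_indicator (hmT T), setLIntegral_const]
      _ ≤ θ ^ T.card * θ := by
          rw [mul_comm]
          gcongr

end Users

/-! ### One user against the selection made by the others. -/

section DirichletUsers

variable {m k : ℕ} {ρ : Measure (ℝ × CVec (m + 1 + (k + 1)))}

/-- For a unit vector the tests and the residual are both functions of the squared inner products
with `q`, whose law is known by isotropy. -/
lemma UserLaw.measure_box_inter (hρ : UserLaw ρ) {q : List (CVec (m + 1 + (k + 1)))}
    (hq : OrthonormalList q) (hl : q.length = m + 1) (δ x : ℝ) :
    ρ {y | (∀ u ∈ q, ‖(inner ℂ y.2 u : ℂ)‖ ^ 2 < δ) ∧ ‖gsResidual q y.2‖ ^ 2 ≤ x}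
      = dirichlet (m + 1) k {t | (∀ i, t i < δ) ∧ 1 - ∑ i, t i ≤ x} := by
  have hon : Orthonormal ℂ fun i : Fin (m + 1) => q.get (Fin.cast hl.symm i) :=
    hq.orthonormal_get.comp _ (Fin.cast_injective _)
  have hB : MeasurableSet {t : Fin (m + 1) → ℝ | (∀ i, t i < δ) ∧ 1 - ∑ i, t i ≤ x} := by
    measurability
  have hT : Measurable fun (v : CVec (m + 1 + (k + 1))) (i : Fin (m + 1)) =>
      ‖(inner ℂ v (q.get (Fin.cast hl.symm i)) : ℂ)‖ ^ 2 := by fun_prop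
  rw [← hρ.isotropic.map_sq_inner hon, Measure.map_apply hT hB,
    Measure.map_apply measurable_snd (hT hB)]
  refine measure_congr ?_
  filter_upwards [hρ.ae_norm_eq_one] with y hy
  refine propext (and_congr ?_ ?_)
  · constructor
    · exact fun h i => h _ (List.get_mem q _)
    · intro h u hu
      obtain ⟨i, rfl⟩ := List.mem_iff_get.1 hu
      exact h (Fin.cast hl i)
  · have hs : ∑ i, ‖(inner ℂ y.2 (q.get i) : ℂ)‖ ^ 2
        = ∑ i : Fin (m + 1), ‖(inner ℂ y.2 (q.get (Fin.cast hl.symm i)) : ℂ)‖ ^ 2 :=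
      Fintype.sum_equiv (finCongr hl) _ _ fun i => rfl
    rw [hq.norm_gsResidual_sq, hy, one_pow, hs]

lemma UserLaw.measure_box (hρ : UserLaw ρ) {q : List (CVec (m + 1 + (k + 1)))}
    (hq : OrthonormalList q) (hl : q.length = m + 1) (δ : ℝ) :
    ρ {y | ∀ u ∈ q, ‖(inner ℂ y.2 u : ℂ)‖ ^ 2 < δ}
      = dirichlet (m + 1) k {t | ∀ i, t i < δ} := by
  have h := hρ.measure_box_inter hq hl δ 1
  have e1 : ρ {y | (∀ u ∈ q, ‖(inner ℂ y.2 u : ℂ)‖ ^ 2 < δ) ∧ ‖gsResidual q y.2‖ ^ 2 ≤ 1}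
      = ρ {y | ∀ u ∈ q, ‖(inner ℂ y.2 u : ℂ)‖ ^ 2 < δ} := by
    refine measure_congr ?_
    filter_upwards [hρ.ae_norm_eq_one] with y hy
    refine propext (and_iff_left ?_)
    rw [hq.norm_gsResidual_sq, hy, one_pow, sub_le_self_iff]
    positivity
  have e2 : dirichlet (m + 1) k {t | (∀ i, t i < δ) ∧ 1 - ∑ i, t i ≤ 1}
      = dirichlet (m + 1) k {t | ∀ i, t i < δ} := by
    refine measure_congr ?_
    filter_upwards [ae_mem_solidSimplex (m + 1) k] with t ht
    refine propext (and_iff_left ?_)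
    have : 0 ≤ ∑ i, t i := Finset.sum_nonneg fun i _ => ht.1 i
    change 1 - ∑ i, t i ≤ 1
    linarith
  rw [← e1, h, e2]

/-- The selection among the other users is independent of user `l`. -/
lemma UserLaw.measure_passEvent_inter (hρ : UserLaw ρ) {K : ℕ} (l : Fin K) (δ x : ℝ) :
    Measure.pi (fun _ : Fin K => ρ) {z | passEvent (lamOf z) (vecOf z) δ l (m + 1) ∧
      ‖gsResidual (gsList (vecOf z) (susHist (lamOf z) (vecOf z) δ (Finset.univ.erase l) (m + 1)))
        (vecOf z l)‖ ^ 2 ≤ x}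
      = dirichlet (m + 1) k {t | (∀ i, t i < δ) ∧ 1 - ∑ i, t i ≤ x}
        * Measure.pi (fun _ : Fin K => ρ)
          {z | (susHist (lamOf z) (vecOf z) δ (Finset.univ.erase l) (m + 1)).length = m + 1} := by
  have := hρ.isProbabilityMeasure
  have hL : MeasurableSet {z : Fin K → ℝ × CVec (m + 1 + (k + 1)) |
      (susHist (lamOf z) (vecOf z) δ (Finset.univ.erase l) (m + 1)).length = m + 1} :=
    measurableSet_susHist measurable_lamOf measurable_vecOf δ (Finset.univ.erase l) (m + 1)
      (Φ := fun p _ => p.length = m + 1) fun p => MeasurableSet.const _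
  have hA : MeasurableSet {z : Fin K → ℝ × CVec (m + 1 + (k + 1)) |
      passEvent (lamOf z) (vecOf z) δ l (m + 1) ∧
      ‖gsResidual (gsList (vecOf z) (susHist (lamOf z) (vecOf z) δ (Finset.univ.erase l) (m + 1)))
        (vecOf z l)‖ ^ 2 ≤ x} :=
    measurableSet_susHist measurable_lamOf measurable_vecOf δ (Finset.univ.erase l) (m + 1)
      (Φ := fun p z => (p.length = m + 1 ∧ ∀ u ∈ gsList (vecOf z) p,
        ‖(inner ℂ (vecOf z l) u : ℂ)‖ ^ 2 < δ) ∧ ‖gsResidual (gsList (vecOf z) p) (vecOf z l)‖ ^ 2 ≤ x)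
      fun p => ((MeasurableSet.const _).inter
        (measurableSet_pass measurable_vecOf p (measurable_vecOf l) δ)).inter
        (measurableSet_le ((measurable_gsResidual measurable_vecOf p
          (measurable_vecOf l)).norm.pow_const 2) measurable_const)
  rw [measure_resample ρ hA l, ← lintegral_indicator_one hL, ← lintegral_const_mul _
    (measurable_one.indicator hL)]
  refine lintegral_congr_ae ?_
  filter_upwards [hρ.ae_forall_orthonormalList] with z hz
  have hlp : l ∉ susHist (lamOf z) (vecOf z) δ (Finset.univ.erase l) (m + 1) := fun h => by
    simpa using mem_of_mem_susHist h
  -- The history without `l` ignores the redrawn user, so the inner probability concerns one user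
  -- and a fixed orthonormal list.
  simp only [passEvent, susHist_update, gsList_vecOf_update hlp]
  by_cases h : (susHist (lamOf z) (vecOf z) δ (Finset.univ.erase l) (m + 1)).length = m + 1
  · have hq := hz _ (nodup_susHist (lamOf z) (vecOf z) δ (Finset.univ.erase l) (m + 1))
      (by rw [h]; omega)
    rw [Set.indicator_of_mem (by exact h), Pi.one_apply, mul_one,
      ← hρ.measure_box_inter hq (by rw [length_gsList, h]) δ x]
    simp only [h, true_and, vecOf, Function.update_self]
  · rw [Set.indicator_of_notMem (by exact h), mul_zero]
    simp [h]

end DirichletUsers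

/-! ### The selection rarely runs out of candidates. -/

section Stuck

variable {M : ℕ} {ρ : Measure (ℝ × CVec M)}

lemma measurableSet_pass_const (q : List (CVec M)) (δ : ℝ) :
    MeasurableSet {y : ℝ × CVec M | ∀ u ∈ q, ‖(inner ℂ y.2 u : ℂ)‖ ^ 2 < δ} := by
  have : {y : ℝ × CVec M | ∀ u ∈ q, ‖(inner ℂ y.2 u : ℂ)‖ ^ 2 < δ}
      = ⋂ u ∈ {u | u ∈ q}, {y : ℝ × CVec M | ‖(inner ℂ y.2 u : ℂ)‖ ^ 2 < δ} := by
    ext y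
    simp
  rw [this]
  refine MeasurableSet.biInter (List.finite_toSet q).countable fun u _ => ?_
  exact measurableSet_lt (by fun_prop) measurable_const

lemma UserLaw.le_measure_pass_of_length (hρ : UserLaw ρ) {q : List (CVec M)}
    (hq : OrthonormalList q) {i κ : ℕ} (hM : M = i + 1 + (κ + 1)) (hl : q.length = i + 1) {δ : ℝ}
    (hδ : 0 < δ) (hδ1 : δ < 1 / (i + 1 + κ : ℝ)) :
    (1 / (i + 1 + κ : ℝ)) ^ κ * δ ^ (i + 1)
      ≤ ρ.real {y | ∀ u ∈ q, ‖(inner ℂ y.2 u : ℂ)‖ ^ 2 < δ} := by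
  subst hM
  rw [measureReal_def, hρ.measure_box hq hl, ← measureReal_def]
  exact le_dirichlet_box i κ hδ hδ1

/-- One bound for all stages: a list of `i + 1 ≤ M - 2` vectors is passed with probability at least
a constant times `δ ^ (i + 1)`, the worst case being `δ ^ (M - 2)`, and the empty list is always
passed. -/
lemma UserLaw.le_measure_pass (hρ : UserLaw ρ) {q : List (CVec M)} (hq : OrthonormalList q)
    (hl : q.length + 2 ≤ M) {δ : ℝ} (hδ : 0 < δ) (hδ1 : δ < 1 / ((M : ℝ) - 1)) :
    (1 / ((M : ℝ) - 1)) ^ (M - 1) * δ ^ (M - 2)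
      ≤ ρ.real {y | ∀ u ∈ q, ‖(inner ℂ y.2 u : ℂ)‖ ^ 2 < δ} := by
  have := hρ.isProbabilityMeasure
  have hM2 : (2 : ℝ) ≤ M := by exact_mod_cast (by omega : 2 ≤ M)
  have hc0 : 0 ≤ 1 / ((M : ℝ) - 1) := by
    apply one_div_nonneg.2; linarith
  have hc1 : 1 / ((M : ℝ) - 1) ≤ 1 := by
    rw [div_le_one (by linarith)]; linarith
  have hδle : δ ≤ 1 := hδ1.le.trans hc1
  rcases Nat.eq_zero_or_pos q.length with h0 | h0
  · rw [List.length_eq_zero_iff] at h0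
    subst h0
    simp only [List.not_mem_nil, false_imp_iff, implies_true]
    rw [show {y : ℝ × CVec M | True} = Set.univ from rfl, probReal_univ]
    exact mul_le_one₀ (pow_le_one₀ hc0 hc1) (by positivity) (pow_le_one₀ hδ.le hδle)
  · obtain ⟨i, hi⟩ : ∃ i, q.length = i + 1 := ⟨q.length - 1, by omega⟩
    obtain ⟨κ, hκ⟩ : ∃ κ, M = i + 1 + (κ + 1) := ⟨M - i - 2, by omega⟩
    have hMr : (M : ℝ) - 1 = i + 1 + κ := by rw [hκ]; push_cast; ring
    rw [hMr] at hc0 hc1 hδ1 ⊢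
    refine le_trans ?_ (hρ.le_measure_pass_of_length hq hκ hi hδ hδ1)
    exact mul_le_mul (pow_le_pow_of_le_one hc0 hc1 (by omega))
      (pow_le_pow_of_le_one hδ.le hδle (by omega)) (by positivity) (by positivity)

/-- Bound for the probability that the selection among the users other than `l` runs out of
candidates. -/
lemma UserLaw.measure_length_ne_le (hρ : UserLaw ρ) {K : ℕ} (l : Fin K) {j : ℕ} (hj : j + 1 ≤ M)
    {δ : ℝ} {θ : ℝ≥0∞} (hθ1 : θ ≤ 1)
    (hθ : ∀ q : List (CVec M), OrthonormalList q → q.length + 2 ≤ M →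
      ρ {y | ¬ ∀ u ∈ q, ‖(inner ℂ y.2 u : ℂ)‖ ^ 2 < δ} ≤ θ) :
    Measure.pi (fun _ : Fin K => ρ)
      {z | (susHist (lamOf z) (vecOf z) δ (Finset.univ.erase l) j).length ≠ j}
      ≤ ∑ i ∈ Finset.range j, (K : ℝ≥0∞) ^ i * θ ^ (K - 1 - i) := by
  classical
  set Q := Measure.pi (fun _ : Fin K => ρ)
  set T : List (Fin K) → Finset (Fin K) := fun p => Finset.univ.erase l \ p.toFinset with hT
  set B : List (Fin K) → Set (Fin K → ℝ × CVec M) := fun p =>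
    {z | ∀ a ∈ T p, ¬ ∀ u ∈ gsList (vecOf z) p, ‖(inner ℂ (vecOf z a) u : ℂ)‖ ^ 2 < δ} with hB
  have hBle : ∀ p : List (Fin K), p.Nodup → p.length + 2 ≤ M →
      Q (B p) ≤ θ ^ (K - 1 - p.length) := by
    intro p hp hl
    refine le_trans (hρ.measure_forall_fail_le hp (by omega)
      (fun q hq hql => hθ q hq (by omega)) (T p) fun a ha => ?_) ?_
    · simp only [hT, Finset.mem_sdiff, List.mem_toFinset] at ha
      exact ha.2
    · refine pow_le_pow_right_of_le_one' hθ1 ?_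
      have h1 := Finset.le_card_sdiff p.toFinset (Finset.univ.erase l)
      rw [Finset.card_erase_of_mem (Finset.mem_univ l), Finset.card_univ, Fintype.card_fin] at h1
      have h2 := List.toFinset_card_le p
      simp only [hT]
      omega
  -- The history depends on the users that must fail, so it is replaced by all `K ^ i` possible
  -- lists of `i` users. For each fixed list, at least `K - 1 - i` users outside it, other than `l`,
  -- have to fail independently.
  have hsub : {z : Fin K → ℝ × CVec M |
      (susHist (lamOf z) (vecOf z) δ (Finset.univ.erase l) j).length ≠ j}
      ⊆ ⋃ i ∈ Finset.range j, ⋃ f : Fin i → Fin K,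
        {z | (List.ofFn f).Nodup ∧ z ∈ B (List.ofFn f)} := by
    intro z hz
    obtain ⟨i, hi, hlen, hemp⟩ := exists_susCand_empty hz
    simp only [Set.mem_iUnion]
    set p := susHist (lamOf z) (vecOf z) δ (Finset.univ.erase l) i with hp
    refine ⟨i, Finset.mem_range.2 hi, fun a => p.get (Fin.cast hlen.symm a), ?_⟩
    have hof : List.ofFn (fun a : Fin i => p.get (Fin.cast hlen.symm a)) = p := by
      conv_rhs => rw [← List.ofFn_get p]
      exact (List.ofFn_congr hlen _).symm
    rw [Set.mem_ofPred_eq, hof]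
    refine ⟨nodup_susHist _ _ _ _ _, fun a ha hpass => ?_⟩
    simp only [hT, Finset.mem_sdiff, List.mem_toFinset] at ha
    have : a ∈ susCand (vecOf z) δ (Finset.univ.erase l) p := mem_susCand.2 ⟨ha.1, ha.2, hpass⟩
    rw [hemp] at this
    simp at this
  refine (measure_mono hsub).trans ((measure_biUnion_finset_le _ _).trans
    (Finset.sum_le_sum fun i hi => ?_))
  refine (measure_iUnion_fintype_le _ _).trans ?_
  refine (Finset.sum_le_sum (g := fun _ => θ ^ (K - 1 - i)) fun f _ => ?_).trans ?_
  · by_cases h : (List.ofFn f).Nodup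
    · have := hBle (List.ofFn f) h (by rw [List.length_ofFn]; have := Finset.mem_range.1 hi; omega)
      rw [List.length_ofFn] at this
      simpa [h] using this
    · simp [h]
  · simp

end Stuck

/-! ### Two estimates for the limit. -/

section Limits

/-- Put `y = K δ^(M-2)`. Eventually `K δ^(M-1) ≥ 1`, hence `K ≤ K (K δ^(M-1))^(M-2) = y^(M-1)`. As
`K - 1 - i ≥ K / 2` eventually, each term is at most `y^((M-1)i) exp(-c y / 2)`, and `y → ∞`. -/
lemma tendsto_sum_pow_mul_pow {M j : ℕ} (hM : 2 ≤ M) {c : ℝ} (hc : 0 < c) (hc1 : c ≤ 1)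
    {δ : ℕ → ℝ} (hδ : ∀ K, 0 < δ K) (hδ1 : ∀ K, δ K ≤ 1)
    (hlim : Tendsto (fun K : ℕ => (K : ℝ) * δ K ^ (M - 1)) atTop atTop) :
    Tendsto (fun K : ℕ => ∑ i ∈ Finset.range j, (K : ℝ) ^ i * (1 - c * δ K ^ (M - 2)) ^ (K - 1 - i))
      atTop (nhds 0) := by
  set y : ℕ → ℝ := fun K => (K : ℝ) * δ K ^ (M - 2) with hy
  have hylim : Tendsto y atTop atTop := by
    refine tendsto_atTop_mono (fun K => ?_) hlim
    exact mul_le_mul_of_nonneg_left (pow_le_pow_of_le_one (hδ K).le (hδ1 K) (by omega))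
      (Nat.cast_nonneg K)
  have hy0 : ∀ K, 0 ≤ y K := fun K => mul_nonneg (Nat.cast_nonneg K) (pow_nonneg (hδ K).le _)
  have hKy : ∀ᶠ K : ℕ in atTop, (K : ℝ) ≤ y K ^ (M - 1) := by
    filter_upwards [hlim.eventually_ge_atTop 1, eventually_gt_atTop 0] with K hK hK0
    have hK0 : (0 : ℝ) < K := by exact_mod_cast hK0
    obtain ⟨r, rfl⟩ : ∃ r, M = r + 2 := ⟨M - 2, by omega⟩
    simp only [hy, Nat.add_sub_cancel, show r + 2 - 1 = r + 1 by omega] at hK ⊢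
    calc (K : ℝ) = K * 1 ^ r := by simp
      _ ≤ K * (K * δ K ^ (r + 1)) ^ r := by gcongr
      _ = (K * δ K ^ r) ^ (r + 1) := by ring
  have hmain : ∀ i ∈ Finset.range j,
      Tendsto (fun K : ℕ => (K : ℝ) ^ i * (1 - c * δ K ^ (M - 2)) ^ (K - 1 - i)) atTop (nhds 0) := by
    intro i _
    have h1 := (Real.tendsto_pow_mul_exp_neg_atTop_nhds_zero ((M - 1) * i)).comp
      (hylim.const_mul_atTop (half_pos hc))
    have h2 := h1.const_mul ((2 / c) ^ ((M - 1) * i))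
    rw [mul_zero] at h2
    refine squeeze_zero' (Eventually.of_forall fun K => ?_) ?_ h2
    · have : 0 ≤ 1 - c * δ K ^ (M - 2) := by
        have := mul_le_one₀ hc1 (by have := hδ K; positivity)
          (pow_le_one₀ (hδ K).le (hδ1 K) (n := M - 2))
        linarith
      positivity
    · filter_upwards [hKy, eventually_ge_atTop (2 * (1 + i))] with K hK hKi
      have hx0 : 0 ≤ c * δ K ^ (M - 2) := by have := hδ K; positivity
      have hx1 : 0 ≤ 1 - c * δ K ^ (M - 2) := by
        have := mul_le_one₀ hc1 (by have := hδ K; positivity)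
          (pow_le_one₀ (hδ K).le (hδ1 K) (n := M - 2))
        linarith
      have hexp : (1 - c * δ K ^ (M - 2)) ^ (K - 1 - i) ≤ Real.exp (-(c / 2 * y K)) := by
        calc (1 - c * δ K ^ (M - 2)) ^ (K - 1 - i)
            ≤ Real.exp (-(c * δ K ^ (M - 2))) ^ (K - 1 - i) :=
              pow_le_pow_left₀ hx1 (Real.one_sub_le_exp_neg _) _
          _ = Real.exp (((K - 1 - i : ℕ) : ℝ) * -(c * δ K ^ (M - 2))) := by rw [← Real.exp_nat_mul]
          _ ≤ _ := by
            apply Real.exp_le_exp.2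
            have h3 : (K : ℝ) / 2 ≤ ((K - 1 - i : ℕ) : ℝ) := by
              rw [div_le_iff₀ two_pos]
              exact_mod_cast (by omega : K ≤ (K - 1 - i) * 2)
            have := mul_le_mul_of_nonneg_right h3 hx0
            simp only [hy]
            linarith
      have hK0 : (0 : ℝ) ≤ K := Nat.cast_nonneg K
      have hpow : (K : ℝ) ^ i ≤ y K ^ ((M - 1) * i) := by
        rw [pow_mul]
        exact pow_le_pow_left₀ hK0 hK i
      have heq : (2 / c) ^ ((M - 1) * i) * ((c / 2 * y K) ^ ((M - 1) * i)) =
          y K ^ ((M - 1) * i) := by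
        rw [← mul_pow]
        congr 1
        field_simp
      simp only [Function.comp_apply]
      rw [← mul_assoc, heq]
      exact mul_le_mul hpow hexp (pow_nonneg hx1 _) (pow_nonneg (hy0 K) _)
  simpa using tendsto_finsetSum _ hmain

/-- Here `b / a` is a conditional probability, `L` the probability that the run without the user is
not stuck, and `h` the probability that the user is selected. The factor `L` cancels, so it only has
to stay away from `0`, while `h` has to be small relative to `μ`. The constant `η = ε / (4 (1 + ε))`
ensures `η < ε (1/2 - η)`. -/
lemma abs_div_sub_div_lt {a b D μ L h ε : ℝ} (hε : 0 < ε) (hμ : 0 < μ) (hD0 : 0 ≤ D) (hD : D ≤ μ)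
    (hL : 1 / 2 ≤ L) (hh : h ≤ μ * (ε / (4 * (1 + ε)))) (ha : μ * L - h ≤ a) (ha' : a ≤ μ * L)
    (hb : D * L - h ≤ b) (hb' : b ≤ D * L) : 0 < a ∧ |b / a - D / μ| < ε := by
  set η := ε / (4 * (1 + ε)) with hη
  have hη0 : 0 < η := by positivity
  have hη1 : η < ε * (1 / 2 - η) := by
    have : η * (4 * (1 + ε)) = ε := by rw [hη]; field_simp
    nlinarith
  have hη2 : η < 1 / 4 := by
    rw [hη, div_lt_iff₀ (by positivity)]
    linarith
  have hL' : μ * (1 / 2) ≤ μ * L := mul_le_mul_of_nonneg_left hL hμ.le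
  have haμ : μ * (1 / 2 - η) ≤ a := by linarith
  have ha0 : 0 < a := lt_of_lt_of_le (mul_pos hμ (by linarith)) haμ
  refine ⟨ha0, ?_⟩
  have hh0 : 0 ≤ h := by linarith
  have h1 : |b * μ - D * a| ≤ h * μ := by
    rw [abs_le]
    constructor <;> nlinarith
  rw [div_sub_div _ _ ha0.ne' hμ.ne', abs_div, abs_of_pos (mul_pos ha0 hμ),
    div_lt_iff₀ (mul_pos ha0 hμ), mul_comm a D]
  calc |b * μ - D * a| ≤ h * μ := h1
    _ ≤ μ * η * μ := by gcongr
    _ < ε * (μ * (1 / 2 - η)) * μ := by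
      have : μ * η < ε * (μ * (1 / 2 - η)) := by nlinarith
      gcongr
    _ ≤ ε * a * μ := by gcongr
    _ = ε * (a * μ) := by ring

end Limits

/-! ### The conditional law of the projection variable. -/

section Conditional

variable {m k : ℕ} {ρ : Measure (ℝ × CVec (m + 1 + (k + 1)))}

lemma UserLaw.measure_passEvent (hρ : UserLaw ρ) {K : ℕ} (l : Fin K) (δ : ℝ) :
    Measure.pi (fun _ : Fin K => ρ) {z | passEvent (lamOf z) (vecOf z) δ l (m + 1)}
      = dirichlet (m + 1) k {t | ∀ i, t i < δ}
        * Measure.pi (fun _ : Fin K => ρ)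
          {z | (susHist (lamOf z) (vecOf z) δ (Finset.univ.erase l) (m + 1)).length = m + 1} := by
  have := hρ.isProbabilityMeasure
  have h := hρ.measure_passEvent_inter l δ 1
  have e2 : dirichlet (m + 1) k {t | (∀ i, t i < δ) ∧ 1 - ∑ i, t i ≤ 1}
      = dirichlet (m + 1) k {t | ∀ i, t i < δ} := by
    refine measure_congr ?_
    filter_upwards [ae_mem_solidSimplex (m + 1) k] with t ht
    refine propext (and_iff_left ?_)
    have : 0 ≤ ∑ i, t i := Finset.sum_nonneg fun i _ => ht.1 i
    change 1 - ∑ i, t i ≤ 1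
    linarith
  rw [← e2, ← h]
  refine measure_congr ?_
  have hn : ∀ᵐ z ∂Measure.pi (fun _ : Fin K => ρ), ‖(z l).2‖ = 1 :=
    (measurePreserving_eval (fun _ : Fin K => ρ) l).quasiMeasurePreserving.ae hρ.ae_norm_eq_one
  filter_upwards [hρ.ae_forall_orthonormalList, hn] with z hz hzl
  refine propext ((and_iff_left_of_imp fun hp => ?_).symm)
  have hq := hz _ (nodup_susHist (lamOf z) (vecOf z) δ (Finset.univ.erase l) (m + 1))
    (by rw [hp.1]; omega)
  rw [hq.norm_gsResidual_sq, hzl, one_pow, sub_le_self_iff]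
  positivity

/-- The law of the projection variable of a candidate is close to the law for deterministic
orthonormal vectors. -/
lemma UserLaw.abs_cond_sub_lt (hρ : UserLaw ρ) {K : ℕ} (l : Fin K) {δ ε : ℝ} (hε : 0 < ε)
    (hδ : 0 < δ) (hδ1 : δ < 1 / (m + 1 + k : ℝ))
    (hL : (Measure.pi (fun _ : Fin K => ρ)).real {z |
      (susHist (lamOf z) (vecOf z) δ (Finset.univ.erase l) (m + 1)).length ≠ m + 1} ≤ 1 / 2)
    (hK : ((m + 1 : ℕ) : ℝ) / K ≤ muPoly (m + 1 + k + 1) (m + 2) δ * (ε / (4 * (1 + ε)))) :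
    0 < (Measure.pi (fun _ : Fin K => ρ)).real {z |
      l ∈ susCand (vecOf z) δ Finset.univ (susHist (lamOf z) (vecOf z) δ Finset.univ (m + 1))} ∧
    ∀ x, |(cond (Measure.pi (fun _ : Fin K => ρ)) {z |
      l ∈ susCand (vecOf z) δ Finset.univ (susHist (lamOf z) (vecOf z) δ Finset.univ (m + 1))}).real
        {z | ‖gsResidual (gsList (vecOf z) (susHist (lamOf z) (vecOf z) δ Finset.univ (m + 1)))
          (vecOf z l)‖ ^ 2 ≤ x} - betaFormula (m + 1 + k + 1) (m + 2) δ x| < ε := by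
  have := hρ.isProbabilityMeasure
  set Q := Measure.pi (fun _ : Fin K => ρ)
  set μ := muPoly (m + 1 + k + 1) (m + 2) δ with hμ
  set E := {z : Fin K → ℝ × CVec (m + 1 + (k + 1)) |
    passEvent (lamOf z) (vecOf z) δ l (m + 1)} with hE
  set H := {z : Fin K → ℝ × CVec (m + 1 + (k + 1)) |
    l ∈ susHist (lamOf z) (vecOf z) δ Finset.univ (m + 1)} with hH
  set A := {z : Fin K → ℝ × CVec (m + 1 + (k + 1)) | l ∈ susCand (vecOf z) δ Finset.univ
    (susHist (lamOf z) (vecOf z) δ Finset.univ (m + 1))} with hA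
  set G := {z : Fin K → ℝ × CVec (m + 1 + (k + 1)) |
    (susHist (lamOf z) (vecOf z) δ (Finset.univ.erase l) (m + 1)).length = m + 1} with hG
  have hAm : MeasurableSet A :=
    measurableSet_susHist measurable_lamOf measurable_vecOf δ Finset.univ (m + 1)
      (Φ := fun p z => l ∈ susCand (vecOf z) δ Finset.univ p) fun p =>
        measurableSet_mem_susCand measurable_vecOf δ Finset.univ p l
  have hGm : MeasurableSet G :=
    measurableSet_susHist measurable_lamOf measurable_vecOf δ (Finset.univ.erase l) (m + 1)
      (Φ := fun p _ => p.length = m + 1) fun p => MeasurableSet.const _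
  have hAE : A = E \ H := by
    ext z
    exact mem_susCand_univ_iff
  have hHle : Q.real H ≤ μ * (ε / (4 * (1 + ε))) :=
    (hρ.measure_mem_susHist_le (by omega) δ l).trans hK
  have hGge : 1 / 2 ≤ Q.real G := by
    have h1 : Q.real Gᶜ = 1 - Q.real G := probReal_compl_eq_one_sub hGm
    have h2 : Q.real Gᶜ ≤ 1 / 2 := hL
    linarith
  have hμbox : (dirichlet (m + 1) k).real {t | ∀ i, t i < δ} = μ :=
    dirichlet_box_eq_muPoly m k hδ.le (succ_mul_le_one hδ1).le
  have hμ0 : 0 < μ := muPoly_pos m k hδ hδ1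
  have hQE : Q.real E = μ * Q.real G := by
    rw [measureReal_def, hρ.measure_passEvent l δ, ENNReal.toReal_mul, ← hμbox]
    rfl
  have hdiff : ∀ S : Set (Fin K → ℝ × CVec (m + 1 + (k + 1))),
      Q.real S - Q.real H ≤ Q.real (S \ H) ∧ Q.real (S \ H) ≤ Q.real S := fun S =>
    ⟨le_measureReal_sdiff, measureReal_mono Set.sdiff_subset⟩
  have hA1 := hdiff E
  rw [← hAE, hQE] at hA1
  -- Positivity does not involve the numerator, so the estimate is applied with a trivial one.
  refine ⟨(abs_div_sub_div_lt (D := 0) (b := 0) hε hμ0 le_rfl hμ0.le hGge hHle hA1.1 hA1.2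
    (by simp) (by simp)).1, fun x => ?_⟩
  set B := {z : Fin K → ℝ × CVec (m + 1 + (k + 1)) |
    ‖gsResidual (gsList (vecOf z) (susHist (lamOf z) (vecOf z) δ Finset.univ (m + 1)))
      (vecOf z l)‖ ^ 2 ≤ x} with hB
  set B' := {z : Fin K → ℝ × CVec (m + 1 + (k + 1)) |
    ‖gsResidual (gsList (vecOf z) (susHist (lamOf z) (vecOf z) δ (Finset.univ.erase l) (m + 1)))
      (vecOf z l)‖ ^ 2 ≤ x} with hB'
  -- Outside `H` the histories with and without `l` agree, so the residual may be taken with respect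
  -- to the latter.
  have hAB : A ∩ B = (E ∩ B') \ H := by
    ext z
    rw [hAE]
    simp only [Set.mem_inter_iff, Set.mem_sdiff]
    by_cases hz : z ∈ H
    · simp [hz]
    · have : z ∈ B ↔ z ∈ B' := by
        simp only [hB, hB', Set.mem_ofPred_eq, susHist_erase_eq (show l ∉ _ from hz)]
      rw [this]
      tauto
  have hQEB : Q.real (E ∩ B')
      = (dirichlet (m + 1) k).real {t | (∀ i, t i < δ) ∧ 1 - ∑ i, t i ≤ x} * Q.real G := by
    have := hρ.measure_passEvent_inter l δ x
    rw [measureReal_def, measureReal_def, measureReal_def, ← ENNReal.toReal_mul, ← this]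
    rfl
  have hAB1 := hdiff (E ∩ B')
  rw [← hAB, hQEB] at hAB1
  rw [measureReal_def, cond_apply hAm, ENNReal.toReal_mul, ENNReal.toReal_inv, ← measureReal_def,
    ← measureReal_def, betaFormula_eq m k hδ hδ1, ← div_eq_inv_mul]
  refine (abs_div_sub_div_lt hε hμ0 measureReal_nonneg ?_ hGge hHle hA1.1 hA1.2 hAB1.1 hAB1.2).2
  rw [← hμbox]
  exact measureReal_mono fun t ht => ht.1

/-- The large-system law of the projection variable of a candidate. -/
lemma UserLaw.eventually_abs_cond_sub_lt (hρ : UserLaw ρ) {δ : ℕ → ℝ} (hδ : ∀ K, 0 < δ K)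
    (hδ1 : ∀ K, δ K < 1 / (m + 1 + k : ℝ))
    (hlim : Tendsto (fun K : ℕ => (K : ℝ) * δ K ^ (m + 1 + k)) atTop atTop) {ε : ℝ} (hε : 0 < ε) :
    ∀ᶠ K : ℕ in atTop, ∀ l : Fin K,
    0 < (Measure.pi (fun _ : Fin K => ρ)).real {z | l ∈ susCand (vecOf z) (δ K) Finset.univ
      (susHist (lamOf z) (vecOf z) (δ K) Finset.univ (m + 1))} ∧
    ∀ x, |(cond (Measure.pi (fun _ : Fin K => ρ)) {z | l ∈ susCand (vecOf z) (δ K) Finset.univ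
      (susHist (lamOf z) (vecOf z) (δ K) Finset.univ (m + 1))}).real
        {z | ‖gsResidual (gsList (vecOf z) (susHist (lamOf z) (vecOf z) (δ K) Finset.univ (m + 1)))
          (vecOf z l)‖ ^ 2 ≤ x} - betaFormula (m + 1 + k + 1) (m + 2) (δ K) x| < ε := by
  have := hρ.isProbabilityMeasure
  have hc0 : (0 : ℝ) < 1 / (m + 1 + k : ℝ) := by positivity
  have hc1 : 1 / (m + 1 + k : ℝ) ≤ 1 := by
    rw [div_le_one (by positivity)]
    have : (0 : ℝ) ≤ m + k := by positivity
    linarith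
  have hδle : ∀ K, δ K ≤ 1 := fun K => (hδ1 K).le.trans hc1
  obtain ⟨M, hM⟩ : ∃ M, M = m + 1 + (k + 1) := ⟨_, rfl⟩
  have hMr : (M : ℝ) - 1 = m + 1 + k := by rw [hM]; push_cast; ring
  set c : ℝ := (1 / (m + 1 + k : ℝ)) ^ (M - 1) with hc
  have hcpos : 0 < c := by positivity
  have hcle : c ≤ 1 := pow_le_one₀ hc0.le hc1
  have hexp : M - 1 = m + 1 + k := by omega
  have hsum := tendsto_sum_pow_mul_pow (j := m + 1) (M := M) (by omega) hcpos hcle hδ hδle (by rw [hexp]; exact hlim)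
  have hη : 0 < ε / (4 * (1 + ε)) := by positivity
  set η := ε / (4 * (1 + ε))
  filter_upwards [hsum.eventually_le_const (show (0 : ℝ) < 1 / 2 by norm_num),
    hlim.eventually_ge_atTop ((m + 1) / (c * η)), eventually_gt_atTop 0] with K hK1 hK2 hK0 l
  have hK0 : (0 : ℝ) < K := by exact_mod_cast hK0
  have hx1 : c * δ K ^ (M - 2) ≤ 1 :=
    mul_le_one₀ hcle (by have := hδ K; positivity) (pow_le_one₀ (hδ K).le (hδle K))
  refine hρ.abs_cond_sub_lt l hε (hδ K) (hδ1 K) ?_ ?_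
  · have h := hρ.measure_length_ne_le l (j := m + 1) (by omega) (δ := δ K)
      (θ := ENNReal.ofReal (1 - c * δ K ^ (M - 2))) (ENNReal.ofReal_le_one.2 (by
        have : 0 ≤ c * δ K ^ (M - 2) := by have := hδ K; positivity
        linarith)) (fun q hq hl => by
        have h1 := hρ.le_measure_pass hq hl (hδ K) (by rw [← hM, hMr]; exact hδ1 K)
        rw [show ((m + 1 + (k + 1) : ℕ) : ℝ) - 1 = m + 1 + k by rw [← hM, hMr],
          show m + 1 + (k + 1) - 1 = M - 1 by omega,
          show m + 1 + (k + 1) - 2 = M - 2 by omega] at h1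
        have h2 := probReal_compl_eq_one_sub (μ := ρ) (measurableSet_pass_const q (δ K))
        rw [← ENNReal.ofReal_toReal (measure_ne_top ρ _)]
        refine ENNReal.ofReal_le_ofReal ?_
        change ρ.real {y | ∀ u ∈ q, ‖(inner ℂ y.2 u : ℂ)‖ ^ 2 < δ K}ᶜ ≤ _
        rw [h2]
        linarith)
    refine ENNReal.toReal_le_of_le_ofReal (by norm_num) (h.trans ?_)
    refine le_trans (le_of_eq ?_) (ENNReal.ofReal_le_ofReal hK1)
    rw [ENNReal.ofReal_sum_of_nonneg fun i _ => mul_nonneg (by positivity)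
      (pow_nonneg (by linarith) _)]
    refine Finset.sum_congr rfl fun i _ => ?_
    rw [ENNReal.ofReal_mul (by positivity), ENNReal.ofReal_pow (by linarith),
      ENNReal.ofReal_pow (by positivity), ENNReal.ofReal_natCast]
  -- The box bound gives `μ ≥ c δ^(M-1)`, and `K δ^(M-1) ≥ (m + 1) / (c η)` for the `K` in question.
  · have hbox := le_dirichlet_box m k (hδ K) (hδ1 K)
    rw [dirichlet_box_eq_muPoly m k (hδ K).le (succ_mul_le_one (hδ1 K)).le] at hbox
    have h1 : c * δ K ^ (m + 1 + k) ≤ (1 / (m + 1 + k : ℝ)) ^ k * δ K ^ (m + 1) :=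
      mul_le_mul (pow_le_pow_of_le_one hc0.le hc1 (by omega))
        (pow_le_pow_of_le_one (hδ K).le (hδle K) (by omega)) (by have := hδ K; positivity)
        (by positivity)
    have h2 : c * δ K ^ (m + 1 + k) ≤ muPoly (m + 1 + k + 1) (m + 2) (δ K) := h1.trans hbox
    rw [div_le_iff₀ (by positivity)] at hK2
    rw [div_le_iff₀ hK0]
    push_cast
    calc (m : ℝ) + 1 ≤ K * δ K ^ (m + 1 + k) * (c * η) := hK2
      _ = c * δ K ^ (m + 1 + k) * η * K := by ring
      _ ≤ muPoly (m + 1 + k + 1) (m + 2) (δ K) * η * K := by gcongr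

end Conditional

/-! ### The largest eigenvalue and the power iteration. -/

section Gram

variable {N M : ℕ}

/-- The matrix with rows `(a i)ᴴ`. -/
def rowMatrix (a : Fin N → CVec M) : Matrix (Fin N) (Fin M) ℂ :=
  Matrix.of fun i j => (starRingEnd ℂ) (a i j)

/-- The operator `x ↦ ∑ i, ⟨a i, x⟩ • a i`. -/
def gramOp (a : Fin N → CVec M) : CVec M →L[ℂ] CVec M :=
  ∑ i, (innerSL ℂ (a i)).smulRight (a i)

/-- The largest eigenvalue of `gramOp a`. -/
def topEig (a : Fin N → CVec M) : ℝ := maxGramEigenvalue (rowMatrix a)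

lemma gramOp_apply (a : Fin N → CVec M) (x : CVec M) :
    gramOp a x = ∑ i, (inner ℂ (a i) x : ℂ) • a i := by
  simp [gramOp]

lemma rowMatrix_mulVec (a : Fin N → CVec M) (x : CVec M) (i : Fin N) :
    (rowMatrix a *ᵥ ⇑x) i = inner ℂ (a i) x := by
  simp [rowMatrix, Matrix.mulVec, dotProduct, PiLp.inner_apply, mul_comm]

lemma gram_mulVec (a : Fin N → CVec M) (x : CVec M) :
    ((rowMatrix a)ᴴ * rowMatrix a) *ᵥ ⇑x = ⇑(gramOp a x) := by
  rw [← Matrix.mulVec_mulVec]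
  ext j
  simp only [Matrix.mulVec, dotProduct, Matrix.conjTranspose_apply]
  rw [gramOp_apply]
  simp only [WithLp.ofLp_sum, WithLp.ofLp_smul, Finset.sum_apply, Pi.smul_apply, smul_eq_mul]
  refine Finset.sum_congr rfl fun i _ => ?_
  have := rowMatrix_mulVec a x i
  simp only [Matrix.mulVec, dotProduct] at this
  rw [this]
  simp [rowMatrix, mul_comm]

lemma isPrincipalVector_rowMatrix_iff (a : Fin N → CVec M) (x : CVec M) :
    IsPrincipalVector (rowMatrix a) x ↔ ‖x‖ = 1 ∧ gramOp a x = (topEig a : ℂ) • x := by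
  rw [IsPrincipalVector, gram_mulVec, ← topEig, ← WithLp.ofLp_smul]
  exact and_congr_right fun _ => (WithLp.ofLp_injective 2).eq_iff

lemma inner_gramOp (a : Fin N → CVec M) (x : CVec M) :
    (inner ℂ x (gramOp a x) : ℂ) = ((∑ i, ‖(inner ℂ (a i) x : ℂ)‖ ^ 2 : ℝ) : ℂ) := by
  rw [gramOp_apply, inner_sum, Complex.ofReal_sum]
  refine Finset.sum_congr rfl fun i _ => ?_
  rw [inner_smul_right, ← inner_conj_symm x (a i), Complex.mul_conj, Complex.normSq_eq_norm_sq]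

lemma exists_eigenbasis (hM : 0 < M) (a : Fin N → CVec M) :
    ∃ (b : OrthonormalBasis (Fin M) ℂ (CVec M)) (e : Fin M → ℝ),
      (∀ l, gramOp a (b l) = (e l : ℂ) • b l) ∧ (∀ l, 0 ≤ e l ∧ e l ≤ topEig a) ∧
      ∃ l, e l = topEig a := by
  have : Nonempty (Fin M) := ⟨⟨0, hM⟩⟩
  set hA := isHermitian_conjTranspose_mul_self (rowMatrix a)
  have heig : ∀ l, gramOp a (hA.eigenvectorBasis l)
      = (hA.eigenvalues l : ℂ) • hA.eigenvectorBasis l := by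
    intro l
    apply WithLp.ofLp_injective 2
    rw [← gram_mulVec, hA.mulVec_eigenvectorBasis, WithLp.ofLp_smul]
    rfl
  refine ⟨hA.eigenvectorBasis, hA.eigenvalues, heig, fun l => ⟨?_, ?_⟩, ?_⟩
  · have h := inner_gramOp a (hA.eigenvectorBasis l)
    rw [heig, inner_smul_right, inner_self_eq_norm_sq_to_K, hA.eigenvectorBasis.norm_eq_one] at h
    have h2 : (hA.eigenvalues l : ℝ) = ∑ i, ‖(inner ℂ (a i) (hA.eigenvectorBasis l) : ℂ)‖ ^ 2 := by
      have : ((hA.eigenvalues l : ℝ) : ℂ)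
          = ((∑ i, ‖(inner ℂ (a i) (hA.eigenvectorBasis l) : ℂ)‖ ^ 2 : ℝ) : ℂ) := by
        rw [← h]; simp
      exact_mod_cast this
    rw [h2]
    positivity
  · exact le_ciSup (Set.finite_range _).bddAbove l
  · exact exists_eq_ciSup_of_finite

lemma sum_sq_inner_eq {a : Fin N → CVec M} {b : OrthonormalBasis (Fin M) ℂ (CVec M)}
    {e : Fin M → ℝ} (hb : ∀ l, gramOp a (b l) = (e l : ℂ) • b l) (x : CVec M) :
    ∑ i, ‖(inner ℂ (a i) x : ℂ)‖ ^ 2 = ∑ l, e l * ‖(inner ℂ (b l) x : ℂ)‖ ^ 2 := by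
  have h : gramOp a x = ∑ l, (inner ℂ (b l) x : ℂ) • (e l : ℂ) • b l := by
    conv_lhs => rw [← b.sum_repr' x]
    simp only [map_sum, map_smul, hb]
  have h2 := inner_gramOp a x
  rw [h, inner_sum] at h2
  have h3 : ((∑ l, e l * ‖(inner ℂ (b l) x : ℂ)‖ ^ 2 : ℝ) : ℂ)
      = ((∑ i, ‖(inner ℂ (a i) x : ℂ)‖ ^ 2 : ℝ) : ℂ) := by
    rw [← h2, Complex.ofReal_sum]
    refine Finset.sum_congr rfl fun l _ => ?_
    rw [inner_smul_right, inner_smul_right, ← inner_conj_symm x (b l), mul_left_comm,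
      Complex.mul_conj, Complex.normSq_eq_norm_sq]
    push_cast
    rfl
  exact_mod_cast h3.symm

lemma sum_sq_inner_le (a : Fin N → CVec M) (x : CVec M) :
    ∑ i, ‖(inner ℂ (a i) x : ℂ)‖ ^ 2 ≤ topEig a * ‖x‖ ^ 2 := by
  rcases Nat.eq_zero_or_pos M with rfl | hM
  · have : x = 0 := Subsingleton.elim _ _
    simp [this]
  obtain ⟨b, e, hb, he, -⟩ := exists_eigenbasis hM a
  rw [sum_sq_inner_eq hb, ← b.sum_sq_norm_inner_right x, Finset.mul_sum]
  exact Finset.sum_le_sum fun l _ => mul_le_mul_of_nonneg_right (he l).2 (by positivity)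

lemma sum_sq_inner_eq_of_gramOp {a : Fin N → CVec M} {x : CVec M} {c : ℝ}
    (hx : gramOp a x = (c : ℂ) • x) : ∑ i, ‖(inner ℂ (a i) x : ℂ)‖ ^ 2 = c * ‖x‖ ^ 2 := by
  have h := inner_gramOp a x
  rw [hx, inner_smul_right, inner_self_eq_norm_sq_to_K] at h
  have h2 : ((∑ i, ‖(inner ℂ (a i) x : ℂ)‖ ^ 2 : ℝ) : ℂ) = ((c * ‖x‖ ^ 2 : ℝ) : ℂ) := by
    rw [← h]
    push_cast
    rfl
  exact Complex.ofReal_injective h2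

/-- The Rayleigh quotient describes sublevel sets by closed conditions, from which measurability,
unitary invariance and scaling of `topEig` are read off. -/
lemma topEig_le_iff (hM : 0 < M) (a : Fin N → CVec M) (c : ℝ) :
    topEig a ≤ c ↔ ∀ x : CVec M, ∑ i, ‖(inner ℂ (a i) x : ℂ)‖ ^ 2 ≤ c * ‖x‖ ^ 2 := by
  constructor
  · intro h x
    exact (sum_sq_inner_le a x).trans (mul_le_mul_of_nonneg_right h (by positivity))
  · intro h
    obtain ⟨b, e, hb, -, l, hl⟩ := exists_eigenbasis hM a
    have := h (b l)
    rwa [sum_sq_inner_eq_of_gramOp (hb l), b.norm_eq_one, one_pow, mul_one, mul_one, hl] at this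

lemma topEig_nonneg (hM : 0 < M) (a : Fin N → CVec M) : 0 ≤ topEig a := by
  obtain ⟨b, e, hb, he, l, hl⟩ := exists_eigenbasis hM a
  exact hl ▸ (he l).1

lemma measurable_topEig (hM : 0 < M) :
    Measurable (topEig : (Fin N → CVec M) → ℝ) := by
  refine measurable_of_Iic fun c => IsClosed.measurableSet ?_
  have : topEig ⁻¹' Set.Iic c = ⋂ x : CVec M,
      {a : Fin N → CVec M | ∑ i, ‖(inner ℂ (a i) x : ℂ)‖ ^ 2 ≤ c * ‖x‖ ^ 2} := by
    ext a
    simp only [Set.mem_preimage, Set.mem_Iic, topEig_le_iff hM, Set.mem_iInter, Set.mem_ofPred_eq]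
  rw [this]
  exact isClosed_iInter fun x => isClosed_le (by fun_prop) continuous_const

lemma eq_zero_of_topEig_eq_zero {a : Fin N → CVec M} (h : topEig a = 0) (i : Fin N) : a i = 0 := by
  have h1 := sum_sq_inner_le a (a i)
  rw [h, zero_mul] at h1
  have h2 := Finset.single_le_sum (f := fun l => ‖(inner ℂ (a l) (a i) : ℂ)‖ ^ 2)
    (fun l _ => by positivity) (Finset.mem_univ i)
  have h3 : ‖(inner ℂ (a i) (a i) : ℂ)‖ ^ 2 = 0 := le_antisymm (h2.trans h1) (by positivity)
  simpa using h3

section Equivariance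

variable (U : CVec M ≃ₗᵢ[ℂ] CVec M) (a : Fin N → CVec M)

lemma gramOp_isometry (x : CVec M) : gramOp (fun i => U (a i)) (U x) = U (gramOp a x) := by
  simp only [gramOp_apply, U.inner_map_map, map_sum, map_smul]

lemma topEig_isometry : topEig (fun i => U (a i)) = topEig a := by
  rcases Nat.eq_zero_or_pos M with rfl | hM
  · simp [topEig, maxGramEigenvalue]
  refine eq_of_forall_ge_iff fun c => ?_
  rw [topEig_le_iff hM, topEig_le_iff hM]
  constructor
  · intro h x
    simpa only [U.inner_map_map, U.norm_map] using h (U x)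
  · intro h x
    obtain ⟨y, rfl⟩ := U.surjective x
    simpa only [U.inner_map_map, U.norm_map] using h y

end Equivariance

section Scaling

variable (s : ℝ) (a : Fin N → CVec M)

lemma gramOp_smul (x : CVec M) : gramOp (fun i => (s : ℂ) • a i) x = ((s ^ 2 : ℝ) : ℂ) • gramOp a x := by
  simp only [gramOp_apply, inner_smul_left, Finset.smul_sum, smul_smul, Complex.conj_ofReal]
  refine Finset.sum_congr rfl fun i _ => ?_
  congr 1
  push_cast
  ring

lemma topEig_smul (hs : 0 < s) : topEig (fun i => (s : ℂ) • a i) = s ^ 2 * topEig a := by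
  rcases Nat.eq_zero_or_pos M with rfl | hM
  · simp [topEig, maxGramEigenvalue]
  refine eq_of_forall_ge_iff fun c => ?_
  rw [topEig_le_iff hM, ← le_div_iff₀' (by positivity), topEig_le_iff hM]
  refine forall_congr' fun x => ?_
  simp only [inner_smul_left, norm_mul, Complex.conj_ofReal, Complex.norm_real, mul_pow,
    ← Finset.mul_sum, Real.norm_eq_abs, sq_abs]
  rw [div_mul_eq_mul_div, le_div_iff₀' (by positivity)]

end Scaling

/-- Power iteration for `gramOp a`, started from `a i`. -/
def powIter (a : Fin N → CVec M) (i : Fin N) (j : ℕ) : CVec M :=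
  (fun x => ((topEig a)⁻¹ : ℂ) • gramOp a x)^[j] (a i)

/-- The projection of `a i` to the eigenspace for the largest eigenvalue. -/
def topVec (a : Fin N → CVec M) (i : Fin N) : CVec M := limUnder atTop (powIter a i)

lemma powIter_zero (a : Fin N → CVec M) (i : Fin N) : powIter a i 0 = a i := rfl

lemma powIter_succ (a : Fin N → CVec M) (i : Fin N) (j : ℕ) :
    powIter a i (j + 1) = ((topEig a)⁻¹ : ℂ) • gramOp a (powIter a i j) := by
  rw [powIter, Function.iterate_succ_apply']
  rfl

lemma powIter_eq {a : Fin N → CVec M} {b : OrthonormalBasis (Fin M) ℂ (CVec M)}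
    {e : Fin M → ℝ} (hb : ∀ l, gramOp a (b l) = (e l : ℂ) • b l) (i : Fin N) (j : ℕ) :
    powIter a i j = ∑ l, ((((topEig a)⁻¹ * e l) ^ j : ℝ) : ℂ) • (inner ℂ (b l) (a i) : ℂ) • b l := by
  induction j with
  | zero => simp [powIter_zero, b.sum_repr']
  | succ j ih =>
    rw [powIter_succ, ih]
    simp only [map_sum, map_smul, hb, Finset.smul_sum]
    refine Finset.sum_congr rfl fun l _ => ?_
    simp only [smul_smul]
    congr 1
    push_cast
    ring

/-- In an eigenbasis the components are multiplied by powers of numbers in `[0, 1]`. The limit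
inherits measurability and equivariance from the iterates, which an arbitrary choice of eigenvector
would not. If `topEig a = 0`, its inverse is `0` and the limit vanishes. -/
lemma tendsto_powIter (hM : 0 < M) (a : Fin N → CVec M) (i : Fin N) :
    Tendsto (powIter a i) atTop (nhds (topVec a i)) := by
  refine tendsto_nhds_limUnder ?_
  obtain ⟨b, e, hb, he, -⟩ := exists_eigenbasis hM a
  have hlam := topEig_nonneg hM a
  refine ⟨∑ l, (((if (topEig a)⁻¹ * e l = 1 then 1 else 0 : ℝ)) : ℂ)
    • (inner ℂ (b l) (a i) : ℂ) • b l, ?_⟩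
  have hfun : powIter a i = fun j =>
      ∑ l, ((((topEig a)⁻¹ * e l) ^ j : ℝ) : ℂ) • (inner ℂ (b l) (a i) : ℂ) • b l :=
    funext fun j => powIter_eq hb i j
  rw [hfun]
  refine tendsto_finsetSum _ fun l _ => Tendsto.smul_const ?_ _
  refine (Complex.continuous_ofReal.tendsto _).comp ?_
  split_ifs with h
  · exact tendsto_const_nhds.congr fun j => by rw [h, one_pow]
  · have h0 : 0 ≤ (topEig a)⁻¹ * e l := mul_nonneg (inv_nonneg.2 hlam) (he l).1
    refine tendsto_pow_atTop_nhds_zero_of_lt_one h0 (lt_of_le_of_ne ?_ h)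
    exact inv_mul_le_one_of_le₀ (he l).2 hlam

lemma gramOp_topVec (hM : 0 < M) (a : Fin N → CVec M) (i : Fin N) :
    gramOp a (topVec a i) = (topEig a : ℂ) • topVec a i := by
  by_cases h0 : topEig a = 0
  · have hz : ∀ x, gramOp a x = 0 := fun x => by
      rw [gramOp_apply]
      exact Finset.sum_eq_zero fun i _ => by simp [eq_zero_of_topEig_eq_zero h0 i]
    rw [hz, h0]
    simp
  have h1 := ((gramOp a).continuous.tendsto _).comp (tendsto_powIter hM a i)
  have h2 := ((tendsto_powIter hM a i).comp (tendsto_add_atTop_nat 1)).const_smul (topEig a : ℂ)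
  refine tendsto_nhds_unique h1 (h2.congr fun j => ?_)
  have h0' : (topEig a : ℂ) ≠ 0 := by exact_mod_cast h0
  simp only [Function.comp_apply, powIter_succ, smul_smul, mul_inv_cancel₀ h0', one_smul]

/-- Otherwise a top eigenvector would be orthogonal to every `a i`, and its eigenvalue would be `0`.
-/
lemma exists_topVec_ne_zero (hM : 0 < M) {a : Fin N → CVec M} (ha : topEig a ≠ 0) :
    ∃ i, topVec a i ≠ 0 := by
  by_contra! hcon
  obtain ⟨b, e, hb, he, l, hl⟩ := exists_eigenbasis hM a
  have hinner : ∀ i, (inner ℂ (b l) (a i) : ℂ) = 0 := by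
    intro i
    have h1 : Tendsto (fun j => (inner ℂ (b l) (powIter a i j) : ℂ)) atTop
        (nhds (inner ℂ (b l) (topVec a i))) :=
      ((innerSL ℂ (b l)).continuous.tendsto _).comp (tendsto_powIter hM a i)
    rw [hcon i, inner_zero_right] at h1
    refine tendsto_nhds_unique (tendsto_const_nhds.congr fun j => ?_) h1
    rw [powIter_eq hb, inner_sum, Finset.sum_eq_single l]
    · rw [hl, inv_mul_cancel₀ ha, inner_smul_right, inner_smul_right, inner_self_eq_norm_sq_to_K,
        b.norm_eq_one]
      simp
    · intro l' _ hne
      rw [inner_smul_right, inner_smul_right, b.orthonormal.2 hne.symm]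
      simp
    · simp
  have h2 := sum_sq_inner_eq_of_gramOp (hb l)
  rw [hl, b.norm_eq_one, one_pow, mul_one] at h2
  refine ha (h2.symm.trans (Finset.sum_eq_zero fun i _ => ?_))
  rw [← inner_conj_symm, hinner i]
  simp

lemma topVec_isometry (hM : 0 < M) (U : CVec M ≃ₗᵢ[ℂ] CVec M) (a : Fin N → CVec M) (i : Fin N) :
    topVec (fun i => U (a i)) i = U (topVec a i) := by
  have hiter : ∀ j, powIter (fun i => U (a i)) i j = U (powIter a i j) := by
    intro j
    induction j with
    | zero => rfl
    | succ j ih => rw [powIter_succ, powIter_succ, ih, topEig_isometry, gramOp_isometry, map_smul]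
  refine tendsto_nhds_unique (tendsto_powIter hM _ i) ?_
  exact ((U.continuous.tendsto _).comp (tendsto_powIter hM a i)).congr fun j => (hiter j).symm

lemma topVec_smul (hM : 0 < M) {s : ℝ} (hs : 0 < s) (a : Fin N → CVec M) (i : Fin N) :
    topVec (fun i => (s : ℂ) • a i) i = (s : ℂ) • topVec a i := by
  have hs' : (s : ℂ) ≠ 0 := by exact_mod_cast hs.ne'
  have hiter : ∀ j, powIter (fun i => (s : ℂ) • a i) i j = (s : ℂ) • powIter a i j := by
    intro j
    induction j with
    | zero => rfl
    | succ j ih =>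
      rw [powIter_succ, powIter_succ, ih, topEig_smul s a hs, gramOp_smul, map_smul]
      simp only [smul_smul]
      congr 1
      push_cast
      field_simp
  refine tendsto_nhds_unique (tendsto_powIter hM _ i) ?_
  exact ((tendsto_powIter hM a i).const_smul (s : ℂ)).congr fun j => (hiter j).symm

end Gram

/-! ### A canonical principal vector: measurable, unitarily equivariant and scale invariant. -/

section FirstNonzero

variable {M : ℕ}

open Classical in
/-- The first nonzero vector of a list. -/
def firstNonzero : List (CVec M) → CVec M
  | [] => 0
  | x :: l => if x = 0 then firstNonzero l else x

lemma firstNonzero_map {f : CVec M → CVec M} (hf : ∀ x, f x = 0 ↔ x = 0) (l : List (CVec M)) :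
    firstNonzero (l.map f) = f (firstNonzero l) := by
  induction l with
  | nil => simp [firstNonzero, (hf 0).2 rfl]
  | cons x l ih =>
    rw [List.map_cons, firstNonzero, firstNonzero, ih]
    by_cases h : x = 0
    · simp [h, (hf 0).2 rfl]
    · simp [h, (hf x).not.2 h]

lemma firstNonzero_ne_zero {l : List (CVec M)} (h : ∃ x ∈ l, x ≠ 0) :
    firstNonzero l ∈ l ∧ firstNonzero l ≠ 0 := by
  induction l with
  | nil => simp at h
  | cons x l ih =>
    rw [firstNonzero]
    by_cases hx : x = 0
    · have := ih (by simpa [hx] using h)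
      rw [if_pos hx]
      exact ⟨List.mem_cons_of_mem _ this.1, this.2⟩
    · rw [if_neg hx]
      exact ⟨List.mem_cons_self, hx⟩

lemma measurable_firstNonzero {Z : Type*} [MeasurableSpace Z] {F : List (Z → CVec M)}
    (hF : ∀ f ∈ F, Measurable f) : Measurable fun z => firstNonzero (F.map fun f => f z) := by
  induction F with
  | nil => simp [firstNonzero]
  | cons f F ih =>
    simp only [List.map_cons, firstNonzero]
    have hf := hF f (by simp)
    exact Measurable.ite (hf (measurableSet_singleton 0)) (ih fun g hg => hF g (by simp [hg])) hf

end FirstNonzero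

section PrincipalVec

variable {N M : ℕ}

/-- A canonical unit eigenvector of `gramOp a` for the largest eigenvalue. -/
def principalVec (a : Fin N → CVec M) : CVec M :=
  ((‖firstNonzero (List.ofFn (topVec a))‖⁻¹ : ℝ) : ℂ) • firstNonzero (List.ofFn (topVec a))

lemma principalVec_spec (hM : 0 < M) {a : Fin N → CVec M} (ha : topEig a ≠ 0) :
    ‖principalVec a‖ = 1 ∧ gramOp a (principalVec a) = (topEig a : ℂ) • principalVec a := by
  obtain ⟨i, hi⟩ := exists_topVec_ne_zero hM ha
  obtain ⟨h1, h2⟩ := firstNonzero_ne_zero (l := List.ofFn (topVec a))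
    ⟨topVec a i, List.mem_ofFn.2 ⟨i, rfl⟩, hi⟩
  obtain ⟨i', hi'⟩ := List.mem_ofFn.1 h1
  constructor
  · rw [principalVec, norm_smul, Complex.norm_real, norm_inv, norm_norm,
      inv_mul_cancel₀ (norm_ne_zero_iff.2 h2)]
  · rw [principalVec, map_smul, ← hi', gramOp_topVec hM, smul_comm]

lemma principalVec_isometry (hM : 0 < M) (U : CVec M ≃ₗᵢ[ℂ] CVec M) (a : Fin N → CVec M) :
    principalVec (fun i => U (a i)) = U (principalVec a) := by
  have h : firstNonzero (List.ofFn (topVec fun i => U (a i)))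
      = U (firstNonzero (List.ofFn (topVec a))) := by
    rw [← firstNonzero_map (f := U) fun x => map_eq_zero_iff U U.injective, List.map_ofFn]
    congr 2
    exact funext fun i => topVec_isometry hM U a i
  rw [principalVec, h, U.norm_map, ← map_smul]
  rfl

lemma principalVec_smul (hM : 0 < M) {s : ℝ} (hs : 0 < s) (a : Fin N → CVec M) :
    principalVec (fun i => (s : ℂ) • a i) = principalVec a := by
  have h : firstNonzero (List.ofFn (topVec fun i => (s : ℂ) • a i))
      = (s : ℂ) • firstNonzero (List.ofFn (topVec a)) := by
    rw [← firstNonzero_map (f := fun x => (s : ℂ) • x) fun x => by simp [hs.ne'], List.map_ofFn]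
    congr 2
    exact funext fun i => topVec_smul hM hs a i
  rw [principalVec, h, principalVec, norm_smul, smul_smul, Complex.norm_real, Real.norm_eq_abs,
    abs_of_pos hs]
  congr 1
  have hs' : (s : ℂ) ≠ 0 := by exact_mod_cast hs.ne'
  push_cast
  rw [mul_inv, mul_right_comm, inv_mul_cancel₀ hs', one_mul]

lemma measurable_powIter (hM : 0 < M) (i : Fin N) (j : ℕ) :
    Measurable fun a : Fin N → CVec M => powIter a i j := by
  induction j with
  | zero => simp only [powIter_zero]; fun_prop
  | succ j ih =>
    simp only [powIter_succ, gramOp_apply]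
    have := measurable_topEig (N := N) hM
    fun_prop

lemma measurable_principalVec (hM : 0 < M) :
    Measurable (principalVec : (Fin N → CVec M) → CVec M) := by
  have h1 : ∀ i, Measurable fun a : Fin N → CVec M => topVec a i := fun i =>
    measurable_of_tendsto_metrizable (measurable_powIter hM i)
      (tendsto_pi_nhds.2 fun a => tendsto_powIter hM a i)
  have h2 : Measurable fun a : Fin N → CVec M => firstNonzero (List.ofFn (topVec a)) := by
    have := measurable_firstNonzero (F := List.ofFn fun i (a : Fin N → CVec M) => topVec a i)
      (by
        intro f hf
        obtain ⟨i, rfl⟩ := List.mem_ofFn.1 hf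
        exact h1 i)
    simp only [List.map_ofFn] at this
    exact this
  unfold principalVec
  fun_prop

end PrincipalVec

/-! ### Null sets: level sets of homogeneous functions and degenerate Gaussian frames. -/

open scoped Pointwise in
/-- A function that is homogeneous of degree two takes a nonzero value on a null set only. -/
lemma addHaar_level_eq_zero {E : Type*} [NormedAddCommGroup E] [NormedSpace ℝ E]
    [MeasurableSpace E] [BorelSpace E] [FiniteDimensional ℝ E] (μ : Measure E)
    [μ.IsAddHaarMeasure] {f : E → ℝ} (hf : Measurable f)
    (hs : ∀ s : ℝ, 0 < s → ∀ x, f (s • x) = s ^ 2 * f x) {c : ℝ} (hc : c ≠ 0) :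
    μ {x | f x = c} = 0 := by
  by_contra hpos
  -- The level sets of `s ^ 2 * c`, for `s > 0`, are disjoint dilates of one another. If one had
  -- positive measure, all of these uncountably many sets would.
  have hcount := Measure.countable_meas_pos_of_disjoint_iUnion (μ := μ)
    (As := fun s : Set.Ioi (0 : ℝ) => {x | f x = (s : ℝ) ^ 2 * c})
    (fun s => measurableSet_eq_fun hf measurable_const) (by
      intro s t hst
      refine Set.disjoint_left.2 fun x hx hx' => hst ?_
      have hx : f x = (s : ℝ) ^ 2 * c := hx
      have hx' : f x = (t : ℝ) ^ 2 * c := hx'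
      rw [hx] at hx'
      exact Subtype.ext ((sq_eq_sq₀ (le_of_lt s.2) (le_of_lt t.2)).1 (mul_right_cancel₀ hc hx')))
  have huniv : {s : Set.Ioi (0 : ℝ) | 0 < μ {x | f x = (s : ℝ) ^ 2 * c}} = Set.univ := by
    refine Set.eq_univ_of_forall fun s => ?_
    have hs0 : (0 : ℝ) < s := s.2
    have hset : {x | f x = (s : ℝ) ^ 2 * c} = (s : ℝ) • {x | f x = c} := by
      ext x
      rw [Set.mem_smul_set_iff_inv_smul_mem₀ hs0.ne', Set.mem_ofPred_eq, Set.mem_ofPred_eq,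
        hs _ (inv_pos.2 hs0), inv_pow, inv_mul_eq_iff_eq_mul₀ (by positivity)]
    change 0 < μ {x | f x = (s : ℝ) ^ 2 * c}
    rw [hset, Measure.addHaar_smul]
    refine ENNReal.mul_pos ?_ hpos
    exact (ENNReal.ofReal_pos.2 (abs_pos.2 (pow_ne_zero _ hs0.ne'))).ne'
  rw [huniv, Set.countable_univ_iff] at hcount
  have h0 := (Set.countable_coe_iff.1 hcount).measure_zero volume
  simp at h0

/-- Choose `j` with `w j ≠ 0`. For fixed other coordinates at most one value of the `j`-th satisfies
the equation, and the Gaussian law has no atoms. -/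
lemma gaussianVec_inner_eq_zero {M : ℕ} {w : CVec M} (hw : w ≠ 0) :
    gaussianVec M {x | (inner ℂ x w : ℂ) = 0} = 0 := by
  obtain ⟨j, hj⟩ : ∃ j, w j ≠ 0 := by
    by_contra! h
    exact hw (by ext j; simpa using h j)
  have hm : MeasurableSet {x : CVec M | (inner ℂ x w : ℂ) = 0} :=
    measurableSet_eq_fun (by fun_prop) measurable_const
  have := isProbabilityMeasure_stdComplexGaussian
  rw [gaussianVec, Measure.map_apply (by fun_prop) hm]
  refine measure_eq_zero_of_resample stdComplexGaussian ((by fun_prop : Measurable _) hm) j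
    (ae_of_all _ fun z => ?_)
  have hsub : {y : ℂ | Function.update z j y ∈
      WithLp.toLp 2 ⁻¹' {x : CVec M | (inner ℂ x w : ℂ) = 0}}.Subsingleton := by
    intro y hy y' hy'
    have hy : (inner ℂ (WithLp.toLp 2 (Function.update z j y)) w : ℂ) = 0 := hy
    have hy' : (inner ℂ (WithLp.toLp 2 (Function.update z j y')) w : ℂ) = 0 := hy'
    have hsubt : WithLp.toLp 2 (Function.update z j y) - WithLp.toLp 2 (Function.update z j y')
        = EuclideanSpace.single j (y - y') := by
      ext i
      by_cases hi : i = j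
      · subst hi; simp
      · simp [hi]
    have h := sub_eq_zero.2 (hy.trans hy'.symm)
    rw [← inner_sub_left, hsubt, EuclideanSpace.inner_single_left] at h
    have h2 := (mul_eq_zero.1 h).resolve_right hj
    rwa [map_eq_zero, sub_eq_zero] at h2
  rcases hsub.eq_empty_or_singleton with h | ⟨y, h⟩
  · rw [h, measure_empty]
  · rw [h, stdComplexGaussian_singleton]

section Frame

variable {N M : ℕ}

/-- The law of `N` independent vectors of independent standard complex Gaussian variables. -/
def gaussFrame (N M : ℕ) : Measure (Fin N → CVec M) := Measure.pi fun _ => gaussianVec M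

instance isProbabilityMeasure_gaussFrame (N M : ℕ) : IsProbabilityMeasure (gaussFrame N M) := by
  unfold gaussFrame
  infer_instance

lemma gaussFrame_map_isometry (U : CVec M ≃ₗᵢ[ℂ] CVec M) :
    (gaussFrame N M).map (fun a i => U (a i)) = gaussFrame N M := by
  have : IsProbabilityMeasure ((gaussianVec M).map U) := by
    rw [gaussianVec_map_isometry]; infer_instance
  have h := Measure.pi_map_pi (μ := fun _ : Fin N => gaussianVec M) (f := fun _ => U)
    fun _ => by fun_prop
  rw [gaussFrame, h, gaussianVec_map_isometry]

lemma gaussFrame_eq_map : gaussFrame N M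
    = (Measure.pi fun _ : Fin N => Measure.pi fun _ : Fin M => stdComplexGaussian).map
      fun H i => WithLp.toLp 2 (H i) := by
  have : IsProbabilityMeasure
      ((Measure.pi fun _ : Fin M => stdComplexGaussian).map (WithLp.toLp 2)) :=
    isProbabilityMeasure_gaussianVec M
  exact (Measure.pi_map_pi (μ := fun _ : Fin N => Measure.pi fun _ : Fin M => stdComplexGaussian)
    (f := fun _ => WithLp.toLp 2) fun _ => by fun_prop).symm

lemma pi_stdComplexGaussian_absolutelyContinuous :
    (Measure.pi fun _ : Fin N => Measure.pi fun _ : Fin M => stdComplexGaussian)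
      ≪ Measure.pi fun _ : Fin N => Measure.pi fun _ : Fin M => (volume : Measure ℂ) := by
  have hpdf : Measurable fun z : ℂ => ENNReal.ofReal (Real.pi⁻¹ * Real.exp (-‖z‖ ^ 2)) := by
    fun_prop
  have h1 : IsProbabilityMeasure (volume.withDensity fun z : ℂ =>
      ENNReal.ofReal (Real.pi⁻¹ * Real.exp (-‖z‖ ^ 2))) := by
    rw [← stdComplexGaussian_eq_withDensity]; infer_instance
  have h2 := pi_withDensity_fin (n := M) volume hpdf
  have h3 : IsProbabilityMeasure ((Measure.pi fun _ : Fin M => (volume : Measure ℂ)).withDensity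
      fun x => ∏ i, ENNReal.ofReal (Real.pi⁻¹ * Real.exp (-‖x i‖ ^ 2))) := by
    rw [← h2]; infer_instance
  have h4 : Measurable fun x : Fin M → ℂ =>
      ∏ i, ENNReal.ofReal (Real.pi⁻¹ * Real.exp (-‖x i‖ ^ 2)) := by fun_prop
  rw [stdComplexGaussian_eq_withDensity, h2,
    pi_withDensity_fin (n := N) (Measure.pi fun _ : Fin M => (volume : Measure ℂ)) h4]
  exact withDensity_absolutelyContinuous _ _

lemma gaussFrame_level_eq_zero {f : (Fin N → CVec M) → ℝ} (hf : Measurable f)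
    (hs : ∀ s : ℝ, 0 < s → ∀ a, f (fun i => (s : ℂ) • a i) = s ^ 2 * f a) {c : ℝ} (hc : c ≠ 0) :
    gaussFrame N M {a | f a = c} = 0 := by
  have hm : MeasurableSet {a | f a = c} := measurableSet_eq_fun hf measurable_const
  have hΦ : Measurable fun (H : Fin N → Fin M → ℂ) i => (WithLp.toLp 2 (H i) : CVec M) := by
    fun_prop
  rw [gaussFrame_eq_map, Measure.map_apply hΦ hm]
  refine pi_stdComplexGaussian_absolutelyContinuous ?_
  have h1 : (Measure.pi fun _ : Fin M => (volume : Measure ℂ)).IsAddHaarMeasure :=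
    Measure.pi.isAddHaarMeasure _
  have h2 : (Measure.pi fun _ : Fin N =>
      Measure.pi fun _ : Fin M => (volume : Measure ℂ)).IsAddHaarMeasure :=
    Measure.pi.isAddHaarMeasure _
  refine addHaar_level_eq_zero _ (hf.comp hΦ) (fun s hs0 H => ?_) hc
  rw [Function.comp_apply, Function.comp_apply, ← hs s hs0]
  congr 1

lemma gaussFrame_ae_inner_ne_zero (i : Fin N) {w : CVec M} (hw : w ≠ 0) :
    ∀ᵐ a ∂gaussFrame N M, (inner ℂ (a i) w : ℂ) ≠ 0 := by
  refine (measurePreserving_eval (fun _ : Fin N => gaussianVec M) i).quasiMeasurePreserving.ae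
    (p := fun x => (inner ℂ x w : ℂ) ≠ 0) ?_
  rw [ae_iff]
  simpa using gaussianVec_inner_eq_zero hw

lemma gaussFrame_ae_topEig_ne_zero (hN : 0 < N) (hM : 0 < M) :
    ∀ᵐ a ∂gaussFrame N M, topEig a ≠ 0 := by
  have hw : (EuclideanSpace.single (⟨0, hM⟩ : Fin M) (1 : ℂ) : CVec M) ≠ 0 := by
    intro h
    simpa using congrArg norm h
  filter_upwards [gaussFrame_ae_inner_ne_zero ⟨0, hN⟩ hw] with a ha h0
  rw [eq_zero_of_topEig_eq_zero h0, inner_zero_left] at ha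
  exact ha rfl

/-- If the first row is not orthogonal to the principal vector of the other rows, then it is not
orthogonal to any eigenvector for the largest eigenvalue. -/
lemma inner_ne_zero_of_update {a : Fin N → CVec M} (hM : 0 < M) {i : Fin N}
    (ha : topEig a ≠ 0)
    (hi : topEig (Function.update a i 0) ≠ 0 →
      (inner ℂ (a i) (principalVec (Function.update a i 0)) : ℂ) ≠ 0) {u : CVec M} (hu : u ≠ 0)
    (hau : gramOp a u = (topEig a : ℂ) • u) : (inner ℂ (a i) u : ℂ) ≠ 0 := by
  -- Without row `i`, the vector `u` keeps its Rayleigh quotient, so `topEig a ≤ topEig a'`. Testing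
  -- `a` at the principal vector `w'` of `a'` gives `|⟨a i, w'⟩|² + topEig a' ≤ topEig a`, and hence
  -- `⟨a i, w'⟩ = 0`.
  intro h0
  set a' := Function.update a i 0 with ha'
  have hsum : ∀ x, ∑ l, ‖(inner ℂ (a l) x : ℂ)‖ ^ 2
      = ‖(inner ℂ (a i) x : ℂ)‖ ^ 2 + ∑ l, ‖(inner ℂ (a' l) x : ℂ)‖ ^ 2 := by
    intro x
    rw [← Finset.add_sum_erase _ _ (Finset.mem_univ i),
      ← Finset.add_sum_erase (a := i) _ (fun l => ‖(inner ℂ (a' l) x : ℂ)‖ ^ 2) (Finset.mem_univ i)]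
    have : ∑ l ∈ Finset.univ.erase i, ‖(inner ℂ (a' l) x : ℂ)‖ ^ 2
        = ∑ l ∈ Finset.univ.erase i, ‖(inner ℂ (a l) x : ℂ)‖ ^ 2 :=
      Finset.sum_congr rfl fun l hl => by rw [ha', Function.update_of_ne (Finset.ne_of_mem_erase hl)]
    rw [this]
    simp [ha']
  have h1 := hsum u
  rw [sum_sq_inner_eq_of_gramOp hau, h0, norm_zero, zero_pow two_ne_zero, zero_add] at h1
  have h2 := sum_sq_inner_le a' u
  rw [← h1] at h2
  have hle : topEig a ≤ topEig a' :=
    le_of_mul_le_mul_right h2 (by have := norm_pos_iff.2 hu; positivity)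
  have hpos : 0 < topEig a := lt_of_le_of_ne (topEig_nonneg hM a) ha.symm
  have ha'0 : topEig a' ≠ 0 := (hpos.trans_le hle).ne'
  obtain ⟨h3, h4⟩ := principalVec_spec hM ha'0
  have h5 := sum_sq_inner_eq_of_gramOp h4
  have h6 := sum_sq_inner_le a (principalVec a')
  rw [hsum, h5, h3] at h6
  have h7 : ‖(inner ℂ (a i) (principalVec a') : ℂ)‖ ^ 2 ≤ 0 := by linarith
  refine hi ha'0 ?_
  have h8 := le_antisymm h7 (by positivity)
  simpa using h8

/-- Almost surely, the unit eigenvector for the largest eigenvalue is unique up to its phase. -/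
lemma gaussFrame_ae_phaseEq (hN : 0 < N) (hM : 0 < M) :
    ∀ᵐ a ∂gaussFrame N M, ∀ x : CVec M, ‖x‖ = 1 → gramOp a x = (topEig a : ℂ) • x →
      PhaseEq x (principalVec a) := by
  set i : Fin N := ⟨0, hN⟩
  have hup : Measurable fun a : Fin N → CVec M => Function.update a i 0 :=
    measurable_update'.comp (measurable_id.prodMk measurable_const)
  have hA : MeasurableSet {a : Fin N → CVec M | topEig (Function.update a i 0) ≠ 0 ∧
      (inner ℂ (a i) (principalVec (Function.update a i 0)) : ℂ) = 0} := by
    have h1 := (measurable_topEig hM).comp hup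
    have h2 := (measurable_principalVec hM).comp hup
    have h3 : Measurable fun a : Fin N → CVec M =>
        (inner ℂ (a i) (principalVec (Function.update a i 0)) : ℂ) :=
      (measurable_pi_apply i).inner h2
    exact (measurableSet_eq_fun h1 measurable_const).compl.inter
      (measurableSet_eq_fun h3 measurable_const)
  have hnull : gaussFrame N M {a | topEig (Function.update a i 0) ≠ 0 ∧
      (inner ℂ (a i) (principalVec (Function.update a i 0)) : ℂ) = 0} = 0 := by
    -- Row `i` is independent of the other rows and hence of their principal vector.
    refine measure_eq_zero_of_resample (gaussianVec M) hA i (ae_of_all _ fun a => ?_)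
    simp only [Set.mem_ofPred_eq, Function.update_idem, Function.update_self]
    by_cases h : topEig (Function.update a i 0) = 0
    · simp [h]
    · have hw := (principalVec_spec hM h).1
      refine measure_mono_null (fun y hy => hy.2)
        (gaussianVec_inner_eq_zero (w := principalVec (Function.update a i 0)) ?_)
      intro h0
      rw [h0, norm_zero] at hw
      exact zero_ne_one hw
  have hae : ∀ᵐ a ∂gaussFrame N M, topEig (Function.update a i 0) ≠ 0 →
      (inner ℂ (a i) (principalVec (Function.update a i 0)) : ℂ) ≠ 0 := by
    rw [ae_iff]
    simpa only [Classical.not_imp, not_not] using hnull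
  filter_upwards [hae, gaussFrame_ae_topEig_ne_zero hN hM] with a h1 h2 x hx hax
  have hne := fun u hu hau => inner_ne_zero_of_update hM h2 h1 (u := u) hu hau
  obtain ⟨hw, haw⟩ := principalVec_spec hM h2
  set w := principalVec a
  have hw0 : w ≠ 0 := fun h => by simp [h] at hw
  have hiw := hne w hw0 haw
  -- This combination lies in the top eigenspace and is orthogonal to `a i`, so it must vanish; the
  -- eigenspace is a line.
  have hu : (inner ℂ (a i) w : ℂ) • x - (inner ℂ (a i) x : ℂ) • w = 0 := by
    by_contra hu
    refine hne _ hu ?_ ?_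
    · rw [map_sub, map_smul, map_smul, hax, haw, smul_sub, smul_comm, smul_comm (inner ℂ (a i) x)]
    · rw [inner_sub_right, inner_smul_right, inner_smul_right]
      ring
  have hxw : x = ((inner ℂ (a i) x : ℂ) / (inner ℂ (a i) w : ℂ)) • w := by
    rw [div_eq_inv_mul, mul_smul, ← sub_eq_zero.1 hu, smul_smul, inv_mul_cancel₀ hiw, one_smul]
  refine ⟨_, ?_, hxw⟩
  have h3 := congrArg norm hxw
  rw [norm_smul, hw, mul_one, hx] at h3
  exact h3.symm

/-- The joint law of the largest eigenvalue and its eigenvector. -/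
def userMeasure (N M : ℕ) : Measure (ℝ × CVec M) :=
  (gaussFrame N M).map fun a => (topEig a, principalVec a)

lemma measurable_gsResidual_const (q : List (CVec M)) : Measurable (gsResidual q) := by
  unfold gsResidual
  refine measurable_id.sub ?_
  induction q with
  | nil => simp
  | cons u q ih =>
    simp only [List.map_cons, List.sum_cons]
    fun_prop

/-- A zero residual means that the squared inner products add up to `1`, a null event for the
Dirichlet law. -/
lemma IsotropicLaw.gsResidual_ne_zero {τ : Measure (CVec M)} (hτ : IsotropicLaw τ)
    {q : List (CVec M)} (hq : OrthonormalList q) (hl : q.length < M) :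
    ∀ᵐ x ∂τ, gsResidual q x ≠ 0 := by
  rcases Nat.eq_zero_or_pos q.length with h0 | h0
  · rw [List.length_eq_zero_iff] at h0
    subst h0
    filter_upwards [hτ.norm_eq_one] with x hx h
    simp only [gsResidual, List.map_nil, List.sum_nil, sub_zero] at h
    simp [h] at hx
  · obtain ⟨i, hi⟩ : ∃ i, q.length = i + 1 := ⟨q.length - 1, by omega⟩
    obtain ⟨κ, hκ⟩ : ∃ κ, M = i + 1 + (κ + 1) := ⟨M - i - 2, by omega⟩
    subst hκ
    have hon : Orthonormal ℂ fun l : Fin (i + 1) => q.get (Fin.cast hi.symm l) :=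
      hq.orthonormal_get.comp _ (Fin.cast_injective _)
    have hD : ∀ᵐ t ∂dirichlet (i + 1) κ, ∑ l, t l ≠ 1 := by
      rw [ae_iff]
      simpa using dirichlet_sum_eq i κ 1
    rw [← hτ.map_sq_inner hon] at hD
    have hT : Measurable fun (v : CVec (i + 1 + (κ + 1))) (l : Fin (i + 1)) =>
      ‖(inner ℂ v (q.get (Fin.cast hi.symm l)) : ℂ)‖ ^ 2 := by fun_prop
    filter_upwards [ae_of_ae_map hT.aemeasurable hD, hτ.norm_eq_one] with x hx h1 h
    have h2 := hq.norm_gsResidual_sq x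
    rw [h, h1, norm_zero] at h2
    refine hx ?_
    have hs : ∑ l, ‖(inner ℂ x (q.get l) : ℂ)‖ ^ 2
        = ∑ l : Fin (i + 1), ‖(inner ℂ x (q.get (Fin.cast hi.symm l)) : ℂ)‖ ^ 2 :=
      Fintype.sum_equiv (finCongr hi) _ _ fun l => rfl
    rw [← hs]
    linarith

/-- Isotropy comes from the unitary equivariance of `principalVec`. Since `principalVec` ignores
scaling, the metric is homogeneous of degree two, which makes nonzero levels null; the level `0`
needs a vanishing eigenvalue or residual. -/
lemma userLaw_userMeasure (hN : 0 < N) (hM : 0 < M) : UserLaw (userMeasure N M) := by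
  have hpair : Measurable fun a : Fin N → CVec M => (topEig a, principalVec a) :=
    (measurable_topEig hM).prodMk (measurable_principalVec hM)
  have hprob : IsProbabilityMeasure (userMeasure N M) :=
    Measure.isProbabilityMeasure_map hpair.aemeasurable
  have hsnd : (userMeasure N M).map Prod.snd = (gaussFrame N M).map principalVec :=
    Measure.map_map measurable_snd hpair
  have hiso : IsotropicLaw ((userMeasure N M).map Prod.snd) := by
    rw [hsnd]
    refine ⟨Measure.isProbabilityMeasure_map (measurable_principalVec hM).aemeasurable, ?_,
      fun U => ?_⟩
    · rw [ae_map_iff (measurable_principalVec hM).aemeasurable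
        (measurableSet_eq_fun (by fun_prop) measurable_const)]
      filter_upwards [gaussFrame_ae_topEig_ne_zero hN hM] with a ha
      exact (principalVec_spec hM ha).1
    · rw [Measure.map_map (by fun_prop) (measurable_principalVec hM)]
      conv_rhs => rw [← gaussFrame_map_isometry U, Measure.map_map (measurable_principalVec hM)
        (by fun_prop)]
      congr 1
      exact funext fun a => (principalVec_isometry hM U a).symm
  refine ⟨hprob, hiso, fun q hq hl c => ?_⟩
  have hf : Measurable fun a : Fin N → CVec M =>
      topEig a * ‖gsResidual q (principalVec a)‖ ^ 2 :=
    (measurable_topEig hM).mul (((measurable_gsResidual_const q).comp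
      (measurable_principalVec hM)).norm.pow_const 2)
  have hset : MeasurableSet {y : ℝ × CVec M | y.1 * ‖gsResidual q y.2‖ ^ 2 = c} :=
    measurableSet_eq_fun (measurable_fst.mul (((measurable_gsResidual_const q).comp
      measurable_snd).norm.pow_const 2)) measurable_const
  rw [userMeasure, Measure.map_apply hpair hset]
  change gaussFrame N M {a | topEig a * ‖gsResidual q (principalVec a)‖ ^ 2 = c} = 0
  by_cases hc : c = 0
  · have h1 := hiso.gsResidual_ne_zero hq hl
    rw [hsnd] at h1
    have h2 : ∀ᵐ a ∂gaussFrame N M, topEig a * ‖gsResidual q (principalVec a)‖ ^ 2 ≠ c := by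
      filter_upwards [ae_of_ae_map (measurable_principalVec hM).aemeasurable h1,
        gaussFrame_ae_topEig_ne_zero hN hM] with a h3 h4
      rw [hc]
      exact mul_ne_zero h4 (pow_ne_zero _ (norm_ne_zero_iff.2 h3))
    rw [ae_iff] at h2
    simpa using h2
  · refine gaussFrame_level_eq_zero hf (fun s hs a => ?_) hc
    rw [topEig_smul s a hs, principalVec_smul hM hs, mul_assoc]

end Frame

/-! ### From the channel entries to independent users. -/

lemma pi_map_curry {ι κ X : Type*} [Fintype ι] [Fintype κ] [MeasurableSpace X] (μ : Measure X)
    [IsProbabilityMeasure μ] :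
    (Measure.pi fun _ : ι × κ => μ).map (MeasurableEquiv.curry ι κ X)
      = Measure.pi fun _ : ι => Measure.pi fun _ : κ => μ := by
  have h : (Measure.pi fun _ : ι × κ => μ)
      = (Measure.pi fun _ : ι => Measure.pi fun _ : κ => μ).map
        (MeasurableEquiv.curry ι κ X).symm := by
    refine Measure.pi_eq fun s hs => ?_
    rw [MeasurableEquiv.map_apply]
    have : (MeasurableEquiv.curry ι κ X).symm ⁻¹' Set.univ.pi s
        = Set.univ.pi fun i => Set.univ.pi fun j => s (i, j) := by
      ext z
      simp [Set.mem_pi, Prod.forall, Function.uncurry]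
    rw [this, Measure.pi_pi, Fintype.prod_prod_type]
    simp_rw [Measure.pi_pi]
  rw [h, Measure.map_map (MeasurableEquiv.measurable _) (MeasurableEquiv.measurable _)]
  simp

lemma stdComplexGaussian_map_conj :
    stdComplexGaussian.map (starRingEnd ℂ) = stdComplexGaussian := by
  have hc : Measurable (starRingEnd ℂ) := Complex.continuous_conj.measurable
  have := Measure.isProbabilityMeasure_map (μ := stdComplexGaussian) hc.aemeasurable
  refine Measure.ext_of_charFun (funext fun t => ?_)
  have h : ∀ x : ℂ, (inner ℝ ((starRingEnd ℂ) x) t : ℝ) = inner ℝ x ((starRingEnd ℂ) t) := by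
    intro x
    simp [Complex.inner]
  rw [charFun_apply, integral_map hc.aemeasurable (by fun_prop)]
  simp_rw [h]
  rw [← charFun_apply, charFun_stdComplexGaussian, charFun_stdComplexGaussian, RCLike.norm_conj]

section ChannelFrame

variable {Ω : Type*} {N M : ℕ} {h : ℕ → Fin N → Fin M → Ω → ℂ} {v : ℕ → Ω → CVec M}

/-- The conjugated rows of the channel matrix of user `k`. -/
def channelFrame (h : ℕ → Fin N → Fin M → Ω → ℂ) (k : ℕ) (ω : Ω) (i : Fin N) : CVec M :=
  WithLp.toLp 2 fun j => (starRingEnd ℂ) (h k i j ω)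

lemma rowMatrix_channelFrame (k : ℕ) (ω : Ω) : rowMatrix (channelFrame h k ω) = channel h k ω := by
  ext i j
  simp [rowMatrix, channelFrame, channel]

/-- The eigenvalues and the canonical eigenvectors of the first `K` users. -/
def userConfig (h : ℕ → Fin N → Fin M → Ω → ℂ) (K : ℕ) (ω : Ω) (k : Fin K) : ℝ × CVec M :=
  (topEig (channelFrame h k ω), principalVec (channelFrame h k ω))

/-- Only the basis retains the phases of the given `v`, and residual norms do not see them. -/
lemma downlinkState_eq {K : ℕ} {ω : Ω}
    (hω : ∀ k : Fin K, PhaseEq (v k ω) (vecOf (userConfig h K ω) k)) (δ : ℝ) (j : ℕ) :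
    downlinkState h v K δ (j + 1) ω =
      { cand := susCand (vecOf (userConfig h K ω)) δ Finset.univ
          (susHist (lamOf (userConfig h K ω)) (vecOf (userConfig h K ω)) δ Finset.univ j)
        basis := gsList (fun k : Fin K => v k ω)
          (susHist (lamOf (userConfig h K ω)) (vecOf (userConfig h K ω)) δ Finset.univ j) } := by
  have hlam : (fun k : Fin K => maxGramEigenvalue (channel h k ω))
      = lamOf (userConfig h K ω) :=
    funext fun k => by rw [← rowMatrix_channelFrame]; rfl
  rw [downlinkState, susState_eq, hlam, susHist_phase (v := fun k : Fin K => v k ω) hω,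
    susCand_phase (v := fun k : Fin K => v k ω) hω]

end ChannelFrame

section Channel

variable {Ω : Type*} [MeasurableSpace Ω] {P : Measure Ω} {N M : ℕ}
  {h : ℕ → Fin N → Fin M → Ω → ℂ} {v : ℕ → Ω → CVec M}

lemma map_channelFrame (hm : ∀ k i j, Measurable (h k i j))
    (hlaw : ∀ k i j, P.map (h k i j) = stdComplexGaussian)
    (hind : iIndepFun (fun (a : ℕ × Fin N × Fin M) ω => h a.1 a.2.1 a.2.2 ω) P) (K : ℕ) :
    P.map (fun ω (k : Fin K) => channelFrame h k ω)
      = Measure.pi fun _ : Fin K => gaussFrame N M := by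
  have := hind.isProbabilityMeasure
  have hflat : P.map (fun ω (b : Fin K × Fin N × Fin M) => h b.1 b.2.1 b.2.2 ω)
      = Measure.pi fun _ => stdComplexGaussian := by
    have h1 := hind.precomp (g := fun b : Fin K × Fin N × Fin M => ((b.1 : ℕ), b.2))
      (fun b b' hb => by
        obtain ⟨h1, h2⟩ := Prod.mk.inj hb
        exact Prod.ext (Fin.ext h1) h2)
    rw [iIndepFun_iff_map_fun_eq_pi_map fun b => (hm _ _ _).aemeasurable] at h1
    rw [h1]
    congr 1
    exact funext fun b => hlaw _ _ _
  have hK := pi_map_curry (ι := Fin K) (κ := Fin N × Fin M) stdComplexGaussian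
  rw [← hflat, Measure.map_map (MeasurableEquiv.measurable _)
    (measurable_pi_lambda _ fun b => hm _ _ _)] at hK
  have hg : Measurable fun (H : Fin N × Fin M → ℂ) i =>
      (WithLp.toLp 2 fun j => (starRingEnd ℂ) (H (i, j)) : CVec M) := by
    have := Complex.continuous_conj.measurable
    fun_prop
  have hgmap : (Measure.pi fun _ : Fin N × Fin M => stdComplexGaussian).map
      (fun (H : Fin N × Fin M → ℂ) i =>
        (WithLp.toLp 2 fun j => (starRingEnd ℂ) (H (i, j)) : CVec M)) = gaussFrame N M := by
    have hc : Measurable (starRingEnd ℂ) := Complex.continuous_conj.measurable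
    have hp := Measure.isProbabilityMeasure_map (μ := stdComplexGaussian) hc.aemeasurable
    have h2 := Measure.pi_map_pi (μ := fun _ : Fin N × Fin M => stdComplexGaussian)
      (f := fun _ => starRingEnd ℂ) fun _ => hc.aemeasurable
    rw [stdComplexGaussian_map_conj] at h2
    rw [gaussFrame_eq_map, ← pi_map_curry]
    conv_rhs => rw [← h2]
    rw [Measure.map_map (MeasurableEquiv.measurable _) (by fun_prop),
      Measure.map_map (by fun_prop) (by fun_prop)]
    rfl
  have hp : IsProbabilityMeasure ((Measure.pi fun _ : Fin N × Fin M => stdComplexGaussian).map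
      (fun (H : Fin N × Fin M → ℂ) i =>
        (WithLp.toLp 2 fun j => (starRingEnd ℂ) (H (i, j)) : CVec M))) :=
    Measure.isProbabilityMeasure_map hg.aemeasurable
  have h3 := Measure.pi_map_pi (μ := fun _ : Fin K =>
    Measure.pi fun _ : Fin N × Fin M => stdComplexGaussian) (f := fun _ H i =>
        (WithLp.toLp 2 fun j => (starRingEnd ℂ) (H (i, j)) : CVec M)) fun _ => hg.aemeasurable
  rw [hgmap, ← hK, Measure.map_map (by fun_prop) (by
    refine (MeasurableEquiv.measurable _).comp (measurable_pi_lambda _ fun b => hm _ _ _))] at h3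
  exact h3

lemma measurable_channelFrame (hm : ∀ k i j, Measurable (h k i j)) (k : ℕ) :
    Measurable (channelFrame h k) := by
  have := Complex.continuous_conj.measurable
  unfold channelFrame
  fun_prop

lemma measurable_userConfig (hM : 0 < M) (hm : ∀ k i j, Measurable (h k i j)) (K : ℕ) :
    Measurable (userConfig h K) :=
  measurable_pi_lambda _ fun k => ((measurable_topEig hM).comp (measurable_channelFrame hm k)).prodMk
    ((measurable_principalVec hM).comp (measurable_channelFrame hm k))

lemma map_userConfig (hN : 0 < N) (hM : 0 < M) (hm : ∀ k i j, Measurable (h k i j))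
    (hlaw : ∀ k i j, P.map (h k i j) = stdComplexGaussian)
    (hind : iIndepFun (fun (a : ℕ × Fin N × Fin M) ω => h a.1 a.2.1 a.2.2 ω) P) (K : ℕ) :
    P.map (userConfig h K) = Measure.pi fun _ : Fin K => userMeasure N M := by
  have hpair : Measurable fun a : Fin N → CVec M => (topEig a, principalVec a) :=
    (measurable_topEig hM).prodMk (measurable_principalVec hM)
  have hp : IsProbabilityMeasure ((gaussFrame N M).map fun a => (topEig a, principalVec a)) :=
    (userLaw_userMeasure hN hM).isProbabilityMeasure
  have h1 := Measure.pi_map_pi (μ := fun _ : Fin K => gaussFrame N M)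
    (f := fun _ a => (topEig a, principalVec a)) fun _ => hpair.aemeasurable
  rw [← map_channelFrame hm hlaw hind K, Measure.map_map
    (show Measurable fun (a : Fin K → Fin N → CVec M) k => (topEig (a k), principalVec (a k)) from
      measurable_pi_lambda _ fun k => hpair.comp (measurable_pi_apply k))
    (measurable_pi_lambda _ fun k : Fin K => measurable_channelFrame hm k)] at h1
  exact h1

lemma ae_phaseEq (hN : 0 < N) (hM : 0 < M) (hm : ∀ k i j, Measurable (h k i j))
    (hlaw : ∀ k i j, P.map (h k i j) = stdComplexGaussian)
    (hind : iIndepFun (fun (a : ℕ × Fin N × Fin M) ω => h a.1 a.2.1 a.2.2 ω) P)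
    (hv : ∀ k ω, IsPrincipalVector (channel h k ω) (v k ω)) (K : ℕ) :
    ∀ᵐ ω ∂P, ∀ k : Fin K, PhaseEq (v k ω) (vecOf (userConfig h K ω) k) := by
  rw [ae_all_iff]
  intro k
  have h1 : ∀ᵐ A ∂(Measure.pi fun _ : Fin K => gaussFrame N M), ∀ x : CVec M, ‖x‖ = 1 →
      gramOp (A k) x = (topEig (A k) : ℂ) • x → PhaseEq x (principalVec (A k)) :=
    (measurePreserving_eval (fun _ : Fin K => gaussFrame N M) k).quasiMeasurePreserving.ae
      (gaussFrame_ae_phaseEq hN hM)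
  rw [← map_channelFrame hm hlaw hind K] at h1
  filter_upwards [ae_of_ae_map (measurable_pi_lambda _ fun k : Fin K =>
    measurable_channelFrame hm k).aemeasurable h1] with ω hω
  have h2 := hv k ω
  rw [← rowMatrix_channelFrame, isPrincipalVector_rowMatrix_iff] at h2
  exact hω _ h2.1 h2.2

end Channel

/-! ### The large-system limit for the channel model. -/

section LargeSystem

variable {Ω : Type*} [MeasurableSpace Ω] {P : Measure Ω} {N m k : ℕ}
  {h : ℕ → Fin N → Fin (m + 1 + (k + 1)) → Ω → ℂ} {v : ℕ → Ω → CVec (m + 1 + (k + 1))}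

/-- The phase of `v k` may depend on anything, so the vectors `v k` need not be independent. Almost
sure phase equality with the canonical vectors is enough to transfer both probabilities to the
product law. -/
lemma susCDF_eq (hN : 0 < N) (hm : ∀ k i j, Measurable (h k i j))
    (hlaw : ∀ k i j, P.map (h k i j) = stdComplexGaussian)
    (hind : iIndepFun (fun (a : ℕ × Fin N × Fin (m + 1 + (k + 1))) ω => h a.1 a.2.1 a.2.2 ω) P)
    (hv : ∀ k ω, IsPrincipalVector (channel h k ω) (v k ω)) {K : ℕ} (l : Fin K) (δ : ℝ) :
    P.real (candEvent h v δ (m + 2) l) =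
      (Measure.pi fun _ : Fin K => userMeasure N (m + 1 + (k + 1))).real {z |
        l ∈ susCand (vecOf z) δ Finset.univ (susHist (lamOf z) (vecOf z) δ Finset.univ (m + 1))} ∧
    ∀ x, susCDF P h v δ (m + 2) l x =
      (cond (Measure.pi fun _ : Fin K => userMeasure N (m + 1 + (k + 1))) {z |
        l ∈ susCand (vecOf z) δ Finset.univ
          (susHist (lamOf z) (vecOf z) δ Finset.univ (m + 1))}).real
        {z | ‖gsResidual (gsList (vecOf z) (susHist (lamOf z) (vecOf z) δ Finset.univ (m + 1)))
          (vecOf z l)‖ ^ 2 ≤ x} := by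
  have hM : 0 < m + 1 + (k + 1) := by omega
  have hFm := measurable_userConfig hM hm K
  have hF := map_userConfig hN hM hm hlaw hind K
  set A := {z : Fin K → ℝ × CVec (m + 1 + (k + 1)) | l ∈ susCand (vecOf z) δ Finset.univ
    (susHist (lamOf z) (vecOf z) δ Finset.univ (m + 1))} with hA
  have hAm : MeasurableSet A :=
    measurableSet_susHist measurable_lamOf measurable_vecOf δ Finset.univ (m + 1)
      (Φ := fun p z => l ∈ susCand (vecOf z) δ Finset.univ p) fun p =>
        measurableSet_mem_susCand measurable_vecOf δ Finset.univ p l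
  have hae := ae_phaseEq hN hM hm hlaw hind hv K
  have hC : candEvent h v δ (m + 2) l =ᵐ[P] userConfig h K ⁻¹' A := by
    filter_upwards [hae] with ω hω
    refine propext ?_
    change l ∈ (downlinkState h v K δ (m + 1 + 1) ω).cand ↔ userConfig h K ω ∈ A
    rw [downlinkState_eq hω]
    rfl
  constructor
  · rw [measureReal_congr hC, measureReal_def, measureReal_def, ← hF, Measure.map_apply hFm hAm]
  · intro x
    set B := {z : Fin K → ℝ × CVec (m + 1 + (k + 1)) |
      ‖gsResidual (gsList (vecOf z) (susHist (lamOf z) (vecOf z) δ Finset.univ (m + 1)))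
        (vecOf z l)‖ ^ 2 ≤ x} with hB
    have hBm : MeasurableSet B :=
      measurableSet_susHist measurable_lamOf measurable_vecOf δ Finset.univ (m + 1)
        (Φ := fun p z => ‖gsResidual (gsList (vecOf z) p) (vecOf z l)‖ ^ 2 ≤ x) fun p =>
          measurableSet_le ((measurable_gsResidual measurable_vecOf p
            (measurable_vecOf l)).norm.pow_const 2) measurable_const
    have hD : {ω | projVar h v δ (m + 2) l ω ≤ x} =ᵐ[P] userConfig h K ⁻¹' B := by
      filter_upwards [hae] with ω hω
      refine propext ?_
      change ‖gsResidual (downlinkState h v K δ (m + 1 + 1) ω).basis (v l ω)‖ ^ 2 ≤ x ↔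
        userConfig h K ω ∈ B
      rw [downlinkState_eq hω, norm_gsResidual_phase (v := fun k : Fin K => v k ω) hω]
      rfl
    have hcond : cond P (candEvent h v δ (m + 2) l) = cond P (userConfig h K ⁻¹' A) := by
      rw [ProbabilityTheory.cond, ProbabilityTheory.cond, measure_congr hC,
        Measure.restrict_congr_set hC]
    rw [susCDF, hcond, measureReal_congr (cond_absolutelyContinuous.ae_eq hD), measureReal_def,
      measureReal_def, cond_apply (hFm hAm), cond_apply hAm, ← hF, Measure.map_apply hFm hAm,
      Measure.map_apply hFm (hAm.inter hBm)]
    rfl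

lemma eventually_abs_susCDF_sub_lt (hN : 0 < N) (hm : ∀ k i j, Measurable (h k i j))
    (hlaw : ∀ k i j, P.map (h k i j) = stdComplexGaussian)
    (hind : iIndepFun (fun (a : ℕ × Fin N × Fin (m + 1 + (k + 1))) ω => h a.1 a.2.1 a.2.2 ω) P)
    (hv : ∀ k ω, IsPrincipalVector (channel h k ω) (v k ω)) {δ : ℕ → ℝ} (hδ : ∀ K, 0 < δ K)
    (hδ1 : ∀ K, δ K < 1 / (m + 1 + k : ℝ))
    (hlim : Tendsto (fun K : ℕ => (K : ℝ) * δ K ^ (m + 1 + k)) atTop atTop) {ε : ℝ} (hε : 0 < ε) :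
    ∀ᶠ K : ℕ in atTop, ∀ l : Fin K, 0 < P.real (candEvent h v (δ K) (m + 2) l) ∧
      ∀ x : ℝ, |susCDF P h v (δ K) (m + 2) l x
        - betaFormula (m + 1 + k + 1) (m + 2) (δ K) x| < ε := by
  filter_upwards [(userLaw_userMeasure (M := m + 1 + (k + 1)) hN
    (by omega)).eventually_abs_cond_sub_lt hδ hδ1 hlim hε] with K hK l
  obtain ⟨h1, h2⟩ := susCDF_eq hN hm hlaw hind hv l (δ K)
  rw [h1]
  refine ⟨(hK l).1, fun x => ?_⟩
  rw [h2]
  exact (hK l).2 x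

end LargeSystem

end

theorem lemma4 {Ω : Type*} [MeasurableSpace Ω] (P : Measure Ω) [IsProbabilityMeasure P]
    (N M n : ℕ) (hN : 1 ≤ N) (hn : 2 ≤ n) (hnM : n ≤ M) :
    -- The c.d.f. of the projection variable of an isotropic unit vector `v` that is independent of
    -- the orthonormal vectors `q_1, …, q_{n-1}`, its closed form for `n = 2`, and its bounds.
    (∀ (δ : ℝ) (v : Ω → CVec M) (q : Fin (n - 1) → Ω → CVec M),
      0 < δ → δ < 1 / ((M : ℝ) - 1) →
      IsIsotropicUnit P v →
      (∀ i, Measurable (q i)) →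
      (∀ᵐ ω ∂P, Orthonormal ℂ (fun i => q i ω)) →
      IndepFun v (fun ω i => q i ω) P →
        P.real (semiOrthEvent v q δ) = muPoly M n δ ∧
        ∀ x : ℝ,
          betaCDF P v q δ x = betaFormula M n δ x ∧
          (n = 2 → betaCDF P v q δ x = betaFormulaTwo M δ x) ∧
          betaLower M n δ x ≤ betaCDF P v q δ x ∧
          betaCDF P v q δ x ≤ betaUpper M n δ x ∧
          (n = 2 → betaLower M n δ x = betaCDF P v q δ x ∧
            betaCDF P v q δ x = betaUpper M n δ x)) ∧
    -- The same facts for the explicit function.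
    (∀ δ : ℝ, 0 < δ → δ < 1 / ((M : ℝ) - 1) →
      0 < muPoly M n δ ∧
      ∀ x : ℝ,
        betaLower M n δ x ≤ betaFormula M n δ x ∧
        betaFormula M n δ x ≤ betaUpper M n δ x ∧
        (n = 2 → betaFormula M n δ x = betaFormulaTwo M δ x ∧
          betaLower M n δ x = betaFormula M n δ x ∧
          betaFormula M n δ x = betaUpper M n δ x)) ∧
    -- It is the large-system c.d.f. of `β_k(n)`, given `k ∈ U_n`, in the selection procedure with
    -- `K` users: the difference tends to `0` as `K → ∞`, uniformly in `x` and in the user `k`.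
    (∀ (h : ℕ → Fin N → Fin M → Ω → ℂ) (v : ℕ → Ω → CVec M) (δ : ℕ → ℝ),
      (∀ k i j, Measurable (h k i j)) →
      (∀ k i j, P.map (h k i j) = stdComplexGaussian) →
      iIndepFun (fun (a : ℕ × Fin N × Fin M) ω => h a.1 a.2.1 a.2.2 ω) P →
      (∀ k, Measurable (v k)) →
      (∀ k ω, IsPrincipalVector (channel h k ω) (v k ω)) →
      (∀ K, 0 < δ K) →
      (∀ K, δ K < 1 / ((M : ℝ) - 1)) →
      Tendsto (fun K : ℕ => (K : ℝ) * δ K ^ (M - 1)) atTop atTop →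
        ∀ ε > 0, ∀ᶠ K : ℕ in atTop, ∀ k : Fin K,
          0 < P.real (candEvent h v (δ K) n k) ∧
          ∀ x : ℝ, |susCDF P h v (δ K) n k x - betaFormula M n (δ K) x| < ε) := by
  -- With `n = m + 2` and `k = M - n` the truncated subtractions disappear, and `M - 1 = m + 1 + k`.
  obtain ⟨m, rfl⟩ : ∃ m, n = m + 2 := ⟨n - 2, by omega⟩
  obtain ⟨k, rfl⟩ : ∃ k, M = m + 1 + (k + 1) := ⟨M - m - 2, by omega⟩
  have hMr : ((m + 1 + (k + 1) : ℕ) : ℝ) - 1 = m + 1 + k := by push_cast; ring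
  rw [hMr]
  have hexplicit : ∀ δ : ℝ, 0 < δ → δ < 1 / (m + 1 + k : ℝ) →
      0 < muPoly (m + 1 + (k + 1)) (m + 2) δ ∧
      ∀ x : ℝ,
        betaLower (m + 1 + (k + 1)) (m + 2) δ x ≤ betaFormula (m + 1 + (k + 1)) (m + 2) δ x ∧
        betaFormula (m + 1 + (k + 1)) (m + 2) δ x ≤ betaUpper (m + 1 + (k + 1)) (m + 2) δ x ∧
        (m + 2 = 2 →
          betaFormula (m + 1 + (k + 1)) (m + 2) δ x = betaFormulaTwo (m + 1 + (k + 1)) δ x ∧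
          betaLower (m + 1 + (k + 1)) (m + 2) δ x = betaFormula (m + 1 + (k + 1)) (m + 2) δ x ∧
          betaFormula (m + 1 + (k + 1)) (m + 2) δ x = betaUpper (m + 1 + (k + 1)) (m + 2) δ x) := by
    intro δ hδ hδ1
    refine ⟨muPoly_pos m k hδ hδ1, fun x => ⟨betaLower_le m k hδ hδ1 x, le_betaUpper m k hδ hδ1 x,
      fun h2 => ?_⟩⟩
    obtain rfl : m = 0 := by omega
    exact betaFormula_two k hδ (by simpa using hδ1) x
  refine ⟨fun δ v q hδ hδ1 hv hqm hq hind => ?_, hexplicit, ?_⟩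
  · refine ⟨semiOrthEvent_eq hv hqm hq hind hδ hδ1, fun x => ?_⟩
    have hβ : betaCDF P v q δ x = betaFormula (m + 1 + (k + 1)) (m + 2) δ x :=
      betaCDF_eq_betaFormula hv hqm hq hind hδ hδ1 x
    obtain ⟨h1, h2, h3⟩ := (hexplicit δ hδ hδ1).2 x
    rw [hβ]
    exact ⟨rfl, fun hn => (h3 hn).1, h1, h2, fun hn => (h3 hn).2⟩
  · intro h v δ hm hlaw hind _ hv hδ hδ1 hlim ε hε
    exact eventually_abs_susCDF_sub_lt hN hm hlaw hind hv hδ hδ1 hlim hε
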